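/- Let $d\ge 1$ be an integer, $0\le s\le 1$, $1\le \gamma',p,q<+\infty$, $0<\alpha<d$, $0<\beta_1,\beta_2<+\infty$, and $\tau',\alpha_{1,1},\alpha_{1,2},\alpha_{2,1},\alpha_{2,2}\in\mathbb{R}$. Set $\alpha_1=\alpha_{1,1}+\alpha_{1,2}$, $\alpha_2=\alpha_{2,1}+\alpha_{2,2}$, and define $\sigma$ and $\gamma$ by $$\sigma=\beta_1p\,\alpha_1+\beta_2q\,\alpha_2,\qquad (d-sp)\beta_1+(d+\alpha)\beta_2=\frac d\gamma .$$ Assume that $$\beta_1p+2\beta_2q=1,\qquad \frac1{\gamma'}+\frac{\tau'}d=\frac1\gamma+\frac\sigma d,\qquad \gamma\ge\gamma',\qquad 1<\gamma<+\infty,$$ and that either $$\beta_1\gamma'+\beta_2\gamma'\ge 1,$$ or $$\frac1p\,(sp-d-\alpha_1p)+\frac1{2q}\,(\alpha+d+\alpha_2q)\ne 0\quad\text{and}\quad \beta_1\gamma+\beta_2\gamma>1 .$$ For a (real- or complex-valued) function $g$ on $\mathbb{R}^d$ put $$\|g\|_{\dot W^{s,p,\alpha_{1,1},\alpha_{1,2}}}^p=\begin{cases}\displaystyle\int_{\mathbb{R}^d}|g(x)|^p|x|^{\alpha_1p}\,dx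 & \text{if } s=0,\\[6pt] \displaystyle\int_{\mathbb{R}^d}\int_{\mathbb{R}^d}\frac{|g(x)-g(y)|^p\,|x|^{\alpha_{1,1}p}\,|y|^{\alpha_{1,2}p}}{|x-y|^{d+sp}}\,dx\,dy & \text{if } 0<s<1,\\[6pt] \displaystyle\int_{\mathbb{R}^d}|\nabla g(x)|^p|x|^{\alpha_1p}\,dx & \text{if } s=1,\end{cases}$$ where $\nabla g$ is the weak gradient of $g$ on $\mathbb{R}^d\setminus\{0\}$ (in particular it is the weak gradient on $\mathbb{R}^d$ if that exists), and the value for $s=1$ is $+\infty$ if $g$ has no locally integrable weak gradient there. Then there is a constant $C>0$, independent of $g$, such that $$\left(\int_{\mathbb{R}^d}|g|^{\gamma'}|x|^{\tau'\gamma'}\,dx\right)^{\frac1{\gamma'}}\le C\,\|g\|_{\dot W^{s,p,\alpha_{1,1},\alpha_{1,2}}}^{p\beta_1}\left(\int_{\mathbb{R}^d}\int_{\mathbb{R}^d}\frac{|g(x)|^q|g(y)|^q\,|x|^{\alpha_{2,1}q}\,|y|^{\alpha_{2,2}q}}{|x-y|^{d-\alpha}}\,dx\,dy\right)^{\beta_2}$$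 holds, with both sides in $[0,+\infty]$ (so that it is trivial if the right-hand side is $+\infty$, with $0\cdot\infty=0$), in each of the following two cases: - $\dfrac1{\gamma'}+\dfrac{\tau'}d>0$ and $g\in L^1(\mathbb{R}^d)$ has compact support; - $\dfrac1{\gamma'}+\dfrac{\tau'}d<0$ and $g\in L^1_{loc}(\mathbb{R}^d)$ vanishes in a neighborhood of $0$. -/

import Mathlib

open MeasureTheory Topology
open scoped ENNReal NNReal ContDiff

/-- `G` is a weak gradient of `g` on the open set `Ω ⊆ ℝ^d`: both are locally integrable on `Ω`, and
`∫ g ∂ᵢφ = - ∫ Gᵢ φ` for every coordinate `i` and every test function `φ ∈ C_c^∞(Ω)`. -/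
def HasWeakGradientOn {𝕜 : Type*} [RCLike 𝕜] {d : ℕ} (Ω : Set (EuclideanSpace ℝ (Fin d)))
    (g : EuclideanSpace ℝ (Fin d) → 𝕜)
    (G : EuclideanSpace ℝ (Fin d) → EuclideanSpace 𝕜 (Fin d)) : Prop :=
  LocallyIntegrableOn g Ω volume ∧ LocallyIntegrableOn G Ω volume ∧
    ∀ φ : EuclideanSpace ℝ (Fin d) → ℝ, ContDiff ℝ ∞ φ → HasCompactSupport φ → tsupport φ ⊆ Ω →
      ∀ i : Fin d,
        ∫ x, (fderiv ℝ φ x (EuclideanSpace.single i 1)) • g x = - ∫ x, φ x • G x i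

open Classical in
/-- The `p`-th power of the weighted (fractional) Sobolev seminorm of order `s ∈ [0, 1]`, with
weights `|x|^(t₁ p)` and `|y|^(t₂ p)`, as a number in `[0, ∞]`.

For `s = 1` the gradient is the weak gradient on `ℝ^d ∖ {0}` (the weight may be singular at the
origin). It is unique up to null sets, so that the infimum runs over at most one value; the infimum
is `∞` when there is no weak gradient. A weak gradient on all of `ℝ^d` is in particular one on
`ℝ^d ∖ {0}`. -/
noncomputable def weightedSobolevEnergy {𝕜 : Type*} [RCLike 𝕜] {d : ℕ} (s p t₁ t₂ : ℝ)
    (g : EuclideanSpace ℝ (Fin d) → 𝕜) : ℝ≥0∞ :=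
  if s = 0 then
    ∫⁻ x, ENNReal.ofReal (‖g x‖ ^ p * ‖x‖ ^ ((t₁ + t₂) * p))
  else if s = 1 then
    ⨅ (G : EuclideanSpace ℝ (Fin d) → EuclideanSpace 𝕜 (Fin d))
      (_ : HasWeakGradientOn {0}ᶜ g G),
      ∫⁻ x, ENNReal.ofReal (‖G x‖ ^ p * ‖x‖ ^ ((t₁ + t₂) * p))
  else
    ∫⁻ x, ∫⁻ y, ENNReal.ofReal
      (‖g x - g y‖ ^ p * ‖x‖ ^ (t₁ * p) * ‖y‖ ^ (t₂ * p) / ‖x - y‖ ^ ((d : ℝ) + s * p))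

/-- The weighted (fractional) Sobolev seminorm of order `s ∈ [0, 1]`. -/
noncomputable def weightedSobolevSeminorm {𝕜 : Type*} [RCLike 𝕜] {d : ℕ} (s p t₁ t₂ : ℝ)
    (g : EuclideanSpace ℝ (Fin d) → 𝕜) : ℝ≥0∞ :=
  weightedSobolevEnergy s p t₁ t₂ g ^ (1 / p)

/-- The weighted Coulomb energy
`∬ |g(x)|^q |g(y)|^q |x|^(t₁ q) |y|^(t₂ q) / |x - y|^(d - α) dx dy`, as a number in `[0, ∞]`. -/
noncomputable def weightedCoulombEnergy {𝕜 : Type*} [RCLike 𝕜] {d : ℕ} (α q t₁ t₂ : ℝ)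
    (g : EuclideanSpace ℝ (Fin d) → 𝕜) : ℝ≥0∞ :=
  ∫⁻ x, ∫⁻ y, ENNReal.ofReal
    (‖g x‖ ^ q * ‖g y‖ ^ q * ‖x‖ ^ (t₁ * q) * ‖y‖ ^ (t₂ * q) / ‖x - y‖ ^ ((d : ℝ) - α))

/-- The weighted Lebesgue norm `(∫ |g|^r |x|^(τ r) dx)^(1/r)`, as a number in `[0, ∞]`. -/
noncomputable def weightedLebesgueNorm {𝕜 : Type*} [RCLike 𝕜] {d : ℕ} (r τ : ℝ)
    (g : EuclideanSpace ℝ (Fin d) → 𝕜) : ℝ≥0∞ :=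
  (∫⁻ x, ENNReal.ofReal (‖g x‖ ^ r * ‖x‖ ^ (τ * r))) ^ (1 / r)

/-! The weights are nearly constant at distance about R from the origin, so the inequality splits
into an unweighted estimate for the oscillation of g on cubes of size R, a summation over R = 2^k,
and a recovery of g from its oscillations.

Local estimate (`exists_lintegral_cube_le`, `exists_coulomb_sobolev_cube`). Let c be the mean of g
on a cube Q and E_k = {|g - c| ≥ 2^k}. A Calderón–Zygmund decomposition of E_{k+1} produces disjoint
subcubes R in which E_{k+1} has small density, bounded from above and below. If E_k fills half of R,
then E_{k+1} is a small fraction of E_k there, and this contribution is absorbed. Otherwise both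
E_{k+1} and the complement of E_k occupy a fixed proportion of R. The Poincaré inequality for the
truncation of |g - c| between 2^k and 2^{k+1} and the lower bound for the Coulomb kernel on R then
bound 2^{kp} and 2^{2qk} by energies M_k and N_k of that level on R × R. Interpolating with β₁p +
2β₂q = 1 gives 2^{kγ}|R| ≤ C M_k^{β₁γ} N_k^{β₂γ}. Since β₁γ + β₂γ ≥ 1, a discrete Hölder inequality
sums this over the cubes and the levels; the truncated energies of all levels add up to at most a
constant times the full energy. The levels below the mean oscillation are treated by the same
interpolation.

The three Sobolev energies enter only through `HasPoincare`, proved for s = 0, 0 < s < 1 and s = 1.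
For s = 1 it comes from mollifying g and integrating along segments.

Scales (`exists_axisCube_estimate`, `exists_tsum_cubeOsc_le`). The punctured space is covered by
shells around the 2d half-axes, each contained, together with its double, in a cube away from the
origin. On such a cube the weights become powers of R, which cancel by the scaling relation. If β₁γ'
+ β₂γ' ≥ 1, discrete Hölder sums over the scales. Otherwise β₁ and β₂ are moved slightly in both
directions along β₁p + 2β₂q = 1; the nonvanishing condition makes the two resulting bounds grow and
decay geometrically in R, and their minimum is summable, with a sum governed by the unperturbed
product.

Recovery (`exists_tsum_shellNorm_le`). The shells of sizes R and 2R lie in one cube, so g(x) and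
g(2x) differ by an oscillation. The sign of 1/γ' + τ'/d decides in which direction this recursion
contracts, and the support hypothesis makes it start at zero. -/

/-! ### Series in [0, ∞] -/

/-- Carrying the last term along in the induction avoids subtracting the series from itself, so no
finiteness of y is presupposed. -/
theorem ENNReal.tsum_le_of_le_mul_add {y A : ℕ → ℝ≥0∞} {r : ℝ≥0∞} (hr : r < 1)
    (h : ∀ n, y (n + 1) ≤ r * y n + A n) :
    ∑' n, y n ≤ (1 - r)⁻¹ * (y 0 + ∑' n, A n) := by
  set c := (1 - r)⁻¹ with hc
  have h0 : 1 - r ≠ 0 := (tsub_pos_of_lt hr).ne'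
  have hc1 : 1 + c * r = c := by
    have h1 : c * (1 - r) = 1 := ENNReal.inv_mul_cancel h0 (by finiteness)
    calc 1 + c * r = c * (1 - r) + c * r := by rw [h1]
      _ = c * ((1 - r) + r) := by ring
      _ = c := by rw [tsub_add_cancel_of_le hr.le, mul_one]
  have key : ∀ N, ∑ n ∈ Finset.range N, y n + c * y N
      ≤ c * (y 0 + ∑ n ∈ Finset.range N, A n) := by
    intro N
    induction N with
    | zero => simp
    | succ N ih =>
      rw [Finset.sum_range_succ, Finset.sum_range_succ]
      calc ∑ n ∈ Finset.range N, y n + y N + c * y (N + 1)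
          ≤ ∑ n ∈ Finset.range N, y n + y N + c * (r * y N + A N) := by gcongr; exact h N
        _ = ∑ n ∈ Finset.range N, y n + (1 + c * r) * y N + c * A N := by ring
        _ = (∑ n ∈ Finset.range N, y n + c * y N) + c * A N := by rw [hc1]
        _ ≤ c * (y 0 + ∑ n ∈ Finset.range N, A n) + c * A N := by gcongr
        _ = _ := by ring
  refine ENNReal.tsum_le_of_sum_range_le fun N => ?_
  calc ∑ n ∈ Finset.range N, y n ≤ _ := le_self_add
    _ ≤ _ := key N
    _ ≤ _ := by gcongr; exact ENNReal.sum_le_tsum _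

theorem ENNReal.tsum_rpow_le {ι : Type*} (f : ι → ℝ≥0∞) {c : ℝ} (hc : 1 ≤ c) :
    ∑' i, f i ^ c ≤ (∑' i, f i) ^ c := by
  by_cases h0 : ∑' i, f i = 0
  · have : ∀ i, f i = 0 := by simpa using h0
    simp [this, ENNReal.zero_rpow_of_pos (by linarith : 0 < c)]
  by_cases ht : ∑' i, f i = ⊤
  · simp [ht, ENNReal.top_rpow_of_pos (by linarith : 0 < c)]
  have hcl : ∀ x : ℝ≥0∞, x ^ c = x * x ^ (c - 1) := fun x => by
    conv_rhs => rw [← ENNReal.rpow_one x, ← ENNReal.rpow_mul, one_mul]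
    rw [← ENNReal.rpow_add_of_nonneg _ _ zero_le_one (by linarith)]; simp
  rw [hcl, ← ENNReal.tsum_mul_right]
  refine ENNReal.tsum_le_tsum fun i => ?_
  rw [hcl]
  exact mul_le_mul_right (ENNReal.rpow_le_rpow (ENNReal.le_tsum i) (by linarith)) _

/-- Hölder with the conjugate weights a/(a+b) and b/(a+b), preceded by the embedding of ℓ¹ into
ℓ^{a+b}. This is where the conditions of the form β₁γ + β₂γ ≥ 1 are used. -/
theorem ENNReal.tsum_rpow_mul_rpow_le {ι : Type*} (M N : ι → ℝ≥0∞) {a b : ℝ}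
    (ha : 0 < a) (hb : 0 < b) (hab : 1 ≤ a + b) :
    ∑' i, M i ^ a * N i ^ b ≤ (∑' i, M i) ^ a * (∑' i, N i) ^ b := by
  let _ : MeasurableSpace ι := ⊤
  set c := a + b
  have hc : 0 < c := by positivity
  have h1 : ∀ x y : ℝ≥0∞, x ^ a * y ^ b = (x ^ (a / c) * y ^ (b / c)) ^ c := fun x y => by
    rw [ENNReal.mul_rpow_of_nonneg _ _ hc.le, ← ENNReal.rpow_mul, ← ENNReal.rpow_mul]
    congr 2 <;> field_simp
  simp_rw [h1]
  refine (ENNReal.tsum_rpow_le _ hab).trans ?_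
  gcongr
  have := ENNReal.lintegral_mul_norm_pow_le (μ := Measure.count) (f := M) (g := N)
    (measurable_from_top.aemeasurable) (measurable_from_top.aemeasurable)
    (p := a / c) (q := b / c) (by positivity) (by positivity) (by field_simp; rfl)
  simpa [lintegral_count] using this

theorem ENNReal.tsum_int_le (f : ℤ → ℝ≥0∞) (k : ℤ) :
    ∑' j, f j ≤ ∑' n : ℕ, f (k + n) + ∑' n : ℕ, f (k - n) := by
  have : ∀ j : ℤ, f j ≤ ∑' n : ℕ, (if j = k + n then f j else 0)
      + ∑' n : ℕ, (if j = k - n then f j else 0) := by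
    intro j
    rcases le_total k j with h | h
    · refine le_trans ?_ le_self_add
      refine le_trans ?_ (ENNReal.le_tsum (j - k).toNat)
      rw [if_pos (by omega)]
    · refine le_trans ?_ le_add_self
      refine le_trans ?_ (ENNReal.le_tsum (k - j).toNat)
      rw [if_pos (by omega)]
  refine (ENNReal.tsum_le_tsum this).trans ?_
  rw [ENNReal.tsum_add, ENNReal.tsum_comm,
    ENNReal.tsum_comm (f := fun (j : ℤ) (n : ℕ) => if j = k - n then f j else 0)]
  simp only [tsum_ite_eq, le_refl]

/-- `∑ 2^{kp}` over the integers `k` with `2^k ≤ X`. -/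
theorem tsum_two_zpow_rpow_le {p : ℝ} (hp : 1 ≤ p) (X : ℝ≥0∞) :
    ∑' k : ℤ, (if (2 : ℝ≥0∞) ^ k ≤ X then ((2 : ℝ≥0∞) ^ k) ^ p else 0) ≤ 2 * X ^ p := by
  have hp0 : 0 < p := by linarith
  by_cases hX : X = ⊤
  · simp [hX, ENNReal.top_rpow_of_pos hp0]
  by_cases h0 : X = 0
  · have : ∀ k : ℤ, ¬ ((2 : ℝ≥0∞) ^ k ≤ X) := fun k h => by
      rw [h0] at h
      exact absurd (le_antisymm h zero_le) (ENNReal.zpow_pos (by simp) (by simp) k).ne'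
    simp [this]
  -- The largest admissible power of two dominates: going down from it, the terms decay at least
  -- like 2^{-m} because p ≥ 1, which gives the factor 2.
  obtain ⟨n, hn⟩ := ENNReal.exists_mem_Ico_zpow h0 hX (y := 2) (by norm_num) (by simp)
  have hterm : ∀ k : ℤ, (if (2 : ℝ≥0∞) ^ k ≤ X then ((2 : ℝ≥0∞) ^ k) ^ p else 0)
     ≤ ∑' m : ℕ, if k = n - m then ((2:ℝ≥0∞) ^ k) ^ p else 0 := by
    intro k
    split_ifs with h
    · have hk : k ≤ n := by
        by_contra hlt
        push Not at hlt
        have : (2:ℝ≥0∞) ^ (n+1) ≤ 2 ^ k := ENNReal.zpow_le_of_le (by norm_num) (by omega)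
        exact absurd (this.trans h) (not_le.2 hn.2)
      refine le_trans ?_ (ENNReal.le_tsum (n - k).toNat)
      rw [if_pos (by omega)]
    · exact zero_le
  refine (ENNReal.tsum_le_tsum hterm).trans ?_
  rw [ENNReal.tsum_comm]
  simp only [tsum_ite_eq]
  have hb : ∀ m : ℕ, ((2:ℝ≥0∞) ^ (n - m : ℤ)) ^ p ≤ X ^ p * (2⁻¹) ^ m := by
    intro m
    rw [ENNReal.zpow_sub (by simp) (by simp), ENNReal.mul_rpow_of_nonneg _ _ hp0.le]
    gcongr
    · exact hn.1
    · rw [zpow_natCast, ENNReal.inv_pow]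
      calc ((2⁻¹ : ℝ≥0∞) ^ m) ^ p ≤ ((2⁻¹ : ℝ≥0∞) ^ m) ^ (1:ℝ) :=
            ENNReal.rpow_le_rpow_of_exponent_ge (pow_le_one₀ zero_le (by simp)) hp
        _ = _ := by simp
  calc _ ≤ ∑' m : ℕ, X ^ p * (2⁻¹) ^ m := ENNReal.tsum_le_tsum hb
    _ = 2 * X ^ p := by rw [ENNReal.tsum_mul_left, ENNReal.tsum_geometric_two]; ring

/-! ### Stopping-time selection in a nested family of partitions -/

section Stopping

variable {X ι : Type*}

/-- The cell of generation `n` containing `x`, for a sequence of labellings `c`. -/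
def cell (c : ℕ → X → ι) (n : ℕ) (x : X) : Set X := {y | c n y = c n x}

/-- The maximal cells with property `P`. -/
def maxCells (c : ℕ → X → ι) (P : Set X → Prop) : Set (ℕ × ι) :=
  {i | ∃ x, c i.1 x = i.2 ∧ P (cell c i.1 x) ∧ ∀ m < i.1, ¬ P (cell c m x)}

/-- The cell with generation and label `i`. -/
def labelCell (c : ℕ → X → ι) (i : ℕ × ι) : Set X := {y | c i.1 y = i.2}

variable {c : ℕ → X → ι}

theorem label_eq_of_le (hc : ∀ n x y, c (n + 1) x = c (n + 1) y → c n x = c n y)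
    {m n : ℕ} (hmn : m ≤ n) {x y : X} (h : c n x = c n y) : c m x = c m y := by
  induction n, hmn using Nat.le_induction with
  | base => exact h
  | succ n _ ih => exact ih (hc _ _ _ h)

/-- Cells are nested: if two selected cells met, the one of earlier generation would be an ancestor
of the other with property P, against the minimality of the generation. -/
theorem pairwiseDisjoint_maxCells (hc : ∀ n x y, c (n + 1) x = c (n + 1) y → c n x = c n y)
    (P : Set X → Prop) :
    (maxCells c P).PairwiseDisjoint (labelCell c) := by
  have key : ∀ i ∈ maxCells c P, ∀ j ∈ maxCells c P, ∀ z, z ∈ labelCell c i → z ∈ labelCell c j →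
      i.1 ≤ j.1 := by
    rintro i ⟨x, hx, hP, hmin⟩ j ⟨y, hy, hP', hmin'⟩ z hzi hzj
    by_contra! hlt
    apply hmin j.1 hlt
    have h1 : c j.1 x = c j.1 z := label_eq_of_le hc hlt.le (hx.trans hzi.symm)
    have : cell c j.1 x = cell c j.1 y := by
      unfold cell
      rw [h1, show c j.1 z = j.2 from hzj, hy]
    rwa [this]
  intro i hi j hj hij
  refine Set.disjoint_left.2 fun z hzi hzj => hij ?_
  have h1 : i.1 = j.1 := le_antisymm (key i hi j hj z hzi hzj) (key j hj i hi z hzj hzi)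
  have h2 : c i.1 z = i.2 := hzi
  have h3 : c j.1 z = j.2 := hzj
  exact Prod.ext h1 (by rw [← h2, ← h3, h1])

theorem exists_mem_maxCells {P : Set X → Prop} {x : X} {n : ℕ} (h : P (cell c n x)) :
    ∃ i ∈ maxCells c P, x ∈ labelCell c i := by
  classical
  have hex : ∃ n, P (cell c n x) := ⟨n, h⟩
  exact ⟨(Nat.find hex, c (Nat.find hex) x), ⟨x, rfl, Nat.find_spec hex,
    fun m hm => Nat.find_min hex hm⟩, rfl⟩

end Stopping

/-! ### Dyadic cubes and the Calderón–Zygmund decomposition -/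

section Cube

variable {d : ℕ}

/-- The half-open cube with lower corner `a` and side `L`. -/
def cube (a : EuclideanSpace ℝ (Fin d)) (L : ℝ) : Set (EuclideanSpace ℝ (Fin d)) :=
  {x | ∀ i, a i ≤ x i ∧ x i < a i + L}

theorem measurableSet_cube (a : EuclideanSpace ℝ (Fin d)) (L : ℝ) : MeasurableSet (cube a L) := by
  have : cube a L = ⋂ i, {x | a i ≤ x i} ∩ {x | x i < a i + L} := by
    ext x; simp [cube]
  rw [this]
  exact MeasurableSet.iInter fun i => (measurableSet_le (by fun_prop) (by fun_prop)).inter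
    (measurableSet_lt (by fun_prop) (by fun_prop))

theorem volume_cube (a : EuclideanSpace ℝ (Fin d)) (L : ℝ) :
    volume (cube a L) = ENNReal.ofReal L ^ d := by
  have h : cube a L = (WithLp.ofLp) ⁻¹' (Set.univ.pi fun i => Set.Ico (a i) (a i + L)) := by
    ext x; simp [cube]
  rw [h, (PiLp.volume_preserving_ofLp (Fin d)).measure_preimage
    (MeasurableSet.univ_pi fun i => measurableSet_Ico).nullMeasurableSet, Real.volume_pi_Ico]
  simp

theorem volume_cube_ne_top (a : EuclideanSpace ℝ (Fin d)) (L : ℝ) : volume (cube a L) ≠ ⊤ := by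
  rw [volume_cube]; finiteness

theorem volume_cube_ne_zero (a : EuclideanSpace ℝ (Fin d)) {L : ℝ} (hL : 0 < L) :
    volume (cube a L) ≠ 0 := by
  rw [volume_cube]; simp [hL]

theorem norm_le_card_mul {x : EuclideanSpace ℝ (Fin d)} {r : ℝ} (hr : 0 ≤ r)
    (h : ∀ i, |x i| ≤ r) : ‖x‖ ≤ d * r := by
  rw [EuclideanSpace.norm_eq]
  refine Real.sqrt_le_iff.2 ⟨by positivity, ?_⟩
  calc ∑ i, ‖x i‖ ^ 2 ≤ ∑ _i : Fin d, r ^ 2 := by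
        gcongr with i; exact h i
    _ = d * r ^ 2 := by simp
    _ ≤ d * (d * r ^ 2) := by
        rcases Nat.eq_zero_or_pos d with h0 | h0
        · simp [h0]
        · have : (1:ℝ) ≤ d := by exact_mod_cast h0
          nlinarith [mul_nonneg (by positivity : (0:ℝ) ≤ d) (sq_nonneg r)]
    _ = (d * r) ^ 2 := by ring

theorem norm_sub_le_of_mem_cube {a x y : EuclideanSpace ℝ (Fin d)} {L : ℝ}
    (hx : x ∈ cube a L) (hy : y ∈ cube a L) (hL : 0 < L) : ‖x - y‖ ≤ d * L := by
  refine norm_le_card_mul hL.le fun i => ?_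
  have := hx i; have := hy i
  rw [PiLp.sub_apply, abs_le]; constructor <;> linarith

theorem convex_cube (a : EuclideanSpace ℝ (Fin d)) (L : ℝ) : Convex ℝ (cube a L) := by
  have : cube a L = ⋂ i, (EuclideanSpace.proj (𝕜 := ℝ) i) ⁻¹' Set.Ico (a i) (a i + L) := by
    ext x; simp [cube]
  rw [this]
  exact convex_iInter fun i => (convex_Ico _ _).linear_preimage
    (EuclideanSpace.proj (𝕜 := ℝ) i : EuclideanSpace ℝ (Fin d) →L[ℝ] ℝ).toLinearMap

/-- The label of the dyadic subcube of generation `n` of `cube a L` containing `x`. -/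
noncomputable def dyadicLabel (a : EuclideanSpace ℝ (Fin d)) (L : ℝ) (n : ℕ)
    (x : EuclideanSpace ℝ (Fin d)) : Fin d → ℤ := fun i => ⌊2 ^ n * ((x i - a i) / L)⌋

theorem dyadicLabel_refines (a : EuclideanSpace ℝ (Fin d)) (L : ℝ) (n : ℕ)
    (x y : EuclideanSpace ℝ (Fin d)) (h : dyadicLabel a L (n + 1) x = dyadicLabel a L (n + 1) y) :
    dyadicLabel a L n x = dyadicLabel a L n y := by
  have key : ∀ t : ℝ, ⌊2 ^ n * t⌋ = ⌊2 ^ (n + 1) * t⌋ / 2 := fun t => by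
    have := Int.floor_div_natCast (2 ^ (n + 1) * t) 2
    simp only [Nat.cast_ofNat] at this
    rw [← this]; congr 1; ring
  funext i
  have hi := congrFun h i
  unfold dyadicLabel at hi ⊢
  rw [key, key, hi]

/-- The corner of a dyadic subcube. -/
noncomputable def dyadicCorner (a : EuclideanSpace ℝ (Fin d)) (L : ℝ) (i : ℕ × (Fin d → ℤ)) :
    EuclideanSpace ℝ (Fin d) := WithLp.toLp 2 fun j => a j + L / 2 ^ i.1 * i.2 j

theorem labelCell_dyadicLabel (a : EuclideanSpace ℝ (Fin d)) {L : ℝ} (hL : 0 < L)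
    (i : ℕ × (Fin d → ℤ)) :
    labelCell (dyadicLabel a L) i = cube (dyadicCorner a L i) (L / 2 ^ i.1) := by
  ext x
  simp only [labelCell, Set.mem_ofPred_eq, cube, funext_iff, dyadicLabel, Int.floor_eq_iff,
    dyadicCorner]
  refine forall_congr' fun j => and_congr ?_ ?_
  · rw [← sub_nonneg, ← sub_nonneg (b := a j + _)]
    have : x j - (a j + L / 2 ^ i.1 * (i.2 j))
        = L / 2 ^ i.1 * (2 ^ i.1 * ((x j - a j) / L) - i.2 j) := by field_simp; ring
    rw [this, mul_nonneg_iff_of_pos_left (by positivity)]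
  · rw [← sub_pos, ← sub_pos (b := x j)]
    have : a j + L / 2 ^ i.1 * (i.2 j) + L / 2 ^ i.1 - x j
        = L / 2 ^ i.1 * ((i.2 j) + 1 - 2 ^ i.1 * ((x j - a j) / L)) := by field_simp; ring
    rw [this, mul_pos_iff_of_pos_left (by positivity)]

theorem cell_dyadicLabel (a : EuclideanSpace ℝ (Fin d)) {L : ℝ} (hL : 0 < L) (n : ℕ)
    (x : EuclideanSpace ℝ (Fin d)) :
    cell (dyadicLabel a L) n x
      = cube (dyadicCorner a L (n, dyadicLabel a L n x)) (L / 2 ^ n) :=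
  labelCell_dyadicLabel a hL (n, dyadicLabel a L n x)

theorem mem_cube_iff_dyadicLabel {a : EuclideanSpace ℝ (Fin d)} {L : ℝ} (hL : 0 < L)
    {x : EuclideanSpace ℝ (Fin d)} : x ∈ cube a L ↔ dyadicLabel a L 0 x = 0 := by
  have := labelCell_dyadicLabel a hL (0, 0)
  have h2 : dyadicCorner a L (0, 0) = a := by ext j; simp [dyadicCorner]
  rw [h2] at this
  simp only [pow_zero, div_one] at this
  rw [← this]; rfl

theorem exists_cell_subset (a : EuclideanSpace ℝ (Fin d)) {L : ℝ} (hL : 0 < L)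
    {U : Set (EuclideanSpace ℝ (Fin d))} (hU : IsOpen U) {x : EuclideanSpace ℝ (Fin d)}
    (hx : x ∈ U) : ∃ n, cell (dyadicLabel a L) n x ⊆ U := by
  obtain ⟨ε, hε, hb⟩ := Metric.isOpen_iff.1 hU x hx
  have ht : Filter.Tendsto (fun n : ℕ => (d:ℝ) * L * (1 / 2) ^ n) Filter.atTop (𝓝 ((d:ℝ) * L * 0)) :=
    (tendsto_pow_atTop_nhds_zero_of_lt_one (by norm_num) (by norm_num)).const_mul _
  rw [mul_zero] at ht
  obtain ⟨n, hn⟩ := (ht.eventually (gt_mem_nhds hε)).exists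
  refine ⟨n, fun y hy => hb ?_⟩
  have hx' : x ∈ cell (dyadicLabel a L) n x := rfl
  rw [cell_dyadicLabel a hL] at hy hx'
  rw [Metric.mem_ball, dist_eq_norm]
  refine (norm_sub_le_of_mem_cube hy hx' (by positivity)).trans_lt (lt_of_le_of_lt (le_of_eq ?_) hn)
  rw [one_div, inv_pow]; ring

/-- A Calderón–Zygmund decomposition of a set of small density in a cube. -/
theorem exists_disjoint_cubes (a : EuclideanSpace ℝ (Fin d)) {L : ℝ} (hL : 0 < L)
    {E : Set (EuclideanSpace ℝ (Fin d))} (hEL : E ⊆ cube a L) {δ : ℝ≥0∞} (hδ0 : δ ≠ 0) (hδ : δ < 1)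
    (hE : volume E ≤ δ * (2 ^ d)⁻¹ * volume (cube a L)) :
    ∃ (ι : Type) (_ : Countable ι) (b : ι → EuclideanSpace ℝ (Fin d)) (l : ι → ℝ),
      (∀ i, 0 < l i ∧ l i ≤ L ∧ cube (b i) (l i) ⊆ cube a L) ∧
      Pairwise (Function.onFun Disjoint fun i => cube (b i) (l i)) ∧
      volume (E \ ⋃ i, cube (b i) (l i)) = 0 ∧
      ∀ i, δ * (2 ^ d)⁻¹ * volume (cube (b i) (l i)) ≤ volume (E ∩ cube (b i) (l i)) ∧
        volume (E ∩ cube (b i) (l i)) ≤ δ * volume (cube (b i) (l i)) := by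
  set c := dyadicLabel a L with hcdef
  have hc := dyadicLabel_refines a L
  set P : Set (EuclideanSpace ℝ (Fin d)) → Prop := fun S => δ * (2 ^ d)⁻¹ * volume S < volume (E ∩ S)
    with hP
  have hcell : ∀ i, labelCell c i = cube (dyadicCorner a L i) (L / 2 ^ i.1) :=
    labelCell_dyadicLabel a hL
  refine ⟨maxCells c P, inferInstance, fun i => dyadicCorner a L i, fun i => L / 2 ^ i.1.1,
    ?_, ?_, ?_, ?_⟩
  · rintro ⟨i, x, hx, hPx, -⟩
    refine ⟨by positivity, div_le_self hL.le (one_le_pow₀ (by norm_num)), ?_⟩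
    rw [← hcell]
    -- The labels also describe cells outside the cube. A selected cell meets E, hence has its
    -- generation-zero label in common with a point of the cube.
    have hne : (E ∩ cell c i.1 x).Nonempty := by
      rw [Set.nonempty_iff_ne_empty]; intro h0
      simp only [hP, h0, measure_empty] at hPx
      exact absurd hPx (by simp)
    obtain ⟨z, hzE, hz⟩ := hne
    intro y hy
    rw [mem_cube_iff_dyadicLabel hL, ← (mem_cube_iff_dyadicLabel hL).1 (hEL hzE)]
    exact label_eq_of_le hc (Nat.zero_le i.1) (show c i.1 y = c i.1 z from
      (show c i.1 y = i.2 from hy).trans (hx.symm.trans (show c i.1 z = c i.1 x from hz).symm))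
  · intro i j hij
    simp only [Function.onFun, ← hcell]
    exact pairwiseDisjoint_maxCells hc P i.2 j.2 (fun h => hij (Subtype.ext h))
  · simp only [← hcell]
    set F := E \ ⋃ i : maxCells c P, labelCell c i with hF
    have hFP : ∀ x ∈ F, ∀ n, ¬ P (cell c n x) := by
      intro x hx n hPn
      obtain ⟨i, hi, hxi⟩ := exists_mem_maxCells hPn
      exact hx.2 (Set.mem_iUnion.2 ⟨⟨i, hi⟩, hxi⟩)
    have hFfin : volume F ≠ ⊤ := ne_top_of_le_ne_top (volume_cube_ne_top a L)
      (measure_mono (Set.sdiff_subset.trans hEL))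
    -- This replaces the Lebesgue density theorem: U is partitioned, as far as F is concerned, into
    -- maximal dyadic cells contained in it, and no cell through a point of F is dense. By outer
    -- regularity U can be taken with volume close to that of F, and δ < 1 forces F to be null.
    -- Measurability of E plays no role.
    have key : ∀ U, IsOpen U → F ⊆ U → volume F ≤ δ * volume U := by
      intro U hU hFU
      set P' : Set (EuclideanSpace ℝ (Fin d)) → Prop := fun S => S ⊆ U
      have hcov : F ⊆ ⋃ i : maxCells c P', F ∩ labelCell c i := by
        intro x hx
        obtain ⟨n, hn⟩ := exists_cell_subset a hL hU (hFU hx)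
        obtain ⟨i, hi, hxi⟩ := exists_mem_maxCells (P := P') hn
        exact Set.mem_iUnion.2 ⟨⟨i, hi⟩, hx, hxi⟩
      calc volume F ≤ volume (⋃ i : maxCells c P', F ∩ labelCell c i) := measure_mono hcov
        _ ≤ ∑' i : maxCells c P', volume (F ∩ labelCell c i) := measure_iUnion_le _
        _ ≤ ∑' i : maxCells c P', δ * volume (labelCell c i.1) := by
            refine ENNReal.tsum_le_tsum fun i => ?_
            by_cases hne : (F ∩ labelCell c i.1).Nonempty
            · obtain ⟨x, hxF, hx⟩ := hne
              have hx' : labelCell c i.1 = cell c i.1.1 x := by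
                unfold labelCell cell
                rw [show c i.1.1 x = i.1.2 from hx]
              have := not_lt.1 (hFP x hxF i.1.1)
              rw [← hx'] at this
              calc volume (F ∩ labelCell c i.1) ≤ volume (E ∩ labelCell c i.1) :=
                    measure_mono (Set.inter_subset_inter_left _ Set.sdiff_subset)
                _ ≤ δ * (2 ^ d)⁻¹ * volume (labelCell c i.1) := this
                _ ≤ δ * 1 * volume (labelCell c i.1) := by
                    gcongr
                    exact ENNReal.inv_le_one.2 (one_le_pow₀ (by norm_num))
                _ = _ := by rw [mul_one]
            · rw [Set.not_nonempty_iff_eq_empty.1 hne]; simp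
        _ = δ * volume (⋃ i : maxCells c P', labelCell c i.1) := by
            rw [ENNReal.tsum_mul_left, measure_iUnion]
            · intro i j hij
              exact pairwiseDisjoint_maxCells hc P' i.2 j.2 (fun h => hij (Subtype.ext h))
            · intro i; rw [hcell]; exact measurableSet_cube _ _
        _ ≤ δ * volume U := by
            gcongr
            refine Set.iUnion_subset ?_
            rintro ⟨i, x, hx, hPx, hmin⟩ y hy
            exact hPx ((show c i.1 y = i.2 from hy).trans hx.symm)
    by_contra h0
    have hlt : volume F < δ⁻¹ * volume F := by
      conv_lhs => rw [← one_mul (volume F)]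
      exact ENNReal.mul_lt_mul_left h0 hFfin (ENNReal.one_lt_inv.2 hδ)
    obtain ⟨U, hFU, hU, hUlt⟩ := Set.exists_isOpen_lt_of_lt F _ hlt
    have := (key U hU hFU).trans_lt ((ENNReal.mul_lt_mul_iff_right hδ0 hδ.ne_top).2 hUlt)
    rw [← mul_assoc, ENNReal.mul_inv_cancel hδ0 hδ.ne_top, one_mul] at this
    exact lt_irrefl _ this
  · rintro ⟨i, x, hx, hPx, hmin⟩
    have hxc : cell c i.1 x = labelCell c i := by unfold labelCell cell; rw [hx]
    have hsub : volume (E ∩ labelCell c i) ≤ volume E := measure_mono Set.inter_subset_left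
    simp only [← hcell]
    rw [hxc] at hPx
    refine ⟨hPx.le, ?_⟩
    -- A cell of generation zero has the volume of the whole cube and is excluded by the smallness
    -- of E. Any other cell has a parent that was not selected, which gives the upper density at the
    -- cost of 2^d.
    rcases Nat.eq_zero_or_pos i.1 with h0 | h0
    · exfalso
      have : volume (labelCell c i) = volume (cube a L) := by
        rw [hcell, volume_cube, volume_cube, h0]; simp
      simp only [hP, this] at hPx
      exact absurd (hPx.trans_le (hsub.trans hE)) (lt_irrefl _)
    · obtain ⟨m, hm⟩ : ∃ m, i.1 = m + 1 := ⟨i.1 - 1, by omega⟩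
      have hnP := not_lt.1 (hmin m (by omega))
      have hvol : volume (cell c m x) = 2 ^ d * volume (labelCell c i) := by
        rw [hcell, cell_dyadicLabel a hL, volume_cube, volume_cube, ← mul_pow, hm]
        congr 1
        rw [← ENNReal.ofReal_ofNat, ← ENNReal.ofReal_mul (by norm_num)]
        congr 1; field_simp; ring
      have hss : labelCell c i ⊆ cell c m x := by
        rw [← hxc]
        exact fun y hy => label_eq_of_le hc (by omega) hy
      calc volume (E ∩ labelCell c i) ≤ volume (E ∩ cell c m x) :=
            measure_mono (Set.inter_subset_inter_right _ hss)
        _ ≤ δ * (2 ^ d)⁻¹ * volume (cell c m x) := hnP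
        _ = δ * volume (labelCell c i) := by
            rw [hvol, mul_assoc, ← mul_assoc _ (2 ^ d : ℝ≥0∞), ENNReal.inv_mul_cancel, one_mul]
            · positivity
            · finiteness

end Cube

/-! ### The level set inequality on a cube -/

/-- The relation for β₁ and β₂ lets V be split as (V^p)^{β₁} (V^{2q})^{β₂}, and the relation
defining γ collects the powers of l. It is used with V a truncation height or a mean oscillation. -/
theorem ENNReal.le_of_interpolation {V l M N c₁ c₂ : ℝ≥0∞} {s p q α β₁ β₂ γ D : ℝ}
    (hβ₁ : 0 < β₁) (hβ₂ : 0 < β₂)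
    (hγ : (D - s * p) * β₁ + (D + α) * β₂ = D / γ) (hβ : β₁ * p + 2 * β₂ * q = 1)
    (hl0 : l ≠ 0) (hl : l ≠ ⊤) (hV0 : V ≠ 0) (hV : V ≠ ⊤)
    (h₁ : V ^ p ≤ c₁ * l ^ (s * p - D) * M) (h₂ : V ^ (2 * q) ≤ c₂ * l ^ (-(D + α)) * N) :
    V ≤ c₁ ^ β₁ * c₂ ^ β₂ * l ^ (-(D / γ)) * (M ^ β₁ * N ^ β₂) := by
  calc V = (V ^ p) ^ β₁ * (V ^ (2 * q)) ^ β₂ := by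
        rw [← ENNReal.rpow_mul, ← ENNReal.rpow_mul, ← ENNReal.rpow_add _ _ hV0 hV,
          show p * β₁ + 2 * q * β₂ = 1 by linarith, ENNReal.rpow_one]
    _ ≤ (c₁ * l ^ (s * p - D) * M) ^ β₁ * (c₂ * l ^ (-(D + α)) * N) ^ β₂ := by gcongr
    _ = c₁ ^ β₁ * c₂ ^ β₂ * (l ^ ((s * p - D) * β₁) * l ^ (-(D + α) * β₂)) * (M ^ β₁ * N ^ β₂) := by
        simp only [ENNReal.mul_rpow_of_nonneg _ _ hβ₁.le, ENNReal.mul_rpow_of_nonneg _ _ hβ₂.le,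
          ← ENNReal.rpow_mul]
        ring
    _ = _ := by
        rw [← ENNReal.rpow_add _ _ hl0 hl]
        congr 3
        linarith

/-- Squares over disjoint sets are disjoint. This superadditivity is the reason for encoding all
energies as measures on the product space. -/
theorem MeasureTheory.Measure.tsum_prod_self_le {X ι : Type*} [MeasurableSpace X] [Countable ι]
    (m : Measure (X × X)) {Q : ι → Set X} {S : Set X} (hQ : ∀ i, MeasurableSet (Q i))
    (hd : Pairwise (Function.onFun Disjoint Q)) (hS : ∀ i, Q i ⊆ S) :
    ∑' i, m (Q i ×ˢ Q i) ≤ m (S ×ˢ S) := by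
  rw [← measure_iUnion]
  · exact measure_mono (Set.iUnion_subset fun i => Set.prod_mono (hS i) (hS i))
  · intro i j hij
    exact Set.Disjoint.set_prod_left (hd hij) _ _
  · exact fun i => (hQ i).prod (hQ i)

/-- A strong type John–Nirenberg inequality on cubes, in terms of level sets. -/
theorem exists_lintegral_cube_le {d : ℕ} {s p q α β₁ β₂ γ : ℝ}
    (hβ₁ : 0 < β₁) (hβ₂ : 0 < β₂) (hγ0 : 0 < γ)
    (hγ : (d - s * p) * β₁ + (d + α) * β₂ = d / γ) (hβ : β₁ * p + 2 * β₂ * q = 1)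
    (hβγ : 1 ≤ β₁ * γ + β₂ * γ) {A : ℝ≥0∞} (hA : A ≠ ⊤) :
    ∃ C : ℝ≥0∞, C ≠ ⊤ ∧ ∀ (a : EuclideanSpace ℝ (Fin d)) (L : ℝ)
      (f : EuclideanSpace ℝ (Fin d) → ℝ≥0∞)
      (M N : ℤ → Measure (EuclideanSpace ℝ (Fin d) × EuclideanSpace ℝ (Fin d))) (t : ℝ≥0∞),
      0 < L → Measurable f → (∀ x, f x ≠ ⊤) →
      (∀ (k : ℤ) (b : EuclideanSpace ℝ (Fin d)) (l : ℝ), 0 < l → l ≤ L → cube b l ⊆ cube a L →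
        ((2 : ℝ≥0∞) ^ k) ^ p * volume ({x | (2 : ℝ≥0∞) ^ (k + 1) ≤ f x} ∩ cube b l) *
          volume (cube b l \ {x | (2 : ℝ≥0∞) ^ k ≤ f x}) ≤
          A * ENNReal.ofReal l ^ (d + s * p) * M k (cube b l ×ˢ cube b l)) →
      (∀ (k : ℤ) (b : EuclideanSpace ℝ (Fin d)) (l : ℝ), 0 < l → l ≤ L → cube b l ⊆ cube a L →
        ((2 : ℝ≥0∞) ^ k) ^ (2 * q) * volume ({x | (2 : ℝ≥0∞) ^ (k + 1) ≤ f x} ∩ cube b l) ^ 2 ≤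
          A * ENNReal.ofReal l ^ (d - α) * N k (cube b l ×ˢ cube b l)) →
      ∫⁻ x in cube a L, f x ≤ t * volume (cube a L) →
      ∫⁻ x in cube a L, f x ^ γ ≤ C * (t ^ γ * volume (cube a L) +
        (∑' k, M k (cube a L ×ˢ cube a L)) ^ (β₁ * γ) *
          (∑' k, N k (cube a L ×ˢ cube a L)) ^ (β₂ * γ)) := by
  -- One level up costs 2^γ, and a half-full cube costs 2. This choice leaves the contraction factor
  -- 1/2.
  set δ : ℝ≥0∞ := 4⁻¹ * 2 ^ (-γ) with hδ
  have h2γ0 : (2:ℝ≥0∞) ^ γ ≠ 0 := by simp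
  have h2γt : (2:ℝ≥0∞) ^ γ ≠ ⊤ := by simp
  have hδ0 : δ ≠ 0 := by
    rw [hδ, ENNReal.rpow_neg]; simp [h2γt]
  have hδ2 : 2 ^ γ * (2 * δ) = 2⁻¹ := by
    rw [hδ, ENNReal.rpow_neg]
    calc (2:ℝ≥0∞) ^ γ * (2 * (4⁻¹ * (2 ^ γ)⁻¹)) = (2 ^ γ * (2 ^ γ)⁻¹) * (2 * 4⁻¹) := by ring
      _ = 2⁻¹ := by
        rw [ENNReal.mul_inv_cancel h2γ0 h2γt, one_mul, show (4:ℝ≥0∞) = 2 * 2 by norm_num,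
          ENNReal.mul_inv (by simp) (by simp), ← mul_assoc, ENNReal.mul_inv_cancel (by simp) (by simp),
          one_mul]
  have hδ1 : δ < 1 := by
    have h1 : (2:ℝ≥0∞) ^ (-γ) ≤ 1 := by
      rw [ENNReal.rpow_neg]
      exact ENNReal.inv_le_one.2 (ENNReal.one_le_rpow (by norm_num) hγ0)
    calc δ ≤ 4⁻¹ * 1 := by rw [hδ]; gcongr
      _ < 1 := by rw [mul_one]; exact ENNReal.inv_lt_one.2 (by norm_num)
  set ε : ℝ≥0∞ := δ * (2 ^ d)⁻¹ with hε
  have h2d0 : (2:ℝ≥0∞) ^ d ≠ 0 := by positivity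
  have h2dt : (2:ℝ≥0∞) ^ d ≠ ⊤ := by finiteness
  have hε0 : ε ≠ 0 := mul_ne_zero hδ0 (ENNReal.inv_ne_zero.2 h2dt)
  have hεt : ε ≠ ⊤ := ENNReal.mul_ne_top hδ1.ne_top (ENNReal.inv_ne_top.2 h2d0)
  set c₁ : ℝ≥0∞ := 2 * ε⁻¹ * A with hc₁
  set c₂ : ℝ≥0∞ := ε⁻¹ ^ 2 * A with hc₂
  have hεi : ε⁻¹ ≠ ⊤ := ENNReal.inv_ne_top.2 hε0
  have hc₁t : c₁ ≠ ⊤ := by finiteness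
  have hc₂t : c₂ ≠ ⊤ := by finiteness
  set C₁ : ℝ≥0∞ := 2 ^ γ * (c₁ ^ β₁ * c₂ ^ β₂) ^ γ with hC₁
  have hC₁t : C₁ ≠ ⊤ := by
    rw [hC₁]
    exact ENNReal.mul_ne_top h2γt (ENNReal.rpow_ne_top_of_nonneg hγ0.le (ENNReal.mul_ne_top
      (ENNReal.rpow_ne_top_of_nonneg hβ₁.le hc₁t) (ENNReal.rpow_ne_top_of_nonneg hβ₂.le hc₂t)))
  have hεγ : ε⁻¹ ^ γ ≠ ⊤ := ENNReal.rpow_ne_top_of_nonneg hγ0.le hεi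
  refine ⟨1 + ε⁻¹ ^ γ + 2 ^ γ * (2 * (ε⁻¹ ^ γ + C₁)), by finiteness, ?_⟩
  intro a L f M N t hL hf hft hP hN ht
  set Q := cube a L with hQdef
  have hQ : MeasurableSet Q := measurableSet_cube a L
  have hW0 : volume Q ≠ 0 := volume_cube_ne_zero a hL
  have hWt : volume Q ≠ ⊤ := volume_cube_ne_top a L
  by_cases htt : t = ⊤
  · rw [htt, ENNReal.top_rpow_of_pos hγ0, ENNReal.top_mul hW0, top_add, ENNReal.mul_top (by positivity)]
    exact le_top
  -- A dyadic starting height exists only for positive t; for t = 0 the function vanishes almost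
  -- everywhere on the cube.
  by_cases ht0 : t = 0
  · have h0 : ∫⁻ x in Q, f x = 0 := by simpa [ht0] using ht
    rw [lintegral_eq_zero_iff hf] at h0
    have : ∫⁻ x in Q, f x ^ γ = 0 := by
      rw [lintegral_eq_zero_iff (hf.pow_const _)]
      filter_upwards [h0] with x hx
      simp [hx, hγ0]
    rw [this]; exact zero_le
  -- From this height on, Chebyshev's inequality gives the next level set density at most ε in the
  -- whole cube, as the Calderón–Zygmund decomposition requires.
  set T := ε⁻¹ * t with hT
  have hT0 : T ≠ 0 := mul_ne_zero (ENNReal.inv_ne_zero.2 hεt) ht0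
  have hTt : T ≠ ⊤ := by finiteness
  obtain ⟨k₀, hk₀, hk₀'⟩ := ENNReal.exists_mem_Ico_zpow hT0 hTt (y := 2) (by norm_num) (by simp)
  set E : ℤ → Set (EuclideanSpace ℝ (Fin d)) := fun k => {x | (2 : ℝ≥0∞) ^ k ≤ f x} with hE
  have hEm : ∀ k, MeasurableSet (E k) := fun k => measurableSet_le measurable_const hf
  have h2k0 : ∀ k : ℤ, (2:ℝ≥0∞) ^ k ≠ 0 := fun k => (ENNReal.zpow_pos (by simp) (by simp) k).ne'
  have h2kt : ∀ k : ℤ, (2:ℝ≥0∞) ^ k ≠ ⊤ := fun k => ENNReal.zpow_ne_top (by simp) (by simp) k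
  have hsucc : ∀ k : ℤ, ((2:ℝ≥0∞) ^ (k + 1)) ^ γ = 2 ^ γ * ((2:ℝ≥0∞) ^ k) ^ γ := fun k => by
    rw [ENNReal.zpow_add (by simp) (by simp), zpow_one, ENNReal.mul_rpow_of_nonneg _ _ hγ0.le,
      mul_comm]
  -- the estimate in one Calderón–Zygmund cube
  have hcube : ∀ (k : ℤ) (b : EuclideanSpace ℝ (Fin d)) (l : ℝ), 0 < l → l ≤ L → cube b l ⊆ Q →
      ε * volume (cube b l) ≤ volume (E (k + 1) ∩ cube b l) →
      volume (E (k + 1) ∩ cube b l) ≤ δ * volume (cube b l) →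
      ((2:ℝ≥0∞) ^ (k + 1)) ^ γ * volume (E (k + 1) ∩ cube b l) ≤
        2⁻¹ * (((2:ℝ≥0∞) ^ k) ^ γ * volume (E k ∩ cube b l)) +
          C₁ * (M k (cube b l ×ˢ cube b l) ^ (β₁ * γ) * N k (cube b l ×ˢ cube b l) ^ (β₂ * γ)) := by
    intro k b l hl hlL hsub hlow hup
    set R := cube b l with hR
    have hV0 : volume R ≠ 0 := volume_cube_ne_zero b hl
    have hVt : volume R ≠ ⊤ := volume_cube_ne_top b l
    have hvol : volume R = ENNReal.ofReal l ^ (d : ℝ) := by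
      rw [hR, volume_cube, ENNReal.rpow_natCast]
    have hl0 : ENNReal.ofReal l ≠ 0 := by simpa using hl
    have hlt : ENNReal.ofReal l ≠ ⊤ := ENNReal.ofReal_ne_top
    have hsplit : volume (E k ∩ R) + volume (R \ E k) = volume R := by
      rw [Set.inter_comm]; exact measure_inter_add_sdiff R (hEm k)
    rcases le_total (2⁻¹ * volume R) (volume (E k ∩ R)) with h | h
    · refine le_trans ?_ le_self_add
      have hRle : volume R ≤ 2 * volume (E k ∩ R) := by
        calc volume R = 2 * (2⁻¹ * volume R) := by
              rw [← mul_assoc, ENNReal.mul_inv_cancel (by simp) (by simp), one_mul]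
          _ ≤ _ := by gcongr
      calc ((2:ℝ≥0∞) ^ (k + 1)) ^ γ * volume (E (k + 1) ∩ R)
          ≤ ((2:ℝ≥0∞) ^ (k + 1)) ^ γ * (δ * (2 * volume (E k ∩ R))) := by
            gcongr; exact hup.trans (by gcongr)
        _ = 2 ^ γ * (2 * δ) * (((2:ℝ≥0∞) ^ k) ^ γ * volume (E k ∩ R)) := by rw [hsucc]; ring
        _ = _ := by rw [hδ2]
    · refine le_trans ?_ le_add_self
      have hcompl : 2⁻¹ * volume R ≤ volume (R \ E k) := by
        by_contra! hlt'
        have : volume R < volume R := by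
          calc volume R = volume (E k ∩ R) + volume (R \ E k) := hsplit.symm
            _ < 2⁻¹ * volume R + 2⁻¹ * volume R :=
              ENNReal.add_lt_add_of_le_of_lt (ne_top_of_le_ne_top (by finiteness) h) h hlt'
            _ = volume R := by rw [← add_mul, ENNReal.inv_two_add_inv_two, one_mul]
        exact lt_irrefl _ this
      have hP' := hP k b l hl hlL hsub
      have hN' := hN k b l hl hlL hsub
      have hl2 : ENNReal.ofReal l ^ (d : ℝ) * ENNReal.ofReal l ^ (d : ℝ) *
          ENNReal.ofReal l ^ (-(2 * d : ℝ)) = 1 := by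
        rw [← ENNReal.rpow_add _ _ hl0 hlt, ← ENNReal.rpow_add _ _ hl0 hlt]
        convert ENNReal.rpow_zero using 2; ring
      have h₁ : ((2:ℝ≥0∞) ^ k) ^ p ≤ c₁ * ENNReal.ofReal l ^ (s * p - d) * M k (R ×ˢ R) := by
        calc ((2:ℝ≥0∞) ^ k) ^ p = ((2:ℝ≥0∞) ^ k) ^ p * (ENNReal.ofReal l ^ (d : ℝ) *
              ENNReal.ofReal l ^ (d : ℝ) * ENNReal.ofReal l ^ (-(2 * d : ℝ))) * (ε⁻¹ * ε) *
                (2 * 2⁻¹) := by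
              rw [hl2, ENNReal.inv_mul_cancel hε0 hεt, ENNReal.mul_inv_cancel (by simp) (by simp)]
              simp
          _ = 2 * ε⁻¹ * ENNReal.ofReal l ^ (-(2 * d : ℝ)) * (((2:ℝ≥0∞) ^ k) ^ p * (ε * volume R) *
                (2⁻¹ * volume R)) := by rw [hvol]; ring
          _ ≤ 2 * ε⁻¹ * ENNReal.ofReal l ^ (-(2 * d : ℝ)) * (((2:ℝ≥0∞) ^ k) ^ p *
                volume (E (k + 1) ∩ R) * volume (R \ E k)) := by gcongr
          _ ≤ 2 * ε⁻¹ * ENNReal.ofReal l ^ (-(2 * d : ℝ)) *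
                (A * ENNReal.ofReal l ^ (d + s * p) * M k (R ×ˢ R)) := by gcongr
          _ = c₁ * (ENNReal.ofReal l ^ (-(2 * d : ℝ)) * ENNReal.ofReal l ^ (d + s * p)) *
                M k (R ×ˢ R) := by rw [hc₁]; ring
          _ = _ := by
              rw [← ENNReal.rpow_add _ _ hl0 hlt]; congr 3; ring
      have h₂ : ((2:ℝ≥0∞) ^ k) ^ (2 * q) ≤
          c₂ * ENNReal.ofReal l ^ (-(d + α)) * N k (R ×ˢ R) := by
        calc ((2:ℝ≥0∞) ^ k) ^ (2 * q) = ((2:ℝ≥0∞) ^ k) ^ (2 * q) * (ENNReal.ofReal l ^ (d : ℝ) *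
              ENNReal.ofReal l ^ (d : ℝ) * ENNReal.ofReal l ^ (-(2 * d : ℝ))) * (ε⁻¹ * ε) ^ 2 := by
              rw [hl2, ENNReal.inv_mul_cancel hε0 hεt]
              simp
          _ = ε⁻¹ ^ 2 * ENNReal.ofReal l ^ (-(2 * d : ℝ)) * (((2:ℝ≥0∞) ^ k) ^ (2 * q) *
                (ε * volume R) ^ 2) := by rw [hvol]; ring
          _ ≤ ε⁻¹ ^ 2 * ENNReal.ofReal l ^ (-(2 * d : ℝ)) * (((2:ℝ≥0∞) ^ k) ^ (2 * q) *
                volume (E (k + 1) ∩ R) ^ 2) := by gcongr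
          _ ≤ ε⁻¹ ^ 2 * ENNReal.ofReal l ^ (-(2 * d : ℝ)) *
                (A * ENNReal.ofReal l ^ (d - α) * N k (R ×ˢ R)) := by gcongr
          _ = c₂ * (ENNReal.ofReal l ^ (-(2 * d : ℝ)) * ENNReal.ofReal l ^ (d - α)) *
                N k (R ×ˢ R) := by rw [hc₂]; ring
          _ = _ := by
              rw [← ENNReal.rpow_add _ _ hl0 hlt]; congr 3; ring
      have hle := ENNReal.le_of_interpolation hβ₁ hβ₂ hγ hβ hl0 hlt (h2k0 k) (h2kt k) h₁ h₂
      have hRδ : volume (E (k + 1) ∩ R) ≤ volume R := measure_mono Set.inter_subset_right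
      calc ((2:ℝ≥0∞) ^ (k + 1)) ^ γ * volume (E (k + 1) ∩ R)
          ≤ 2 ^ γ * ((2:ℝ≥0∞) ^ k) ^ γ * volume R := by rw [hsucc]; gcongr
        _ ≤ 2 ^ γ * (c₁ ^ β₁ * c₂ ^ β₂ * ENNReal.ofReal l ^ (-((d:ℝ) / γ)) *
              (M k (R ×ˢ R) ^ β₁ * N k (R ×ˢ R) ^ β₂)) ^ γ * volume R := by gcongr
        _ = C₁ * (M k (R ×ˢ R) ^ (β₁ * γ) * N k (R ×ˢ R) ^ (β₂ * γ)) *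
              (ENNReal.ofReal l ^ (-((d:ℝ) / γ) * γ) * ENNReal.ofReal l ^ (d : ℝ)) := by
            rw [hvol, hC₁]
            simp only [ENNReal.mul_rpow_of_nonneg _ _ hγ0.le, ← ENNReal.rpow_mul]
            ring
        _ = _ := by
            rw [← ENNReal.rpow_add _ _ hl0 hlt]
            have : -((d:ℝ) / γ) * γ + d = 0 := by field_simp; ring
            rw [this]; simp
  -- the recursive estimate
  set y : ℕ → ℝ≥0∞ := fun n => ((2:ℝ≥0∞) ^ (k₀ + n)) ^ γ * volume (E (k₀ + n) ∩ Q) with hy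
  have hrec : ∀ n, y (n + 1) ≤ 2⁻¹ * y n +
      C₁ * (M (k₀ + n) (Q ×ˢ Q) ^ (β₁ * γ) * N (k₀ + n) (Q ×ˢ Q) ^ (β₂ * γ)) := by
    intro n
    set k : ℤ := k₀ + n with hk
    have hkn : k₀ + ((n + 1 : ℕ) : ℤ) = k + 1 := by push_cast; ring
    simp only [hy, hkn]
    have hmark : volume (E (k + 1) ∩ Q) ≤ δ * (2 ^ d)⁻¹ * volume Q := by
      have h1 : (2:ℝ≥0∞) ^ (k + 1) * volume (E (k + 1) ∩ Q) ≤ t * volume Q := by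
        refine le_trans ?_ ht
        have := mul_meas_ge_le_lintegral (μ := volume.restrict Q) hf ((2:ℝ≥0∞) ^ (k + 1))
        rwa [Measure.restrict_apply (hEm (k + 1))] at this
      have h2 : t ≤ ε * 2 ^ (k + 1) := by
        have h3 : T ≤ 2 ^ (k + 1) := hk₀'.le.trans
          (ENNReal.zpow_le_of_le (by norm_num) (by omega))
        calc t = ε * T := by rw [hT, ← mul_assoc, ENNReal.mul_inv_cancel hε0 hεt, one_mul]
          _ ≤ _ := by gcongr
      have h4 : (2:ℝ≥0∞) ^ (k + 1) * volume (E (k + 1) ∩ Q) ≤ 2 ^ (k + 1) * (ε * volume Q) :=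
        h1.trans (by calc t * volume Q ≤ ε * 2 ^ (k + 1) * volume Q := by gcongr
                      _ = _ := by ring)
      exact (ENNReal.mul_le_mul_iff_right (h2k0 _) (h2kt _)).1 h4
    obtain ⟨ι, hι, b, l, hbl, hdisj, hcov, hdens⟩ :=
      exists_disjoint_cubes a hL (E := E (k + 1) ∩ Q) Set.inter_subset_right hδ0 hδ1 hmark
    have hint : ∀ i k, E k ∩ Q ∩ cube (b i) (l i) = E k ∩ cube (b i) (l i) := fun i k => by
      rw [Set.inter_assoc, Set.inter_eq_right.2 (hbl i).2.2]
    simp only [hint] at hdens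
    have hE1 : volume (E (k + 1) ∩ Q) ≤ ∑' i, volume (E (k + 1) ∩ cube (b i) (l i)) := by
      calc volume (E (k + 1) ∩ Q)
          ≤ volume ((E (k + 1) ∩ Q) ∩ ⋃ i, cube (b i) (l i)) +
            volume ((E (k + 1) ∩ Q) \ ⋃ i, cube (b i) (l i)) := measure_le_inter_add_sdiff _ _ _
        _ = volume (⋃ i, E (k + 1) ∩ cube (b i) (l i)) := by
            rw [hcov, add_zero, Set.inter_iUnion]; simp only [hint]
        _ ≤ _ := measure_iUnion_le _
    have hE2 : ∑' i, volume (E k ∩ cube (b i) (l i)) ≤ volume (E k ∩ Q) := by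
      rw [← measure_iUnion]
      · exact measure_mono (Set.iUnion_subset fun i => Set.inter_subset_inter_right _ (hbl i).2.2)
      · intro i j hij
        exact (hdisj hij).mono Set.inter_subset_right Set.inter_subset_right
      · exact fun i => (hEm k).inter (measurableSet_cube _ _)
    have hm : ∀ m : Measure (EuclideanSpace ℝ (Fin d) × EuclideanSpace ℝ (Fin d)),
        ∑' i, m (cube (b i) (l i) ×ˢ cube (b i) (l i)) ≤ m (Q ×ˢ Q) := fun m =>
      m.tsum_prod_self_le (fun i => measurableSet_cube _ _) hdisj (fun i => (hbl i).2.2)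
    calc ((2:ℝ≥0∞) ^ (k + 1)) ^ γ * volume (E (k + 1) ∩ Q)
        ≤ ((2:ℝ≥0∞) ^ (k + 1)) ^ γ * ∑' i, volume (E (k + 1) ∩ cube (b i) (l i)) := by gcongr
      _ = ∑' i, ((2:ℝ≥0∞) ^ (k + 1)) ^ γ * volume (E (k + 1) ∩ cube (b i) (l i)) := by
          rw [ENNReal.tsum_mul_left]
      _ ≤ ∑' i, (2⁻¹ * (((2:ℝ≥0∞) ^ k) ^ γ * volume (E k ∩ cube (b i) (l i))) +
          C₁ * (M k (cube (b i) (l i) ×ˢ cube (b i) (l i)) ^ (β₁ * γ) *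
            N k (cube (b i) (l i) ×ˢ cube (b i) (l i)) ^ (β₂ * γ))) :=
          ENNReal.tsum_le_tsum fun i => hcube k (b i) (l i) (hbl i).1 (hbl i).2.1 (hbl i).2.2
            (hdens i).1 (hdens i).2
      _ = 2⁻¹ * (((2:ℝ≥0∞) ^ k) ^ γ * ∑' i, volume (E k ∩ cube (b i) (l i))) +
          C₁ * ∑' i, (M k (cube (b i) (l i) ×ˢ cube (b i) (l i)) ^ (β₁ * γ) *
            N k (cube (b i) (l i) ×ˢ cube (b i) (l i)) ^ (β₂ * γ)) := by
          rw [ENNReal.tsum_add, ENNReal.tsum_mul_left, ENNReal.tsum_mul_left, ENNReal.tsum_mul_left]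
      _ ≤ _ := by
          gcongr
          refine (ENNReal.tsum_rpow_mul_rpow_le _ _ (by positivity) (by positivity) hβγ).trans ?_
          gcongr
          · exact hm _
          · exact hm _
  have hinj : Function.Injective fun n : ℕ => k₀ + (n : ℤ) := fun m n h => by simpa using h
  have hsum : ∑' n, y n ≤ 2 * (T ^ γ * volume Q + C₁ *
      ((∑' k, M k (Q ×ˢ Q)) ^ (β₁ * γ) * (∑' k, N k (Q ×ˢ Q)) ^ (β₂ * γ))) := by
    have h := ENNReal.tsum_le_of_le_mul_add (r := 2⁻¹) (by simp) hrec
    rw [ENNReal.one_sub_inv_two, inv_inv, ENNReal.tsum_mul_left] at h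
    refine h.trans ?_
    gcongr
    · simp only [hy, Nat.cast_zero, add_zero]
      gcongr
      exact Set.inter_subset_right
    · refine (ENNReal.tsum_rpow_mul_rpow_le _ _ (by positivity) (by positivity) hβγ).trans ?_
      gcongr
      · exact ENNReal.tsum_comp_le_tsum_of_injective hinj fun k => M k (Q ×ˢ Q)
      · exact ENNReal.tsum_comp_le_tsum_of_injective hinj fun k => N k (Q ×ˢ Q)
  -- A layer cake bound: below the starting height f is at most T, and above it the single term of
  -- the dyadic level of f x suffices.
  have hpt : ∀ x, f x ^ γ ≤ T ^ γ + 2 ^ γ * ∑' n : ℕ, (E (k₀ + n)).indicator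
      (fun _ => ((2:ℝ≥0∞) ^ (k₀ + n)) ^ γ) x := by
    intro x
    rcases lt_or_ge (f x) (2 ^ k₀) with h | h
    · exact le_trans (by gcongr; exact h.le.trans hk₀) le_self_add
    · refine le_trans ?_ le_add_self
      have hfx0 : f x ≠ 0 := fun h0 => by
        rw [h0] at h; exact h2k0 k₀ (le_antisymm h zero_le)
      obtain ⟨k, hk, hk'⟩ := ENNReal.exists_mem_Ico_zpow hfx0 (hft x) (y := 2) (by norm_num) (by simp)
      have hkk : k₀ ≤ k := by
        by_contra! hlt
        have : (2:ℝ≥0∞) ^ (k + 1) ≤ 2 ^ k₀ := ENNReal.zpow_le_of_le (by norm_num) (by omega)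
        exact absurd (this.trans h) (not_le.2 hk')
      calc f x ^ γ ≤ ((2:ℝ≥0∞) ^ (k + 1)) ^ γ := by gcongr
        _ = 2 ^ γ * (E (k₀ + (k - k₀).toNat)).indicator
            (fun _ => ((2:ℝ≥0∞) ^ (k₀ + (k - k₀).toNat)) ^ γ) x := by
            have : k₀ + ((k - k₀).toNat : ℤ) = k := by omega
            rw [this, Set.indicator_of_mem (show x ∈ E k from hk), hsucc]
        _ ≤ _ := by
            gcongr
            exact ENNReal.le_tsum (f := fun n : ℕ => (E (k₀ + n)).indicator
              (fun _ => ((2:ℝ≥0∞) ^ (k₀ + n)) ^ γ) x) (k - k₀).toNat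
  have hint : ∫⁻ x in Q, f x ^ γ ≤ T ^ γ * volume Q + 2 ^ γ * ∑' n, y n := by
    calc ∫⁻ x in Q, f x ^ γ ≤ ∫⁻ x in Q, (T ^ γ + 2 ^ γ * ∑' n : ℕ, (E (k₀ + n)).indicator
          (fun _ => ((2:ℝ≥0∞) ^ (k₀ + n)) ^ γ) x) := lintegral_mono fun x => hpt x
      _ = T ^ γ * volume Q + 2 ^ γ * ∑' n, y n := by
          rw [lintegral_add_left measurable_const, setLIntegral_const, lintegral_const_mul' _ _ h2γt,
            lintegral_tsum fun n => (measurable_const.indicator (hEm _)).aemeasurable]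
          congr 3
          funext n
          rw [lintegral_indicator (hEm _), lintegral_const, Measure.restrict_restrict (hEm _)]
          simp [hy]
  refine hint.trans ?_
  set S := (∑' k, M k (Q ×ˢ Q)) ^ (β₁ * γ) * (∑' k, N k (Q ×ˢ Q)) ^ (β₂ * γ)
  have hTγ : T ^ γ = ε⁻¹ ^ γ * t ^ γ := by rw [hT, ENNReal.mul_rpow_of_nonneg _ _ hγ0.le]
  calc T ^ γ * volume Q + 2 ^ γ * ∑' n, y n
      ≤ T ^ γ * volume Q + 2 ^ γ * (2 * (T ^ γ * volume Q + C₁ * S)) := by gcongr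
    _ = ε⁻¹ ^ γ * (t ^ γ * volume Q) + 2 ^ γ * (2 * (ε⁻¹ ^ γ * (t ^ γ * volume Q) + C₁ * S)) := by
        rw [hTγ]; ring
    _ ≤ ε⁻¹ ^ γ * (t ^ γ * volume Q + S) + 2 ^ γ * (2 * (ε⁻¹ ^ γ * (t ^ γ * volume Q + S) +
          C₁ * (t ^ γ * volume Q + S))) := by
        gcongr
        · exact le_self_add
        · exact le_self_add
        · exact le_add_self
    _ = (ε⁻¹ ^ γ + 2 ^ γ * (2 * (ε⁻¹ ^ γ + C₁))) * (t ^ γ * volume Q + S) := by ring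
    _ ≤ _ := by
        gcongr
        exact le_add_self

/-! ### Jensen's inequality and energies as measures on the square -/

theorem MeasureTheory.lintegral_rpow_le {X : Type*} [MeasurableSpace X] (μ : Measure X)
    {h : X → ℝ≥0∞} (hh : AEMeasurable h μ) {p : ℝ} (hp : 1 ≤ p) :
    (∫⁻ x, h x ∂μ) ^ p ≤ μ Set.univ ^ (p - 1) * ∫⁻ x, h x ^ p ∂μ := by
  have hp0 : 0 < p := by linarith
  have h1 := ENNReal.lintegral_mul_norm_pow_le (μ := μ) (f := fun x => h x ^ p) (g := fun _ => 1)
    (hh.pow_const p) aemeasurable_const (p := 1 / p) (q := 1 - 1 / p) (by positivity)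
    (by rw [sub_nonneg, div_le_one hp0]; exact hp) (by ring)
  simp only [ENNReal.one_rpow, mul_one, ← ENNReal.rpow_mul, mul_one_div_cancel hp0.ne',
    ENNReal.rpow_one, lintegral_const, one_mul] at h1
  calc (∫⁻ x, h x ∂μ) ^ p
      ≤ ((∫⁻ x, h x ^ p ∂μ) ^ (1 / p) * μ Set.univ ^ (1 - 1 / p)) ^ p := by gcongr
    _ = _ := by
      rw [ENNReal.mul_rpow_of_nonneg _ _ hp0.le, ← ENNReal.rpow_mul, ← ENNReal.rpow_mul,
        one_div_mul_cancel hp0.ne', ENNReal.rpow_one, mul_comm]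
      congr 2; field_simp

theorem MeasureTheory.withDensity_prod_self {X : Type*} [MeasurableSpace X] (μ : Measure X)
    [SFinite μ] {F : X × X → ℝ≥0∞} (hF : Measurable F) {R : Set X} (hR : MeasurableSet R) :
    (μ.prod μ).withDensity F (R ×ˢ R) = ∫⁻ x in R, ∫⁻ y in R, F (x, y) ∂μ ∂μ := by
  rw [withDensity_apply _ (hR.prod hR), ← Measure.prod_restrict, lintegral_prod _ hF.aemeasurable]

/-- Pushing forward to the diagonal puts the single-integral energies of orders 0 and 1 on the same
footing as the double integrals. -/
theorem MeasureTheory.map_diag_prod_self {X : Type*} [MeasurableSpace X] (μ : Measure X)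
    {R : Set X} (hR : MeasurableSet R) :
    μ.map (fun x => (x, x)) (R ×ˢ R) = μ R := by
  rw [Measure.map_apply (by fun_prop) (hR.prod hR)]
  congr 1; ext x; simp

theorem measure_mul_enorm_average_le {X 𝕜 : Type*} [MeasurableSpace X] [RCLike 𝕜] (μ : Measure X)
    [IsFiniteMeasure μ] (h : X → 𝕜) :
    μ Set.univ * ‖⨍ x, h x ∂μ‖ₑ ≤ ∫⁻ x, ‖h x‖ₑ ∂μ := by
  rcases eq_or_ne μ 0 with rfl | hμ
  · simp
  rw [average_eq, enorm_smul, ← mul_assoc]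
  have : μ Set.univ * ‖(μ.real Set.univ)⁻¹‖ₑ = 1 := by
    rw [Real.enorm_eq_ofReal (by positivity), ENNReal.ofReal_inv_of_pos, Measure.real,
      ENNReal.ofReal_toReal (by finiteness), ENNReal.mul_inv_cancel (by simpa using hμ) (by finiteness)]
    exact ENNReal.toReal_pos (by simpa using hμ) (by finiteness)
  rw [this, one_mul]
  exact enorm_integral_le_lintegral_enorm _

theorem measure_mul_enorm_average_rpow_le {X 𝕜 : Type*} [MeasurableSpace X] [RCLike 𝕜]
    (μ : Measure X) [IsFiniteMeasure μ] {h : X → 𝕜} (hh : AEMeasurable h μ) {q : ℝ} (hq : 1 ≤ q) :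
    μ Set.univ * ‖⨍ x, h x ∂μ‖ₑ ^ q ≤ ∫⁻ x, ‖h x‖ₑ ^ q ∂μ := by
  rcases eq_or_ne μ 0 with rfl | hμ
  · simp
  set W := μ Set.univ
  have hW0 : W ≠ 0 := by simpa [W] using hμ
  have hWt : W ≠ ⊤ := by finiteness
  have h1 : (W * ‖⨍ x, h x ∂μ‖ₑ) ^ q ≤ W ^ (q - 1) * ∫⁻ x, ‖h x‖ₑ ^ q ∂μ :=
    (ENNReal.rpow_le_rpow (measure_mul_enorm_average_le μ h) (by linarith)).trans
      (lintegral_rpow_le μ hh.enorm hq)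
  rw [ENNReal.mul_rpow_of_nonneg _ _ (by linarith)] at h1
  have h2 : W ^ q = W ^ (q - 1) * W := by
    conv_rhs => rw [← ENNReal.rpow_one W, ← ENNReal.rpow_mul, one_mul]
    rw [← ENNReal.rpow_add _ _ hW0 hWt]; congr 1; ring
  rw [h2, mul_assoc] at h1
  exact (ENNReal.mul_le_mul_iff_right (by simp [hW0, hWt])
    (ENNReal.rpow_ne_top_of_nonneg (by linarith) hWt)).1 h1

/-! ### The Coulomb–Sobolev inequality on one cube -/

section Local

variable {d : ℕ}

theorem one_le_ofReal_rpow_mul_enorm_sub_rpow (hd : 1 ≤ d) {e : ℝ} (he : 0 < e)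
    {b x y : EuclideanSpace ℝ (Fin d)} {l : ℝ} (hl : 0 < l) (hx : x ∈ cube b l)
    (hy : y ∈ cube b l) : 1 ≤ ENNReal.ofReal (d * l) ^ e * ‖x - y‖ₑ ^ (-e) := by
  have hdl : 0 < (d:ℝ) * l := by have : (0:ℝ) < d := by exact_mod_cast hd
                                 positivity
  have h1 : ‖x - y‖ₑ ≤ ENNReal.ofReal (d * l) := by
    rw [← ofReal_norm]
    exact ENNReal.ofReal_le_ofReal (norm_sub_le_of_mem_cube hx hy hl)
  calc (1:ℝ≥0∞) = ENNReal.ofReal (d * l) ^ e * ENNReal.ofReal (d * l) ^ (-e) := by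
        rw [← ENNReal.rpow_add _ _ (ENNReal.ofReal_pos.2 hdl).ne' ENNReal.ofReal_ne_top]; simp
    _ ≤ _ := by
        rw [ENNReal.rpow_neg, ENNReal.rpow_neg]
        gcongr

/-- Points of a cube of side l are at distance at most d·l, so the singular kernel is bounded below
there. On the diagonal the kernel is infinite, which does no harm. -/
theorem lintegral_cube_mul_le (hd : 1 ≤ d) {e : ℝ} (he : 0 < e)
    {b : EuclideanSpace ℝ (Fin d)} {l : ℝ} (hl : 0 < l)
    {h₁ h₂ : EuclideanSpace ℝ (Fin d) → ℝ≥0∞} (hh₁ : Measurable h₁) (hh₂ : Measurable h₂) :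
    (∫⁻ x in cube b l, h₁ x) * (∫⁻ x in cube b l, h₂ x) ≤ ENNReal.ofReal (d * l) ^ e *
      ∫⁻ x in cube b l, ∫⁻ y in cube b l, h₁ x * h₂ y * ‖x - y‖ₑ ^ (-e) := by
  have hm := measurableSet_cube b l
  have ht : ENNReal.ofReal (d * l) ^ e ≠ ⊤ := ENNReal.rpow_ne_top_of_nonneg he.le
    ENNReal.ofReal_ne_top
  rw [← lintegral_mul_const _ hh₁, ← lintegral_const_mul' _ _ ht]
  refine setLIntegral_mono' hm fun x hx => ?_
  rw [← lintegral_const_mul _ hh₂, ← lintegral_const_mul' _ _ ht]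
  refine setLIntegral_mono' hm fun y hy => ?_
  calc h₁ x * h₂ y = h₁ x * h₂ y * 1 := by rw [mul_one]
    _ ≤ h₁ x * h₂ y * (ENNReal.ofReal (d * l) ^ e * ‖x - y‖ₑ ^ (-e)) := by
        gcongr; exact one_le_ofReal_rpow_mul_enorm_sub_rpow hd he hl hx hy
    _ = _ := by ring

variable {𝕜 : Type*} [RCLike 𝕜]

/-- A Poincaré inequality of order `s` with energy `μ` in a cube, together with its version for
truncations of `|g - c|`, `c` being the mean of `g`. -/
def HasPoincare (A : ℝ≥0∞) (s p : ℝ) (a : EuclideanSpace ℝ (Fin d)) (L : ℝ)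
    (g : EuclideanSpace ℝ (Fin d) → 𝕜) (μ : ℝ≥0∞) : Prop :=
  (∃ M : ℤ → Measure (EuclideanSpace ℝ (Fin d) × EuclideanSpace ℝ (Fin d)),
    ∑' k, M k (cube a L ×ˢ cube a L) ≤ A * μ ∧
    ∀ (k : ℤ) (b : EuclideanSpace ℝ (Fin d)) (l : ℝ), 0 < l → l ≤ L → cube b l ⊆ cube a L →
      ((2 : ℝ≥0∞) ^ k) ^ p *
        volume ({x | (2 : ℝ≥0∞) ^ (k + 1) ≤ ‖g x - ⨍ z in cube a L, g z‖ₑ} ∩ cube b l) *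
        volume (cube b l \ {x | (2 : ℝ≥0∞) ^ k ≤ ‖g x - ⨍ z in cube a L, g z‖ₑ}) ≤
          A * ENNReal.ofReal l ^ (d + s * p) * M k (cube b l ×ˢ cube b l)) ∧
  ∫⁻ x in cube a L, ∫⁻ y in cube a L, ‖g x - g y‖ₑ ^ p ≤ A * ENNReal.ofReal L ^ (d + s * p) * μ

/-- The Coulomb–Sobolev inequality on cubes. -/
theorem exists_coulomb_sobolev_cube (hd : 1 ≤ d) {s p q α β₁ β₂ γ : ℝ}
    (hp : 1 ≤ p) (hq : 1 ≤ q) (hα₀ : 0 < α) (hαd : α < d)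
    (hβ₁ : 0 < β₁) (hβ₂ : 0 < β₂) (hγ0 : 0 < γ)
    (hγ : (d - s * p) * β₁ + (d + α) * β₂ = d / γ) (hβ : β₁ * p + 2 * β₂ * q = 1)
    (hβγ : 1 ≤ β₁ * γ + β₂ * γ) {A : ℝ≥0∞} (hA : A ≠ ⊤) :
    ∃ C : ℝ≥0∞, C ≠ ⊤ ∧ ∀ (a : EuclideanSpace ℝ (Fin d)) (L : ℝ)
      (g : EuclideanSpace ℝ (Fin d) → 𝕜) (μ : ℝ≥0∞), 0 < L → Measurable g →
      IntegrableOn g (cube a L) → HasPoincare A s p a L g μ →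
      ∫⁻ x in cube a L, ‖g x - ⨍ z in cube a L, g z‖ₑ ^ γ ≤
        C * (μ ^ β₁ * (∫⁻ x in cube a L, ∫⁻ y in cube a L,
          ‖g x‖ₑ ^ q * ‖g y‖ₑ ^ q * ‖x - y‖ₑ ^ (-(d - α))) ^ β₂) ^ γ := by
  have hdR : (0:ℝ) < d := by exact_mod_cast hd
  have hdα : 0 < d - α := by linarith
  set D : ℝ≥0∞ := (d : ℝ≥0∞) ^ (d - α) with hD
  have hDt : D ≠ ⊤ := ENNReal.rpow_ne_top_of_nonneg hdα.le (by finiteness)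
  -- The summands serve the Poincaré bounds, the Coulomb bounds at levels up to |c|, and the Coulomb
  -- bounds at levels above |c|, respectively.
  set B : ℝ≥0∞ := A + 1 + D with hB
  have hBt : B ≠ ⊤ := by finiteness
  obtain ⟨C, hC, H⟩ := exists_lintegral_cube_le (d := d) hβ₁ hβ₂ hγ0 hγ hβ hβγ hBt
  set K₁ : ℝ≥0∞ := (A ^ β₁ * (2 ^ (2 * q) * D) ^ β₂) ^ γ with hK₁
  set K₂ : ℝ≥0∞ := A ^ (β₁ * γ) * (2 + 2 * D) ^ (β₂ * γ) with hK₂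
  have hK₁t : K₁ ≠ ⊤ := by
    refine ENNReal.rpow_ne_top_of_nonneg hγ0.le (ENNReal.mul_ne_top
      (ENNReal.rpow_ne_top_of_nonneg hβ₁.le hA) (ENNReal.rpow_ne_top_of_nonneg hβ₂.le
        (ENNReal.mul_ne_top (ENNReal.rpow_ne_top_of_nonneg (by linarith) (by simp)) hDt)))
  have hK₂t : K₂ ≠ ⊤ := ENNReal.mul_ne_top (ENNReal.rpow_ne_top_of_nonneg (by positivity) hA)
    (ENNReal.rpow_ne_top_of_nonneg (by positivity) (by finiteness))
  refine ⟨C * (K₁ + K₂), by finiteness, ?_⟩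
  rintro a L g μ hL hg hgi ⟨⟨M, hM, hP⟩, hosc⟩
  set Q := cube a L with hQdef
  have hQ : MeasurableSet Q := measurableSet_cube a L
  have hW0 : volume Q ≠ 0 := volume_cube_ne_zero a hL
  have hWt : volume Q ≠ ⊤ := volume_cube_ne_top a L
  have : Fact (volume Q < ⊤) := ⟨hWt.lt_top⟩
  set W := volume Q with hW
  set ν := ∫⁻ x in Q, ∫⁻ y in Q, ‖g x‖ₑ ^ q * ‖g y‖ₑ ^ q * ‖x - y‖ₑ ^ (-(d - α)) with hν
  set c := ⨍ z in Q, g z with hc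
  set l := ENNReal.ofReal L with hl
  have hl0 : l ≠ 0 := by simpa [hl] using hL
  have hlt : l ≠ ⊤ := ENNReal.ofReal_ne_top
  have hWl : W = l ^ (d : ℝ) := by rw [hW, hQdef, volume_cube, ENNReal.rpow_natCast]
  have hdl : ENNReal.ofReal (d * L) ^ (d - α) = D * l ^ (d - α) := by
    rw [ENNReal.ofReal_mul hdR.le, ENNReal.mul_rpow_of_nonneg _ _ hdα.le, ENNReal.ofReal_natCast]
  set I := ∫⁻ x in Q, ‖g x‖ₑ ^ q with hI
  have hIν : I ^ 2 ≤ D * l ^ (d - α) * ν := by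
    have := lintegral_cube_mul_le (h₁ := fun x => ‖g x‖ₑ ^ q) (h₂ := fun x => ‖g x‖ₑ ^ q) hd hdα
      (b := a) hL (by fun_prop) (by fun_prop)
    rwa [hdl, ← sq] at this
  have hcI : W * ‖c‖ₑ ^ q ≤ I := by
    have := measure_mul_enorm_average_rpow_le (volume.restrict Q) hg.aemeasurable hq
    simpa using this
  have hc1 : W * ‖c‖ₑ ≤ ∫⁻ x in Q, ‖g x‖ₑ := by
    have := measure_mul_enorm_average_le (volume.restrict Q) g
    simpa using this
  have hWinv : W⁻¹ * W = 1 := ENNReal.inv_mul_cancel hW0 hWt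
  have hWi : W⁻¹ = l ^ (-(d:ℝ)) := by rw [hWl, ENNReal.rpow_neg]
  -- the mean oscillation
  set t := W⁻¹ * ∫⁻ x in Q, ‖g x - c‖ₑ with ht
  have htW : ∫⁻ x in Q, ‖g x - c‖ₑ ≤ t * W := by
    rw [ht, mul_comm, ← mul_assoc, mul_comm W, hWinv, one_mul]
  have ht2 : t ≤ 2 * W⁻¹ * ∫⁻ x in Q, ‖g x‖ₑ := by
    calc t ≤ W⁻¹ * ∫⁻ x in Q, (‖g x‖ₑ + ‖c‖ₑ) := by
          rw [ht]; gcongr; exact enorm_sub_le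
      _ = W⁻¹ * ((∫⁻ x in Q, ‖g x‖ₑ) + W * ‖c‖ₑ) := by
          rw [lintegral_add_right _ measurable_const, setLIntegral_const, mul_comm W]
      _ ≤ W⁻¹ * ((∫⁻ x in Q, ‖g x‖ₑ) + ∫⁻ x in Q, ‖g x‖ₑ) := by gcongr
      _ = _ := by ring
  have htfin : t ≠ ⊤ := by
    refine ne_top_of_le_ne_top ?_ ht2
    exact ENNReal.mul_ne_top (ENNReal.mul_ne_top (by simp) (ENNReal.inv_ne_top.2 hW0)) hgi.2.ne
  have htq : t ^ (2 * q) ≤ 2 ^ (2 * q) * D * l ^ (-(d + α)) * ν := by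
    have h1 : t ^ q ≤ 2 ^ q * W⁻¹ * I := by
      calc t ^ q ≤ (2 * W⁻¹ * ∫⁻ x in Q, ‖g x‖ₑ) ^ q := by gcongr
        _ = 2 ^ q * W⁻¹ ^ q * (∫⁻ x in Q, ‖g x‖ₑ) ^ q := by
            simp only [ENNReal.mul_rpow_of_nonneg _ _ (by linarith : 0 ≤ q)]
        _ ≤ 2 ^ q * W⁻¹ ^ q * (W ^ (q - 1) * I) := by
            gcongr
            simpa using lintegral_rpow_le (volume.restrict Q) hg.enorm.aemeasurable hq
        _ = 2 ^ q * (W⁻¹ ^ q * W ^ (q - 1)) * I := by ring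
        _ = _ := by
            rw [ENNReal.inv_rpow, ← ENNReal.rpow_neg, ← ENNReal.rpow_add _ _ hW0 hWt,
              ← ENNReal.rpow_neg_one]
            congr 3; ring
    calc t ^ (2 * q) = (t ^ q) ^ 2 := by
          rw [← ENNReal.rpow_natCast, ← ENNReal.rpow_mul]; congr 1; push_cast; ring
      _ ≤ (2 ^ q * W⁻¹ * I) ^ 2 := by gcongr
      _ = (2 ^ q) ^ 2 * W⁻¹ ^ 2 * I ^ 2 := by ring
      _ ≤ (2 ^ q) ^ 2 * W⁻¹ ^ 2 * (D * l ^ (d - α) * ν) := by gcongr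
      _ = 2 ^ (2 * q) * D * (l ^ (-(2 * d : ℝ)) * l ^ (d - α)) * ν := by
          have e1 : ((2:ℝ≥0∞) ^ q) ^ 2 = 2 ^ (2 * q) := by
            rw [← ENNReal.rpow_natCast, ← ENNReal.rpow_mul]; congr 1; push_cast; ring
          have e2 : W⁻¹ ^ 2 = l ^ (-(2 * d : ℝ)) := by
            rw [hWi, ← ENNReal.rpow_natCast, ← ENNReal.rpow_mul]; congr 1; push_cast; ring
          rw [e1, e2]; ring
      _ = _ := by rw [← ENNReal.rpow_add _ _ hl0 hlt]; congr 3; ring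
  have htp : t ^ p ≤ A * l ^ (s * p - d) * μ := by
    -- The mean oscillation is dominated by a double average of |g x - g y|, to which Jensen's
    -- inequality on the product applies.
    have hx : ∀ x, W * ‖g x - c‖ₑ ≤ ∫⁻ y in Q, ‖g x - g y‖ₑ := by
      intro x
      have h1 : ⨍ y in Q, (g x - g y) = g x - c := by
        have hne : (volume.restrict Q) ≠ 0 := by simpa using hW0
        have : NeZero (volume.restrict Q) := ⟨hne⟩
        have h2 : ⨍ _y in Q, g x = g x := average_const _ _
        rw [setAverage_eq] at h2
        rw [hc, setAverage_eq, setAverage_eq, integral_sub (integrable_const _) hgi, smul_sub, h2]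
      have := measure_mul_enorm_average_le (volume.restrict Q) fun y => g x - g y
      rw [h1] at this
      simpa using this
    have h2 : W * ∫⁻ x in Q, ‖g x - c‖ₑ ≤ ∫⁻ x in Q, ∫⁻ y in Q, ‖g x - g y‖ₑ := by
      rw [← lintegral_const_mul _ (by fun_prop)]
      exact lintegral_mono fun x => hx x
    have hme : Measurable fun z : EuclideanSpace ℝ (Fin d) × EuclideanSpace ℝ (Fin d) =>
        ‖g z.1 - g z.2‖ₑ := by fun_prop
    have h3 := lintegral_rpow_le ((volume.restrict Q).prod (volume.restrict Q))
      hme.aemeasurable hp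
    rw [lintegral_prod _ hme.aemeasurable, lintegral_prod _ (hme.pow_const p).aemeasurable,
      ← Set.univ_prod_univ, Measure.prod_prod, Measure.restrict_apply_univ] at h3
    have h4 : t ≤ W⁻¹ ^ 2 * ∫⁻ x in Q, ∫⁻ y in Q, ‖g x - g y‖ₑ := by
      calc t = W⁻¹ * (W⁻¹ * W) * ∫⁻ x in Q, ‖g x - c‖ₑ := by rw [hWinv, mul_one]
        _ = W⁻¹ ^ 2 * (W * ∫⁻ x in Q, ‖g x - c‖ₑ) := by ring
        _ ≤ _ := by gcongr
    calc t ^ p ≤ (W⁻¹ ^ 2 * ∫⁻ x in Q, ∫⁻ y in Q, ‖g x - g y‖ₑ) ^ p := by gcongr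
      _ = (W⁻¹ ^ 2) ^ p * (∫⁻ x in Q, ∫⁻ y in Q, ‖g x - g y‖ₑ) ^ p := by
          rw [ENNReal.mul_rpow_of_nonneg _ _ (by linarith)]
      _ ≤ (W⁻¹ ^ 2) ^ p * ((W * W) ^ (p - 1) * ∫⁻ x in Q, ∫⁻ y in Q, ‖g x - g y‖ₑ ^ p) := by gcongr
      _ ≤ (W⁻¹ ^ 2) ^ p * ((W * W) ^ (p - 1) * (A * l ^ (d + s * p) * μ)) := by gcongr
      _ = A * (l ^ (-(2 * d * p : ℝ)) * l ^ (2 * d * (p - 1) : ℝ) * l ^ (d + s * p)) * μ := by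
          have e1 : (W⁻¹ ^ 2) ^ p = l ^ (-(2 * d * p : ℝ)) := by
            rw [hWi, ← ENNReal.rpow_natCast, ← ENNReal.rpow_mul, ← ENNReal.rpow_mul]
            congr 1; push_cast; ring
          have e2 : (W * W) ^ (p - 1) = l ^ (2 * d * (p - 1) : ℝ) := by
            rw [hWl, ← ENNReal.rpow_add _ _ hl0 hlt, ← ENNReal.rpow_mul]; congr 1; ring
          rw [e1, e2]; ring
      _ = _ := by
          rw [← ENNReal.rpow_add _ _ hl0 hlt, ← ENNReal.rpow_add _ _ hl0 hlt]; congr 3; ring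
  -- The mean oscillation obeys the same pair of bounds as a truncation height, so the same
  -- interpolation applies.
  have htγ : t ^ γ * W ≤ K₁ * (μ ^ β₁ * ν ^ β₂) ^ γ := by
    by_cases ht0 : t = 0
    · rw [ht0, ENNReal.zero_rpow_of_pos hγ0, zero_mul]; exact zero_le
    have h1 := ENNReal.le_of_interpolation hβ₁ hβ₂ hγ hβ hl0 hlt ht0 htfin htp htq
    calc t ^ γ * W ≤ (A ^ β₁ * (2 ^ (2 * q) * D) ^ β₂ * l ^ (-((d:ℝ) / γ)) *
            (μ ^ β₁ * ν ^ β₂)) ^ γ * W := by gcongr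
      _ = K₁ * (μ ^ β₁ * ν ^ β₂) ^ γ * (l ^ (-((d:ℝ) / γ) * γ) * l ^ (d:ℝ)) := by
          rw [ENNReal.mul_rpow_of_nonneg _ _ hγ0.le, ENNReal.mul_rpow_of_nonneg _ _ hγ0.le, hWl,
            ← ENNReal.rpow_mul l]
          ring
      _ = _ := by
          rw [← ENNReal.rpow_add _ _ hl0 hlt]
          have : -((d:ℝ) / γ) * γ + d = 0 := by field_simp; ring
          rw [this]; simp
  -- the Coulomb energies of the level sets
  have h2kt : ∀ k : ℤ, ((2:ℝ≥0∞) ^ k) ^ (2 * q) ≠ ⊤ := fun k =>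
    ENNReal.rpow_ne_top_of_nonneg (by linarith) (ENNReal.zpow_ne_top (by simp) (by simp) k)
  set G : ℤ → EuclideanSpace ℝ (Fin d) → ℝ≥0∞ := fun k =>
    Set.indicator {x | (2:ℝ≥0∞) ^ k ≤ ‖g x‖ₑ} 1 with hG
  have hGset : ∀ k : ℤ, MeasurableSet {x | (2:ℝ≥0∞) ^ k ≤ ‖g x‖ₑ} := fun k =>
    measurableSet_le measurable_const hg.enorm
  have hGm : ∀ k, Measurable (G k) := fun k => measurable_one.indicator (hGset k)
  set N₁ : ℤ → Measure (EuclideanSpace ℝ (Fin d) × EuclideanSpace ℝ (Fin d)) := fun k =>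
    (volume.prod volume).withDensity fun z =>
      ((2:ℝ≥0∞) ^ k) ^ (2 * q) * (G k z.1 * G k z.2 * ‖z.1 - z.2‖ₑ ^ (-(d - α))) with hN₁
  -- At heights up to |c| the level sets of g - c say nothing about those of g. They are charged to
  -- the constant function |c| instead, whose Coulomb energy on the cube is controlled by that of g
  -- through Jensen.
  set κ : ℤ → ℝ≥0∞ := fun k =>
    (if (2:ℝ≥0∞) ^ k ≤ ‖c‖ₑ then ((2:ℝ≥0∞) ^ k) ^ (2 * q) else 0) * l ^ α with hκ
  set N₂ : ℤ → Measure (EuclideanSpace ℝ (Fin d) × EuclideanSpace ℝ (Fin d)) := fun k =>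
    (κ k • volume).map fun x => (x, x) with hN₂
  have hFm : ∀ k, Measurable fun z : EuclideanSpace ℝ (Fin d) × EuclideanSpace ℝ (Fin d) =>
      G k z.1 * G k z.2 * ‖z.1 - z.2‖ₑ ^ (-(d - α)) := fun k => by
    have := hGm k; fun_prop
  have hN₁R : ∀ k R, MeasurableSet R → N₁ k (R ×ˢ R) = ((2:ℝ≥0∞) ^ k) ^ (2 * q) *
      ∫⁻ x in R, ∫⁻ y in R, G k x * G k y * ‖x - y‖ₑ ^ (-(d - α)) := fun k R hR => by
    rw [hN₁, withDensity_prod_self _ ((hFm k).const_mul _) hR, ← lintegral_const_mul' _ _ (h2kt k)]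
    simp only [lintegral_const_mul' _ _ (h2kt k)]
  have hN₂R : ∀ k R, MeasurableSet R → N₂ k (R ×ˢ R) = κ k * volume R := fun k R hR => by
    rw [hN₂, map_diag_prod_self _ hR]; rfl
  have hN : ∀ (k : ℤ) (b : EuclideanSpace ℝ (Fin d)) (r : ℝ), 0 < r → r ≤ L → cube b r ⊆ Q →
      ((2 : ℝ≥0∞) ^ k) ^ (2 * q) * volume ({x | (2 : ℝ≥0∞) ^ (k + 1) ≤ ‖g x - c‖ₑ} ∩ cube b r) ^ 2 ≤
        B * ENNReal.ofReal r ^ (d - α) * (N₁ k + N₂ k) (cube b r ×ˢ cube b r) := by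
    intro k b r hr hrL hsub
    set R := cube b r with hRdef
    have hR : MeasurableSet R := measurableSet_cube b r
    have hr0 : ENNReal.ofReal r ≠ 0 := by simpa using hr
    have hrt : ENNReal.ofReal r ≠ ⊤ := ENNReal.ofReal_ne_top
    rw [Measure.add_apply, hN₁R k R hR, hN₂R k R hR]
    by_cases hck : (2:ℝ≥0∞) ^ k ≤ ‖c‖ₑ
    · have hvol : volume R = ENNReal.ofReal r ^ (d : ℝ) := by
        rw [hRdef, volume_cube, ENNReal.rpow_natCast]
      calc ((2 : ℝ≥0∞) ^ k) ^ (2 * q) * volume ({x | (2 : ℝ≥0∞) ^ (k + 1) ≤ ‖g x - c‖ₑ} ∩ R) ^ 2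
          ≤ ((2 : ℝ≥0∞) ^ k) ^ (2 * q) * volume R ^ 2 := by
            gcongr; exact Set.inter_subset_right
        _ = ((2 : ℝ≥0∞) ^ k) ^ (2 * q) * ((ENNReal.ofReal r ^ (d - α) * ENNReal.ofReal r ^ α) *
              volume R) := by
            rw [← ENNReal.rpow_add _ _ hr0 hrt, hvol, sub_add_cancel, sq]
        _ ≤ ((2 : ℝ≥0∞) ^ k) ^ (2 * q) * ((ENNReal.ofReal r ^ (d - α) * l ^ α) * volume R) := by
            gcongr
            exact ENNReal.ofReal_le_ofReal hrL
        _ = 1 * ENNReal.ofReal r ^ (d - α) * (0 + κ k * volume R) := by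
            simp only [hκ, if_pos hck]; ring
        _ ≤ _ := by
            gcongr
            · exact le_add_right le_add_self
            · exact zero_le
    · push Not at hck
      -- Above |c| the loss of one dyadic level compensates for the subtraction of the mean.
      have hss : {x | (2 : ℝ≥0∞) ^ (k + 1) ≤ ‖g x - c‖ₑ} ⊆ {x | (2:ℝ≥0∞) ^ k ≤ ‖g x‖ₑ} := by
        intro x hx
        by_contra hx'
        simp only [Set.mem_ofPred_eq, not_le] at hx hx'
        have h1 : ‖g x - c‖ₑ < 2 ^ k + 2 ^ k :=
          (enorm_sub_le).trans_lt (ENNReal.add_lt_add hx' hck)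
        have h2 : (2:ℝ≥0∞) ^ (k + 1) = 2 ^ k + 2 ^ k := by
          rw [ENNReal.zpow_add (by simp) (by simp), zpow_one, mul_two]
        exact absurd ((h2 ▸ hx).trans_lt h1) (lt_irrefl _)
      have hGv : ∫⁻ x in R, G k x = volume ({x | (2:ℝ≥0∞) ^ k ≤ ‖g x‖ₑ} ∩ R) := by
        rw [hG, lintegral_indicator_one (hGset k), Measure.restrict_apply (hGset k)]
      have hsq := lintegral_cube_mul_le hd hdα (b := b) hr (hGm k) (hGm k)
      rw [hGv, ← sq, ENNReal.ofReal_mul hdR.le, ENNReal.mul_rpow_of_nonneg _ _ hdα.le,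
        ENNReal.ofReal_natCast] at hsq
      calc ((2 : ℝ≥0∞) ^ k) ^ (2 * q) * volume ({x | (2 : ℝ≥0∞) ^ (k + 1) ≤ ‖g x - c‖ₑ} ∩ R) ^ 2
          ≤ ((2 : ℝ≥0∞) ^ k) ^ (2 * q) * volume ({x | (2:ℝ≥0∞) ^ k ≤ ‖g x‖ₑ} ∩ R) ^ 2 := by
            gcongr
        _ ≤ ((2 : ℝ≥0∞) ^ k) ^ (2 * q) * (D * ENNReal.ofReal r ^ (d - α) *
              ∫⁻ x in R, ∫⁻ y in R, G k x * G k y * ‖x - y‖ₑ ^ (-(d - α))) := by gcongr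
        _ = D * ENNReal.ofReal r ^ (d - α) * (((2 : ℝ≥0∞) ^ k) ^ (2 * q) *
              (∫⁻ x in R, ∫⁻ y in R, G k x * G k y * ‖x - y‖ₑ ^ (-(d - α))) + 0) := by ring
        _ ≤ _ := by
            gcongr
            · exact le_add_self
            · exact zero_le
  have hN₁sum : ∑' k, N₁ k (Q ×ˢ Q) ≤ 2 * ν := by
    have e1 : ∀ k, N₁ k (Q ×ˢ Q) = ∫⁻ z in Q ×ˢ Q, ((2:ℝ≥0∞) ^ k) ^ (2 * q) *
        (G k z.1 * G k z.2 * ‖z.1 - z.2‖ₑ ^ (-(d - α))) ∂(volume.prod volume) := fun k => by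
      rw [hN₁, withDensity_apply _ (hQ.prod hQ)]
    simp only [e1]
    rw [← lintegral_tsum fun k => ((hFm k).const_mul _).aemeasurable]
    have hνm : Measurable fun z : EuclideanSpace ℝ (Fin d) × EuclideanSpace ℝ (Fin d) =>
        ‖g z.1‖ₑ ^ q * ‖g z.2‖ₑ ^ q * ‖z.1 - z.2‖ₑ ^ (-(d - α)) := by fun_prop
    have e2 : 2 * ν = ∫⁻ z in Q ×ˢ Q, 2 * (‖g z.1‖ₑ ^ q * ‖g z.2‖ₑ ^ q *
        ‖z.1 - z.2‖ₑ ^ (-(d - α))) ∂(volume.prod volume) := by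
      rw [lintegral_const_mul _ hνm, ← Measure.prod_restrict, lintegral_prod _ hνm.aemeasurable]
    rw [e2]
    refine lintegral_mono fun z => ?_
    have e3 : ∀ k, ((2:ℝ≥0∞) ^ k) ^ (2 * q) * (G k z.1 * G k z.2 * ‖z.1 - z.2‖ₑ ^ (-(d - α))) =
        (if (2:ℝ≥0∞) ^ k ≤ min ‖g z.1‖ₑ ‖g z.2‖ₑ then ((2:ℝ≥0∞) ^ k) ^ (2 * q) else 0) *
          ‖z.1 - z.2‖ₑ ^ (-(d - α)) := fun k => by
      by_cases h1 : (2:ℝ≥0∞) ^ k ≤ ‖g z.1‖ₑ <;> by_cases h2 : (2:ℝ≥0∞) ^ k ≤ ‖g z.2‖ₑ <;>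
        simp [hG, h1, h2]
    simp only [e3]
    rw [ENNReal.tsum_mul_right, ← mul_assoc]
    gcongr
    refine (tsum_two_zpow_rpow_le (by linarith) _).trans ?_
    gcongr
    rw [two_mul, ENNReal.rpow_add_of_nonneg _ _ (by linarith) (by linarith)]
    gcongr
    · exact min_le_left _ _
    · exact min_le_right _ _
  have hN₂sum : ∑' k, N₂ k (Q ×ˢ Q) ≤ 2 * D * ν := by
    simp only [fun k => hN₂R k Q hQ, hκ]
    rw [ENNReal.tsum_mul_right, ENNReal.tsum_mul_right]
    have h1 := tsum_two_zpow_rpow_le (p := 2 * q) (by linarith) ‖c‖ₑ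
    calc _ ≤ 2 * ‖c‖ₑ ^ (2 * q) * l ^ α * W := by gcongr
      _ = 2 * ‖c‖ₑ ^ (2 * q) * l ^ α * W * (W⁻¹ * W) := by rw [hWinv, mul_one]
      _ = 2 * l ^ α * W⁻¹ * (W * ‖c‖ₑ ^ q) ^ 2 := by
          rw [two_mul q, ENNReal.rpow_add_of_nonneg _ _ (by linarith) (by linarith)]; ring
      _ ≤ 2 * l ^ α * W⁻¹ * I ^ 2 := by gcongr
      _ ≤ 2 * l ^ α * W⁻¹ * (D * l ^ (d - α) * ν) := by gcongr
      _ = 2 * D * ν * (l ^ α * l ^ (-(d:ℝ)) * l ^ (d - α)) := by rw [hWi]; ring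
      _ = _ := by
          rw [← ENNReal.rpow_add _ _ hl0 hlt, ← ENNReal.rpow_add _ _ hl0 hlt]
          have : α + -(d:ℝ) + (d - α) = 0 := by ring
          rw [this]; simp
  have hNsum : ∑' k, (N₁ k + N₂ k) (Q ×ˢ Q) ≤ (2 + 2 * D) * ν := by
    simp only [Measure.add_apply]
    rw [ENNReal.tsum_add, add_mul]
    gcongr
  have hP' : ∀ (k : ℤ) (b : EuclideanSpace ℝ (Fin d)) (r : ℝ), 0 < r → r ≤ L → cube b r ⊆ Q →
      ((2 : ℝ≥0∞) ^ k) ^ p * volume ({x | (2 : ℝ≥0∞) ^ (k + 1) ≤ ‖g x - c‖ₑ} ∩ cube b r) *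
        volume (cube b r \ {x | (2 : ℝ≥0∞) ^ k ≤ ‖g x - c‖ₑ}) ≤
          B * ENNReal.ofReal r ^ (d + s * p) * M k (cube b r ×ˢ cube b r) := by
    intro k b r hr hrL hsub
    refine (hP k b r hr hrL hsub).trans ?_
    gcongr
    exact le_add_right le_self_add
  have := H a L (fun x => ‖g x - c‖ₑ) M (fun k => N₁ k + N₂ k) t hL (by fun_prop)
    (fun x => enorm_ne_top) hP' hN htW
  refine this.trans ?_
  rw [mul_assoc C]
  gcongr
  rw [add_mul]
  refine add_le_add htγ ?_
  calc (∑' k, M k (Q ×ˢ Q)) ^ (β₁ * γ) * (∑' k, (N₁ k + N₂ k) (Q ×ˢ Q)) ^ (β₂ * γ)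
      ≤ (A * μ) ^ (β₁ * γ) * ((2 + 2 * D) * ν) ^ (β₂ * γ) := by gcongr
    _ = K₂ * (μ ^ β₁ * ν ^ β₂) ^ γ := by
        rw [ENNReal.mul_rpow_of_nonneg _ _ (by positivity : 0 ≤ β₁ * γ),
          ENNReal.mul_rpow_of_nonneg _ _ (by positivity : 0 ≤ β₂ * γ),
          ENNReal.mul_rpow_of_nonneg _ _ hγ0.le, ← ENNReal.rpow_mul, ← ENNReal.rpow_mul, hK₂]
        ring

end Local

/-! ### Poincaré inequalities of order s < 1 -/

section Instances

variable {d : ℕ} {𝕜 : Type*} [RCLike 𝕜]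

/-- The zero order Poincaré inequality. -/
theorem hasPoincare_zero {p : ℝ} (hp : 1 ≤ p) (a : EuclideanSpace ℝ (Fin d)) (L : ℝ)
    {g : EuclideanSpace ℝ (Fin d) → 𝕜} (hg : Measurable g) :
    HasPoincare (2 * (2 * 2 ^ p)) 0 p a L g (∫⁻ x in cube a L, ‖g x‖ₑ ^ p) := by
  unfold HasPoincare
  set Q := cube a L with hQdef
  have hQ : MeasurableSet Q := measurableSet_cube a L
  have hWt : volume Q ≠ ⊤ := volume_cube_ne_top a L
  have : Fact (volume Q < ⊤) := ⟨hWt.lt_top⟩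
  set c := ⨍ z in Q, g z with hc
  set I := ∫⁻ x in Q, ‖g x‖ₑ ^ p with hI
  have hp0 : 0 ≤ p := by linarith
  have h2p : (2:ℝ≥0∞) ^ p ≠ ⊤ := by simp
  have h2p1 : (2:ℝ≥0∞) ^ (p - 1) ≤ 2 ^ p := ENNReal.rpow_le_rpow_of_exponent_le (by simp) (by linarith)
  have hA1 : (1:ℝ≥0∞) ≤ 2 * (2 * 2 ^ p) := by
    have h1 : (1:ℝ≥0∞) ≤ 2 ^ p := ENNReal.one_le_rpow (by simp) (by linarith)
    calc (1:ℝ≥0∞) = 1 * (1 * 1) := by simp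
      _ ≤ _ := by gcongr <;> simp
  have h2kt : ∀ k : ℤ, ((2:ℝ≥0∞) ^ k) ^ p ≠ ⊤ := fun k =>
    ENNReal.rpow_ne_top_of_nonneg hp0 (ENNReal.zpow_ne_top (by simp) (by simp) k)
  set E : ℤ → Set (EuclideanSpace ℝ (Fin d)) := fun k => {x | (2 : ℝ≥0∞) ^ k ≤ ‖g x - c‖ₑ} with hE
  have hEm : ∀ k, MeasurableSet (E k) := fun k => measurableSet_le measurable_const (by fun_prop)
  have hcI : volume Q * ‖c‖ₑ ^ p ≤ I := by
    have := measure_mul_enorm_average_rpow_le (volume.restrict Q) hg.aemeasurable hp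
    simpa using this
  -- At order zero the energy of a level is just 2^{kp} times the measure of the level set. Summed
  -- over k it gives the p-th power integral of g - c up to a constant.
  set M : ℤ → Measure (EuclideanSpace ℝ (Fin d) × EuclideanSpace ℝ (Fin d)) := fun k =>
    (((2:ℝ≥0∞) ^ k) ^ p • volume.restrict (E k)).map fun x => (x, x) with hM
  have hMR : ∀ k R, MeasurableSet R → M k (R ×ˢ R) = ((2:ℝ≥0∞) ^ k) ^ p * volume (E k ∩ R) := by
    intro k R hR
    rw [hM, map_diag_prod_self _ hR, Measure.smul_apply, Measure.restrict_apply hR, Set.inter_comm]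
    rfl
  refine ⟨⟨M, ?_, ?_⟩, ?_⟩
  · simp only [fun k => hMR k Q hQ]
    calc ∑' k, ((2:ℝ≥0∞) ^ k) ^ p * volume (E k ∩ Q)
        = ∑' k : ℤ, ∫⁻ x in Q, (if (2:ℝ≥0∞) ^ k ≤ ‖g x - c‖ₑ then ((2:ℝ≥0∞) ^ k) ^ p else 0) := by
          congr 1; funext k
          rw [← Measure.restrict_apply (hEm k), ← lintegral_indicator_const (hEm k)]
          simp only [Set.indicator_apply, hE, Set.mem_ofPred_eq]
      _ = ∫⁻ x in Q, ∑' k : ℤ, (if (2:ℝ≥0∞) ^ k ≤ ‖g x - c‖ₑ then ((2:ℝ≥0∞) ^ k) ^ p else 0) := by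
          rw [lintegral_tsum]
          exact fun k => (Measurable.ite (hEm k) measurable_const measurable_const).aemeasurable
      _ ≤ ∫⁻ x in Q, 2 * (2 ^ (p - 1) * (‖g x‖ₑ ^ p + ‖c‖ₑ ^ p)) := by
          refine lintegral_mono fun x => (tsum_two_zpow_rpow_le hp _).trans ?_
          gcongr
          exact (ENNReal.rpow_le_rpow enorm_sub_le hp0).trans
            (ENNReal.rpow_add_le_mul_rpow_add_rpow _ _ hp)
      _ = 2 * (2 ^ (p - 1) * (I + volume Q * ‖c‖ₑ ^ p)) := by
          rw [lintegral_const_mul _ (by fun_prop), lintegral_const_mul _ (by fun_prop),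
            lintegral_add_right _ measurable_const, setLIntegral_const, mul_comm (volume Q)]
      _ ≤ 2 * (2 ^ p * (I + I)) := by gcongr
      _ = _ := by ring
  · intro k b l hl hlL hsub
    rw [hMR k _ (measurableSet_cube b l), zero_mul, add_zero]
    have hvol : volume (cube b l) = ENNReal.ofReal l ^ (d : ℝ) := by
      rw [volume_cube, ENNReal.rpow_natCast]
    rw [← hvol]
    have hEE : E (k + 1) ⊆ E k := fun x hx =>
      (ENNReal.zpow_le_of_le (by norm_num) (by omega)).trans hx
    calc ((2:ℝ≥0∞) ^ k) ^ p * volume (E (k + 1) ∩ cube b l) * volume (cube b l \ E k)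
        ≤ ((2:ℝ≥0∞) ^ k) ^ p * volume (E k ∩ cube b l) * volume (cube b l) := by
          gcongr; exact Set.sdiff_subset
      _ = 1 * volume (cube b l) * (((2:ℝ≥0∞) ^ k) ^ p * volume (E k ∩ cube b l)) := by ring
      _ ≤ _ := by gcongr
  · have hvol : volume Q = ENNReal.ofReal L ^ (d : ℝ) := by
      rw [hQdef, volume_cube, ENNReal.rpow_natCast]
    rw [zero_mul, add_zero, ← hvol]
    calc ∫⁻ x in Q, ∫⁻ y in Q, ‖g x - g y‖ₑ ^ p
        ≤ ∫⁻ x in Q, ∫⁻ y in Q, 2 ^ (p - 1) * (‖g x‖ₑ ^ p + ‖g y‖ₑ ^ p) := by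
          refine lintegral_mono fun x => lintegral_mono fun y => ?_
          exact (ENNReal.rpow_le_rpow enorm_sub_le hp0).trans
            (ENNReal.rpow_add_le_mul_rpow_add_rpow _ _ hp)
      _ = 2 ^ (p - 1) * (I * volume Q + I * volume Q) := by
          have h1 : ∀ x, ∫⁻ y in Q, 2 ^ (p - 1) * (‖g x‖ₑ ^ p + ‖g y‖ₑ ^ p) =
              2 ^ (p - 1) * (‖g x‖ₑ ^ p * volume Q + I) := fun x => by
            rw [lintegral_const_mul _ (by fun_prop), lintegral_add_left measurable_const,
              setLIntegral_const]
          simp only [h1]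
          rw [lintegral_const_mul _ (by fun_prop), lintegral_add_right _ measurable_const,
            setLIntegral_const, lintegral_mul_const _ (by fun_prop)]
      _ ≤ 2 ^ p * (I * volume Q + I * volume Q) := by gcongr
      _ = 1 * (2 * 2 ^ p) * volume Q * I := by ring
      _ ≤ _ := by gcongr; simp

/-- The fractional Poincaré inequality. -/
theorem hasPoincare_fractional (hd : 1 ≤ d) {s p : ℝ} (hs : 0 < s) (hp : 1 ≤ p)
    (a : EuclideanSpace ℝ (Fin d)) {L : ℝ} (hL : 0 < L)
    {g : EuclideanSpace ℝ (Fin d) → 𝕜} (hg : Measurable g) :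
    HasPoincare (2 + (d : ℝ≥0∞) ^ (d + s * p)) s p a L g
      (∫⁻ x in cube a L, ∫⁻ y in cube a L, ‖g x - g y‖ₑ ^ p * ‖x - y‖ₑ ^ (-(d + s * p))) := by
  unfold HasPoincare
  set Q := cube a L with hQdef
  have hQ : MeasurableSet Q := measurableSet_cube a L
  have hdR : (0:ℝ) < d := by exact_mod_cast hd
  have he : 0 < d + s * p := by positivity
  set e := d + s * p with hedef
  set c := ⨍ z in Q, g z with hc
  have hp0 : 0 ≤ p := by linarith
  have h2kt : ∀ k : ℤ, ((2:ℝ≥0∞) ^ k) ^ p ≠ ⊤ := fun k =>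
    ENNReal.rpow_ne_top_of_nonneg hp0 (ENNReal.zpow_ne_top (by simp) (by simp) k)
  set E : ℤ → Set (EuclideanSpace ℝ (Fin d)) := fun k => {x | (2 : ℝ≥0∞) ^ k ≤ ‖g x - c‖ₑ} with hE
  have hEm : ∀ k, MeasurableSet (E k) := fun k => measurableSet_le measurable_const (by fun_prop)
  have hdl : ∀ l : ℝ, ENNReal.ofReal (d * l) ^ e = (d:ℝ≥0∞) ^ e * ENNReal.ofReal l ^ e := fun l => by
    rw [ENNReal.ofReal_mul hdR.le, ENNReal.mul_rpow_of_nonneg _ _ he.le, ENNReal.ofReal_natCast]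
  set φ : ℤ → EuclideanSpace ℝ (Fin d) → ℝ≥0∞ := fun k => (E (k + 1)).indicator 1 with hφ
  set ψ : ℤ → EuclideanSpace ℝ (Fin d) → ℝ≥0∞ := fun k => (E k)ᶜ.indicator 1 with hψ
  have hφm : ∀ k, Measurable (φ k) := fun k => measurable_one.indicator (hEm _)
  have hψm : ∀ k, Measurable (ψ k) := fun k => measurable_one.indicator (hEm _).compl
  set M : ℤ → Measure (EuclideanSpace ℝ (Fin d) × EuclideanSpace ℝ (Fin d)) := fun k =>
    (volume.prod volume).withDensity fun z =>
      ((2:ℝ≥0∞) ^ k) ^ p * (φ k z.1 * ψ k z.2 * ‖z.1 - z.2‖ₑ ^ (-e)) with hM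
  have hFm : ∀ k, Measurable fun z : EuclideanSpace ℝ (Fin d) × EuclideanSpace ℝ (Fin d) =>
      φ k z.1 * ψ k z.2 * ‖z.1 - z.2‖ₑ ^ (-e) := fun k => by
    have := hφm k; have := hψm k; fun_prop
  refine ⟨⟨M, ?_, ?_⟩, ?_⟩
  · have e1 : ∀ k, M k (Q ×ˢ Q) = ∫⁻ z in Q ×ˢ Q, ((2:ℝ≥0∞) ^ k) ^ p *
        (φ k z.1 * ψ k z.2 * ‖z.1 - z.2‖ₑ ^ (-e)) ∂(volume.prod volume) := fun k => by
      rw [hM, withDensity_apply _ (hQ.prod hQ)]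
    simp only [e1]
    rw [← lintegral_tsum fun k => ((hFm k).const_mul _).aemeasurable]
    have hνm : Measurable fun z : EuclideanSpace ℝ (Fin d) × EuclideanSpace ℝ (Fin d) =>
        ‖g z.1 - g z.2‖ₑ ^ p * ‖z.1 - z.2‖ₑ ^ (-e) := by fun_prop
    have e2 : ∫⁻ x in Q, ∫⁻ y in Q, ‖g x - g y‖ₑ ^ p * ‖x - y‖ₑ ^ (-e) = ∫⁻ z in Q ×ˢ Q,
        ‖g z.1 - g z.2‖ₑ ^ p * ‖z.1 - z.2‖ₑ ^ (-e) ∂(volume.prod volume) := by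
      rw [← Measure.prod_restrict, lintegral_prod _ hνm.aemeasurable]
    rw [e2]
    refine le_trans ?_ (mul_le_mul_left (le_self_add : (2:ℝ≥0∞) ≤ _) _)
    rw [← lintegral_const_mul _ hνm]
    refine lintegral_mono fun z => ?_
    -- A pair separated by the levels k and k + 1 satisfies |g z.1 - g z.2| ≥ 2^k. For a given pair
    -- these k thus form a geometric range dominated by the difference itself.
    have e3 : ∀ k, ((2:ℝ≥0∞) ^ k) ^ p * (φ k z.1 * ψ k z.2 * ‖z.1 - z.2‖ₑ ^ (-e)) ≤
        (if (2:ℝ≥0∞) ^ k ≤ ‖g z.1 - g z.2‖ₑ then ((2:ℝ≥0∞) ^ k) ^ p else 0) *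
          ‖z.1 - z.2‖ₑ ^ (-e) := fun k => by
      by_cases h1 : z.1 ∈ E (k + 1)
      · by_cases h2 : z.2 ∈ E k
        · simp [hψ, h2]
        · have h3 : (2:ℝ≥0∞) ^ k ≤ ‖g z.1 - g z.2‖ₑ := by
            by_contra! hlt
            simp only [hE, Set.mem_ofPred_eq, not_le] at h1 h2
            have h4 : ‖g z.1 - c‖ₑ < 2 ^ k + 2 ^ k := by
              calc ‖g z.1 - c‖ₑ = ‖(g z.1 - g z.2) + (g z.2 - c)‖ₑ := by congr 1; ring
                _ ≤ ‖g z.1 - g z.2‖ₑ + ‖g z.2 - c‖ₑ := enorm_add_le _ _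
                _ < _ := ENNReal.add_lt_add hlt h2
            have h5 : (2:ℝ≥0∞) ^ (k + 1) = 2 ^ k + 2 ^ k := by
              rw [ENNReal.zpow_add (by simp) (by simp), zpow_one, mul_two]
            exact absurd ((h5 ▸ h1).trans_lt h4) (lt_irrefl _)
          simp [hφ, hψ, h1, h2, h3]
      · simp [hφ, h1]
    refine (ENNReal.tsum_le_tsum e3).trans ?_
    rw [ENNReal.tsum_mul_right, ← mul_assoc]
    gcongr
    exact tsum_two_zpow_rpow_le hp _
  · intro k b l hl hlL hsub
    have hR := measurableSet_cube b l
    have h1 := lintegral_cube_mul_le hd he (b := b) hl (hφm k) (hψm k)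
    rw [hφ, hψ, lintegral_indicator_one (hEm _), lintegral_indicator_one (hEm _).compl,
      Measure.restrict_apply (hEm _), Measure.restrict_apply (hEm _).compl, hdl] at h1
    have h2 : M k (cube b l ×ˢ cube b l) = ((2:ℝ≥0∞) ^ k) ^ p *
        ∫⁻ x in cube b l, ∫⁻ y in cube b l, φ k x * ψ k y * ‖x - y‖ₑ ^ (-e) := by
      rw [hM, withDensity_prod_self _ ((hFm k).const_mul _) hR, ← lintegral_const_mul' _ _ (h2kt k)]
      simp only [lintegral_const_mul' _ _ (h2kt k)]
    have h3 : cube b l \ E k = (E k)ᶜ ∩ cube b l := by rw [Set.sdiff_eq, Set.inter_comm]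
    calc ((2:ℝ≥0∞) ^ k) ^ p * volume (E (k + 1) ∩ cube b l) * volume (cube b l \ E k)
        = ((2:ℝ≥0∞) ^ k) ^ p * (volume (E (k + 1) ∩ cube b l) * volume ((E k)ᶜ ∩ cube b l)) := by
          rw [h3, mul_assoc]
      _ ≤ ((2:ℝ≥0∞) ^ k) ^ p * ((d:ℝ≥0∞) ^ e * ENNReal.ofReal l ^ e *
          ∫⁻ x in cube b l, ∫⁻ y in cube b l, φ k x * ψ k y * ‖x - y‖ₑ ^ (-e)) := by
          gcongr
      _ = (d:ℝ≥0∞) ^ e * ENNReal.ofReal l ^ e * M k (cube b l ×ˢ cube b l) := by rw [h2]; ring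
      _ ≤ _ := by gcongr; exact le_add_self
  · have hct : ENNReal.ofReal (d * L) ^ e ≠ ⊤ :=
      ENNReal.rpow_ne_top_of_nonneg he.le ENNReal.ofReal_ne_top
    calc ∫⁻ x in Q, ∫⁻ y in Q, ‖g x - g y‖ₑ ^ p
        ≤ ∫⁻ x in Q, ∫⁻ y in Q, ENNReal.ofReal (d * L) ^ e *
            (‖g x - g y‖ₑ ^ p * ‖x - y‖ₑ ^ (-e)) := by
          refine setLIntegral_mono' hQ fun x hx => setLIntegral_mono' hQ fun y hy => ?_
          calc ‖g x - g y‖ₑ ^ p = ‖g x - g y‖ₑ ^ p * 1 := by rw [mul_one]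
            _ ≤ ‖g x - g y‖ₑ ^ p * (ENNReal.ofReal (d * L) ^ e * ‖x - y‖ₑ ^ (-e)) := by
                gcongr; exact one_le_ofReal_rpow_mul_enorm_sub_rpow hd he hL hx hy
            _ = _ := by ring
      _ = ENNReal.ofReal (d * L) ^ e *
            ∫⁻ x in Q, ∫⁻ y in Q, ‖g x - g y‖ₑ ^ p * ‖x - y‖ₑ ^ (-e) := by
          simp only [lintegral_const_mul' _ _ hct]
      _ ≤ _ := by
          rw [hdl]; gcongr; exact le_add_self

end Instances

/-! ### Mollification in L¹ -/

section Mollification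

open Filter ContinuousLinearMap
open scoped Convolution

variable {V F : Type*} [NormedAddCommGroup V] [NormedSpace ℝ V] [FiniteDimensional ℝ V]
  [MeasurableSpace V] [BorelSpace V] {μ : Measure V} [μ.IsAddHaarMeasure]
  [NormedAddCommGroup F] [NormedSpace ℝ F]

/-- Young's inequality in L¹: Tonelli, translation invariance, and the total mass one of the
mollifier. -/
theorem ContDiffBump.lintegral_enorm_normed_convolution_le (φ : ContDiffBump (0 : V)) {f : V → F}
    (hf : AEStronglyMeasurable f μ) :
    ∫⁻ x, ‖(φ.normed μ ⋆[lsmul ℝ ℝ, μ] f) x‖ₑ ∂μ ≤ ∫⁻ x, ‖f x‖ₑ ∂μ := by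
  have hφ : ∫⁻ t, ‖φ.normed μ t‖ₑ ∂μ = 1 := by
    rw [← ofReal_integral_norm_eq_lintegral_enorm φ.integrable_normed]
    simp only [Real.norm_of_nonneg (φ.nonneg_normed _), φ.integral_normed, ENNReal.ofReal_one]
  have hφm : Measurable (φ.normed μ) := φ.continuous_normed.measurable
  have hm : AEMeasurable (fun z : V × V => ‖φ.normed μ z.2‖ₑ * ‖f (z.1 - z.2)‖ₑ) (μ.prod μ) := by
    refine (hφm.enorm.comp measurable_snd).aemeasurable.mul ?_
    exact (hf.comp_quasiMeasurePreserving
      (quasiMeasurePreserving_sub_of_right_invariant μ μ)).enorm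
  calc ∫⁻ x, ‖(φ.normed μ ⋆[lsmul ℝ ℝ, μ] f) x‖ₑ ∂μ
      ≤ ∫⁻ x, ∫⁻ t, ‖φ.normed μ t‖ₑ * ‖f (x - t)‖ₑ ∂μ ∂μ := by
        refine lintegral_mono fun x => ?_
        refine (enorm_integral_le_lintegral_enorm _).trans (le_of_eq ?_)
        simp [enorm_smul]
    _ = ∫⁻ t, ∫⁻ x, ‖φ.normed μ t‖ₑ * ‖f (x - t)‖ₑ ∂μ ∂μ := lintegral_lintegral_swap hm
    _ = ∫⁻ t, ‖φ.normed μ t‖ₑ * ∫⁻ x, ‖f x‖ₑ ∂μ ∂μ := by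
        refine lintegral_congr fun t => ?_
        rw [lintegral_const_mul' _ _ enorm_ne_top, lintegral_sub_right_eq_self (fun x => ‖f x‖ₑ) t]
    _ = _ := by rw [lintegral_mul_const _ hφm.enorm, hφ, one_mul]

/-- Mollifications of an integrable function converge in `L¹` on sets of finite measure. -/
theorem tendsto_lintegral_convolution_sub [CompleteSpace F] {φ : ℕ → ContDiffBump (0 : V)}
    (hφ : Tendsto (fun n => (φ n).rOut) atTop (𝓝 0)) {f : V → F} (hf : Integrable f μ) {Q : Set V}
    (hQt : μ Q ≠ ⊤) :
    Tendsto (fun n => ∫⁻ x in Q, ‖((φ n).normed μ ⋆[lsmul ℝ ℝ, μ] f) x - f x‖ₑ ∂μ) atTop (𝓝 0) := by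
  have : Fact (μ Q < ⊤) := ⟨hQt.lt_top⟩
  rw [ENNReal.tendsto_nhds_zero]
  intro ε hε
  have hε3 : ε / 3 ≠ 0 := (ENNReal.div_pos hε.ne' (by simp)).ne'
  obtain ⟨h, hhs, hfh, hhc, hhi⟩ := hf.exists_hasCompactSupport_lintegral_sub_le hε3
  obtain ⟨B, hB⟩ := hhc.bounded_above_of_compact_support hhs
  have hconvB : ∀ n x, ‖((φ n).normed μ ⋆[lsmul ℝ ℝ, μ] h) x‖ ≤ B := by
    intro n x
    have h1 : ∀ t, ‖(lsmul ℝ ℝ ((φ n).normed μ t)) (h (x - t))‖ ≤ (φ n).normed μ t * B := fun t => by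
      rw [lsmul_apply, norm_smul, Real.norm_of_nonneg ((φ n).nonneg_normed _)]
      exact mul_le_mul_of_nonneg_left (hB _) ((φ n).nonneg_normed _)
    calc _ ≤ ∫ t, (φ n).normed μ t * B ∂μ :=
          norm_integral_le_of_norm_le ((φ n).integrable_normed.mul_const B) (ae_of_all _ h1)
      _ = B := by rw [integral_mul_const, (φ n).integral_normed, one_mul]
  have hconvc : ∀ n (u : V → F), Integrable u μ → Continuous ((φ n).normed μ ⋆[lsmul ℝ ℝ, μ] u) :=
    fun n u hu => (φ n).hasCompactSupport_normed.continuous_convolution_left _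
      (φ n).continuous_normed hu.locallyIntegrable
  -- For the continuous approximant the convergence is pointwise and bounded by 2B, so dominated
  -- convergence applies on a set of finite measure; the contraction property above transfers it to
  -- f.
  have hlim : Tendsto (fun n => ∫⁻ x in Q, ‖((φ n).normed μ ⋆[lsmul ℝ ℝ, μ] h) x - h x‖ₑ ∂μ)
      atTop (𝓝 0) := by
    have := tendsto_lintegral_of_dominated_convergence (μ := μ.restrict Q)
      (F := fun n x => ‖((φ n).normed μ ⋆[lsmul ℝ ℝ, μ] h) x - h x‖ₑ) (f := fun _ => 0)
      (fun _ => ENNReal.ofReal (B + B))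
      (fun n => ((hconvc n h hhi).sub hhc).enorm.measurable)
      (fun n => ae_of_all _ fun x => by
        beta_reduce
        rw [← ofReal_norm]
        exact ENNReal.ofReal_le_ofReal ((norm_sub_le _ _).trans (add_le_add (hconvB n x) (hB x))))
      (by simp [ENNReal.mul_eq_top, hQt])
      (ae_of_all _ fun x => by
        have := ContDiffBump.convolution_tendsto_right_of_continuous (μ := μ) hφ hhc x
        have h2 := (this.sub_const (h x)).enorm
        simpa using h2)
    simpa using this
  filter_upwards [(ENNReal.tendsto_nhds_zero.1 hlim) (ε / 3) hε3.bot_lt] with n hn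
  have hsub : ∀ x, ((φ n).normed μ ⋆[lsmul ℝ ℝ, μ] f) x = ((φ n).normed μ ⋆[lsmul ℝ ℝ, μ] h) x
      + ((φ n).normed μ ⋆[lsmul ℝ ℝ, μ] (f - h)) x := by
    intro x
    have hex : ∀ u : V → F, Integrable u μ → ConvolutionExistsAt ((φ n).normed μ) u x (lsmul ℝ ℝ) μ :=
      fun u hu => (φ n).hasCompactSupport_normed.convolutionExists_left _
        (φ n).continuous_normed hu.locallyIntegrable x
    have := (hex h hhi).distrib_add (hex (f - h) (hf.sub hhi))
    rw [add_sub_cancel] at this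
    exact this
  have hmh : AEMeasurable (fun x => ‖h x - f x‖ₑ) (μ.restrict Q) :=
    (hhc.aestronglyMeasurable.sub hf.1).enorm.restrict
  have hm2 : Measurable (fun x => ‖((φ n).normed μ ⋆[lsmul ℝ ℝ, μ] h) x - h x‖ₑ) :=
    ((hconvc n h hhi).sub hhc).enorm.measurable
  calc ∫⁻ x in Q, ‖((φ n).normed μ ⋆[lsmul ℝ ℝ, μ] f) x - f x‖ₑ ∂μ
      ≤ ∫⁻ x in Q, (‖((φ n).normed μ ⋆[lsmul ℝ ℝ, μ] h) x - h x‖ₑ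
          + (‖((φ n).normed μ ⋆[lsmul ℝ ℝ, μ] (f - h)) x‖ₑ + ‖h x - f x‖ₑ)) ∂μ := by
        refine lintegral_mono fun x => ?_
        have : ((φ n).normed μ ⋆[lsmul ℝ ℝ, μ] f) x - f x =
            (((φ n).normed μ ⋆[lsmul ℝ ℝ, μ] h) x - h x) +
            (((φ n).normed μ ⋆[lsmul ℝ ℝ, μ] (f - h)) x + (h x - f x)) := by rw [hsub]; abel
        rw [this]
        exact (enorm_add_le _ _).trans (by gcongr; exact enorm_add_le _ _)
    _ = (∫⁻ x in Q, ‖((φ n).normed μ ⋆[lsmul ℝ ℝ, μ] h) x - h x‖ₑ ∂μ)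
          + ((∫⁻ x in Q, ‖((φ n).normed μ ⋆[lsmul ℝ ℝ, μ] (f - h)) x‖ₑ ∂μ) +
            ∫⁻ x in Q, ‖h x - f x‖ₑ ∂μ) := by
        rw [lintegral_add_left hm2, lintegral_add_right' _ hmh]
    _ ≤ ε / 3 + (ε / 3 + ε / 3) := by
        gcongr
        · refine (setLIntegral_le_lintegral _ _).trans
            (((φ n).lintegral_enorm_normed_convolution_le (hf.sub hhi).1).trans hfh)
        · refine (setLIntegral_le_lintegral _ _).trans (le_trans (le_of_eq ?_) hfh)
          exact lintegral_congr fun x => by rw [enorm_sub_rev]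
    _ = ε := by rw [← add_assoc]; exact ENNReal.add_thirds ε

end Mollification

/-! ### Integration along segments -/

section Segment

variable {d : ℕ}

theorem lintegral_comp_add_smul (f : EuclideanSpace ℝ (Fin d) → ℝ≥0∞) (hf : Measurable f)
    (v : EuclideanSpace ℝ (Fin d)) {t : ℝ} (ht : 0 < t) :
    ∫⁻ y, f (v + t • y) = ENNReal.ofReal (t⁻¹) ^ d * ∫⁻ z, f z := by
  have h1 := Measure.map_addHaar_smul (volume : Measure (EuclideanSpace ℝ (Fin d))) ht.ne'
  have h2 : ∫⁻ y, f (v + t • y) = ∫⁻ y, f (v + y) ∂(Measure.map (t • ·) volume) := by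
    rw [lintegral_map (by fun_prop) (by fun_prop)]
  rw [h2, h1, lintegral_smul_measure, lintegral_add_left_eq_self f v, smul_eq_mul]
  congr 1
  rw [finrank_euclideanSpace_fin, abs_of_pos (by positivity), ← ENNReal.ofReal_pow (by positivity),
    inv_pow]

/-- At each t one of t and 1 - t is at least 1/2. Changing variables in the corresponding endpoint
costs a Jacobian of at most 2^d, and convexity keeps the segment in Q. -/
theorem lintegral_cube_segment_le {Q : Set (EuclideanSpace ℝ (Fin d))} (hQ : MeasurableSet Q)
    (hQc : Convex ℝ Q) {w : EuclideanSpace ℝ (Fin d) → ℝ≥0∞} (hw : Measurable w) :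
    ∫⁻ x in Q, ∫⁻ y in Q, ∫⁻ t in Set.Icc (0:ℝ) 1, w (x + t • (y - x)) ≤
      2 ^ d * volume Q * ∫⁻ z in Q, w z := by
  set w' := Q.indicator w with hw'
  have hwm : Measurable w' := hw.indicator hQ
  have hone : ∀ t : ℝ, 2⁻¹ ≤ t → ENNReal.ofReal (t⁻¹) ^ d ≤ 2 ^ d := fun t ht => by
    gcongr
    rw [← ENNReal.ofReal_ofNat]
    exact ENNReal.ofReal_le_ofReal (by
      rw [← inv_inv (2:ℝ)]; exact inv_anti₀ (by norm_num) ht)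
  have hcomp : ∀ (v : EuclideanSpace ℝ (Fin d)) (t : ℝ), 2⁻¹ ≤ t →
      ∫⁻ y in Q, w' (v + t • y) ≤ 2 ^ d * ∫⁻ z in Q, w z := fun v t ht => by
    calc ∫⁻ y in Q, w' (v + t • y) ≤ ∫⁻ y, w' (v + t • y) := setLIntegral_le_lintegral _ _
      _ = ENNReal.ofReal (t⁻¹) ^ d * ∫⁻ z, w' z :=
          lintegral_comp_add_smul _ hwm v (lt_of_lt_of_le (by norm_num) ht)
      _ ≤ 2 ^ d * ∫⁻ z in Q, w z := by
          rw [hw', lintegral_indicator hQ]; exact mul_le_mul_left (hone t ht) _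
  have hseg : ∀ t ∈ Set.Icc (0:ℝ) 1, ∀ x ∈ Q, ∀ y ∈ Q,
      w (x + t • (y - x)) = w' ((1 - t) • x + t • y) := fun t ht x hx y hy => by
    have h1 : x + t • (y - x) = (1 - t) • x + t • y := by module
    rw [h1, hw', Set.indicator_of_mem]
    exact hQc hx hy (by linarith [ht.2]) ht.1 (by ring)
  have key : ∀ t ∈ Set.Icc (0:ℝ) 1, ∫⁻ x in Q, ∫⁻ y in Q, w (x + t • (y - x)) ≤
      2 ^ d * volume Q * ∫⁻ z in Q, w z := by
    intro t ht
    have h1 : ∫⁻ x in Q, ∫⁻ y in Q, w (x + t • (y - x)) =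
        ∫⁻ x in Q, ∫⁻ y in Q, w' ((1 - t) • x + t • y) :=
      setLIntegral_congr_fun hQ fun x hx => setLIntegral_congr_fun hQ fun y hy => hseg t ht x hx y hy
    rw [h1]
    rcases le_total 2⁻¹ t with h | h
    · calc _ ≤ ∫⁻ x in Q, 2 ^ d * ∫⁻ z in Q, w z := lintegral_mono fun x => hcomp _ t h
        _ = _ := by rw [setLIntegral_const]; ring
    · rw [lintegral_lintegral_swap]
      · calc _ ≤ ∫⁻ y in Q, 2 ^ d * ∫⁻ z in Q, w z := lintegral_mono fun y => by
              have := hcomp (t • y) (1 - t) (by linarith)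
              simpa only [add_comm] using this
          _ = _ := by rw [setLIntegral_const]; ring
      · exact (hwm.comp (by fun_prop)).aemeasurable
  have hm3 : Measurable fun z : (EuclideanSpace ℝ (Fin d) × EuclideanSpace ℝ (Fin d)) × ℝ =>
      w (z.1.1 + z.2 • (z.1.2 - z.1.1)) := hw.comp (by fun_prop)
  have hm2 : Measurable fun z : EuclideanSpace ℝ (Fin d) × EuclideanSpace ℝ (Fin d) =>
      ∫⁻ t in Set.Icc (0:ℝ) 1, w (z.1 + t • (z.2 - z.1)) := hm3.lintegral_prod_right'
  calc ∫⁻ x in Q, ∫⁻ y in Q, ∫⁻ t in Set.Icc (0:ℝ) 1, w (x + t • (y - x))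
      = ∫⁻ z, (∫⁻ t in Set.Icc (0:ℝ) 1, w (z.1 + t • (z.2 - z.1)))
          ∂((volume.restrict Q).prod (volume.restrict Q)) :=
        (lintegral_prod _ hm2.aemeasurable).symm
    _ = ∫⁻ t in Set.Icc (0:ℝ) 1, (∫⁻ z, w (z.1 + t • (z.2 - z.1))
          ∂((volume.restrict Q).prod (volume.restrict Q))) :=
        lintegral_lintegral_swap hm3.aemeasurable
    _ ≤ ∫⁻ _t in Set.Icc (0:ℝ) 1, 2 ^ d * volume Q * ∫⁻ z in Q, w z := by
        refine setLIntegral_mono' measurableSet_Icc fun t ht => ?_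
        rw [lintegral_prod (fun z : EuclideanSpace ℝ (Fin d) × EuclideanSpace ℝ (Fin d) =>
          w (z.1 + t • (z.2 - z.1))) (hw.comp (by fun_prop)).aemeasurable]
        exact key t ht
    _ = _ := by rw [setLIntegral_const]; simp

variable {V F₁ F₂ : Type*} [NormedAddCommGroup V] [NormedSpace ℝ V]
  [NormedAddCommGroup F₁] [NormedSpace ℝ F₁] [NormedAddCommGroup F₂] [NormedSpace ℝ F₂]

/-- The fundamental theorem of calculus and the chain rule. The factor with the derivative of Φ is
kept inside the integral because it localizes a truncation to one dyadic range of values. -/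
theorem enorm_comp_sub_le_lintegral_segment {u : V → F₁} (hu : ContDiff ℝ 1 u) {Φ : F₁ → F₂}
    (hΦ : ContDiff ℝ 1 Φ) (x y : V) :
    ‖Φ (u x) - Φ (u y)‖ₑ ≤ ‖x - y‖ₑ * ∫⁻ t in Set.Icc (0:ℝ) 1,
      ‖fderiv ℝ Φ (u (x + t • (y - x)))‖ₑ * ‖fderiv ℝ u (x + t • (y - x))‖ₑ := by
  set γ : ℝ → V := fun t => x + t • (y - x) with hγ
  have hγd : ∀ t, HasDerivAt γ (y - x) t := fun t => by
    have := ((hasDerivAt_id t).smul_const (y - x)).const_add x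
    rwa [one_smul] at this
  have hγc : ContDiff ℝ 1 γ := by fun_prop
  have h := enorm_sub_le_lintegral_deriv_of_contDiffOn_Icc
    (f := fun t => Φ (u (γ t))) (a := 0) (b := 1) ((hΦ.comp (hu.comp hγc)).contDiffOn) zero_le_one
  have h0 : γ 0 = x := by simp [hγ]
  have h1 : γ 1 = y := by simp [hγ]
  rw [h0, h1, enorm_sub_rev] at h
  refine h.trans ?_
  rw [← lintegral_const_mul' _ _ enorm_ne_top]
  refine lintegral_mono fun t => ?_
  have hd : HasDerivAt (fun t => Φ (u (γ t)))
      (fderiv ℝ Φ (u (γ t)) (fderiv ℝ u (γ t) (y - x))) t :=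
    ((hΦ.differentiable one_ne_zero _).hasFDerivAt.comp (γ t)
      (hu.differentiable one_ne_zero _).hasFDerivAt).comp_hasDerivAt t (hγd t)
  rw [hd.deriv]
  calc _ ≤ ‖fderiv ℝ Φ (u (γ t))‖ₑ * ‖fderiv ℝ u (γ t) (y - x)‖ₑ :=
        ContinuousLinearMap.le_opENorm _ _
    _ ≤ ‖fderiv ℝ Φ (u (γ t))‖ₑ * (‖fderiv ℝ u (γ t)‖ₑ * ‖y - x‖ₑ) := by
        gcongr; exact ContinuousLinearMap.le_opENorm _ _
    _ = _ := by rw [enorm_sub_rev x y]; ring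

end Segment

/-! ### Weak gradients and the Poincaré inequality for compositions -/

section WeakGradient

open Filter ContinuousLinearMap
open scoped Convolution

variable {d : ℕ} {𝕜 : Type*} [RCLike 𝕜]

theorem integrable_indicator_of_locallyIntegrableOn {F : Type*} [NormedAddCommGroup F]
    {Ω K : Set (EuclideanSpace ℝ (Fin d))} {f : EuclideanSpace ℝ (Fin d) → F}
    (hf : LocallyIntegrableOn f Ω volume) (hK : IsCompact K) (hKΩ : K ⊆ Ω) :
    Integrable (K.indicator f) volume :=
  (hf.integrableOn_compact_subset hKΩ hK).integrable_indicator hK.measurableSet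

theorem norm_le_of_apply_single {T : EuclideanSpace ℝ (Fin d) →L[ℝ] 𝕜} {v : EuclideanSpace 𝕜 (Fin d)}
    (h : ∀ i, T (EuclideanSpace.single i 1) = v i) : ‖T‖ ≤ ‖v‖ := by
  refine T.opNorm_le_bound (norm_nonneg _) fun x => ?_
  have hx : x = ∑ i, x i • EuclideanSpace.single i (1:ℝ) := by
    ext j
    simp [Finset.sum_apply, Pi.single_apply]
  have hT : T x = ∑ i, x i • v i := by
    conv_lhs => rw [hx]
    simp only [map_sum, map_smul, h]
  rw [hT]
  calc ‖∑ i, x i • v i‖ ≤ ∑ i, ‖v i‖ * ‖x i‖ :=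
        (norm_sum_le _ _).trans (Finset.sum_le_sum fun i _ => by rw [norm_smul, mul_comm])
    _ ≤ √(∑ i, ‖v i‖ ^ 2) * √(∑ i, ‖x i‖ ^ 2) := Real.sum_mul_le_sqrt_mul_sqrt _ _ _
    _ = ‖v‖ * ‖x‖ := by rw [EuclideanSpace.norm_eq, EuclideanSpace.norm_eq]

/-- The reflected mollifier centered at x is a test function supported in K, so the cut-off to K is
invisible and the weak derivative passes to the mollification. The sign from the reflection cancels
the one from integration by parts. -/
theorem HasWeakGradientOn.fderiv_convolution_le {Ω K : Set (EuclideanSpace ℝ (Fin d))}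
    {g : EuclideanSpace ℝ (Fin d) → 𝕜} {G : EuclideanSpace ℝ (Fin d) → EuclideanSpace 𝕜 (Fin d)}
    (h : HasWeakGradientOn Ω g G) (hK : IsCompact K) (hKΩ : K ⊆ Ω)
    (φ : ContDiffBump (0 : EuclideanSpace ℝ (Fin d))) {x : EuclideanSpace ℝ (Fin d)}
    (hx : Metric.closedBall x φ.rOut ⊆ K) :
    ‖fderiv ℝ (φ.normed volume ⋆[lsmul ℝ ℝ, volume] K.indicator g) x‖ₑ ≤
      ‖(φ.normed volume ⋆[lsmul ℝ ℝ, volume] K.indicator G) x‖ₑ := by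
  obtain ⟨hg, hG, hw⟩ := h
  have hgi := integrable_indicator_of_locallyIntegrableOn hg hK hKΩ
  have hGi := integrable_indicator_of_locallyIntegrableOn hG hK hKΩ
  set ρ := φ.normed (volume : Measure (EuclideanSpace ℝ (Fin d))) with hρ
  have hρs : HasCompactSupport ρ := φ.hasCompactSupport_normed
  have hρc : ContDiff ℝ ∞ ρ := φ.contDiff_normed
  have hρt : tsupport ρ = Metric.closedBall 0 φ.rOut := φ.tsupport_normed_eq
  have hρ1 : ContDiff ℝ 1 ρ := hρc.of_le (by exact_mod_cast le_top)
  rw [← ofReal_norm, ← ofReal_norm]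
  refine ENNReal.ofReal_le_ofReal (norm_le_of_apply_single fun i => ?_)
  have hout : ∀ t, t ∉ K → x - t ∉ tsupport ρ := fun t ht hmem => by
    rw [hρt, mem_closedBall_zero_iff] at hmem
    exact ht (hx (by rwa [Metric.mem_closedBall, dist_eq_norm, norm_sub_rev]))
  -- the derivative of the mollification
  have h1 : fderiv ℝ (ρ ⋆[lsmul ℝ ℝ, volume] K.indicator g) x (EuclideanSpace.single i 1) =
      ∫ t, (fderiv ℝ ρ (x - t) (EuclideanSpace.single i 1)) • g t := by
    rw [(hρs.hasFDerivAt_convolution_left (lsmul ℝ ℝ) hρ1 hgi.locallyIntegrable x).fderiv,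
      convolution_eq_swap]
    have hex : ConvolutionExistsAt (fderiv ℝ ρ) (K.indicator g) x
        ((lsmul ℝ ℝ : ℝ →L[ℝ] 𝕜 →L[ℝ] 𝕜).precompL (EuclideanSpace ℝ (Fin d))) volume :=
      (hρs.fderiv ℝ).convolutionExists_left _ (hρ1.continuous_fderiv one_ne_zero)
        hgi.locallyIntegrable x
    rw [ContinuousLinearMap.integral_apply hex.integrable_swap]
    refine integral_congr_ae (ae_of_all _ fun t => ?_)
    simp only [precompL_apply, lsmul_apply]
    by_cases ht : t ∈ K
    · rw [Set.indicator_of_mem ht]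
    · have : fderiv ℝ ρ (x - t) = 0 := by
        by_contra hne
        exact hout t ht (support_fderiv_subset ℝ hne)
      simp [this]
  -- the mollification of the gradient
  have h2 : ((ρ ⋆[lsmul ℝ ℝ, volume] K.indicator G) x) i = ∫ t, ρ (x - t) • G t i := by
    rw [convolution_lsmul_swap]
    have hex : ConvolutionExistsAt ρ (K.indicator G) x (lsmul ℝ ℝ) volume :=
      hρs.convolutionExists_left _ hρ1.continuous hGi.locallyIntegrable x
    have hint := hex.integrable_swap
    simp only [lsmul_apply] at hint
    have := (EuclideanSpace.proj i : EuclideanSpace 𝕜 (Fin d) →L[𝕜] 𝕜).integral_comp_comm hint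
    refine this.symm.trans ?_
    refine integral_congr_ae (ae_of_all _ fun t => ?_)
    by_cases ht : t ∈ K
    · simp [Set.indicator_of_mem ht]
    · have : ρ (x - t) = 0 := by
        by_contra hne
        exact hout t ht (subset_tsupport _ hne)
      simp [this]
  rw [h1, h2]
  have hψd : ∀ t, fderiv ℝ (fun t => ρ (x - t)) t = -fderiv ℝ ρ (x - t) := fun t => by
    have h3 : HasFDerivAt (fun t => x - t) (-ContinuousLinearMap.id ℝ (EuclideanSpace ℝ (Fin d))) t :=
      (hasFDerivAt_id t).const_sub x
    refine ((hρ1.differentiable one_ne_zero (x - t)).hasFDerivAt.comp t h3).fderiv.trans ?_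
    ext; simp
  have hψt : tsupport (fun t => ρ (x - t)) ⊆ Ω := by
    refine (closure_minimal ?_ hK.isClosed).trans hKΩ
    intro t ht
    by_contra hne
    exact hout t hne (subset_tsupport _ ht)
  have hψs : HasCompactSupport (fun t => ρ (x - t)) :=
    HasCompactSupport.intro hK fun t ht => by
      by_contra hne
      exact hout t ht (subset_tsupport _ hne)
  have := hw (fun t => ρ (x - t)) (hρc.comp (by fun_prop)) hψs hψt i
  simp only [hψd, neg_apply, neg_smul, integral_neg, neg_inj] at this
  exact this

/-- A Poincaré inequality for the composition of a function having a weak gradient with a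
Lipschitz `C¹` function. -/
theorem HasWeakGradientOn.lintegral_comp_sub_rpow_le {Ω : Set (EuclideanSpace ℝ (Fin d))}
    (hΩ : IsOpen Ω)
    {g : EuclideanSpace ℝ (Fin d) → 𝕜} {G : EuclideanSpace ℝ (Fin d) → EuclideanSpace 𝕜 (Fin d)}
    (h : HasWeakGradientOn Ω g G) (hg : Measurable g) {a : EuclideanSpace ℝ (Fin d)} {L : ℝ}
    (hL : 0 < L) (hQΩ : closure (cube a L) ⊆ Ω) {F : Type*} [NormedAddCommGroup F]
    [NormedSpace ℝ F] {Φ : 𝕜 → F} (hΦ : ContDiff ℝ 1 Φ) {B : ℝ≥0∞} (hB : B ≠ ⊤)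
    (hΦB : ∀ z, ‖fderiv ℝ Φ z‖ₑ ≤ B) {p : ℝ} (hp : 1 ≤ p) :
    ∫⁻ x in cube a L, ∫⁻ y in cube a L, ‖Φ (g x) - Φ (g y)‖ₑ ^ p ≤
      ENNReal.ofReal (d * L) ^ p * (2 ^ d * volume (cube a L) *
        ∫⁻ x in cube a L, (‖fderiv ℝ Φ (g x)‖ₑ * ‖G x‖ₑ) ^ p) := by
  set Q := cube a L with hQdef
  have hQ : MeasurableSet Q := measurableSet_cube a L
  have hQc : Convex ℝ Q := convex_cube a L
  have hQt : volume Q ≠ ⊤ := volume_cube_ne_top a L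
  have hQb : IsCompact (closure Q) := by
    refine Bornology.IsBounded.isCompact_closure (Metric.isBounded_iff.2 ⟨d * L, fun x hx y hy => ?_⟩)
    rw [dist_eq_norm]; exact norm_sub_le_of_mem_cube hx hy hL
  have hp0 : 0 ≤ p := by linarith
  obtain ⟨r, hr, hrΩ⟩ := hQb.exists_cthickening_subset_open hΩ hQΩ
  set K := Metric.cthickening r (closure Q) with hKdef
  have hK : IsCompact K := hQb.cthickening
  have hQK : Q ⊆ K := subset_closure.trans (Metric.self_subset_cthickening _)
  have hgi := integrable_indicator_of_locallyIntegrableOn h.1 hK hrΩ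
  have hGi := integrable_indicator_of_locallyIntegrableOn h.2.1 hK hrΩ
  set φ : ℕ → ContDiffBump (0 : EuclideanSpace ℝ (Fin d)) := fun n =>
    ⟨r / (n + 1) / 2, r / (n + 1), by positivity, by linarith [show 0 < r / (n + 1) by positivity]⟩
    with hφ
  have hφr : ∀ n, (φ n).rOut ≤ r := fun n => by
    change r / (n + 1) ≤ r
    exact div_le_self hr.le (by linarith [(Nat.cast_nonneg n : (0:ℝ) ≤ n)])
  have hφ0 : Tendsto (fun n => (φ n).rOut) atTop (𝓝 0) := by
    have := (tendsto_const_div_atTop_nhds_zero_nat r).comp (tendsto_add_atTop_nat 1)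
    refine this.congr fun n => ?_
    simp [hφ]
  set u : ℕ → EuclideanSpace ℝ (Fin d) → 𝕜 := fun n =>
    (φ n).normed volume ⋆[lsmul ℝ ℝ, volume] K.indicator g with hu
  set v : ℕ → EuclideanSpace ℝ (Fin d) → EuclideanSpace 𝕜 (Fin d) := fun n =>
    (φ n).normed volume ⋆[lsmul ℝ ℝ, volume] K.indicator G with hv
  have huc : ∀ n, ContDiff ℝ 1 (u n) := fun n =>
    (φ n).hasCompactSupport_normed.contDiff_convolution_left _ (n := 1) (φ n).contDiff_normed
      hgi.locallyIntegrable
  have hvc : ∀ n, Continuous (v n) := fun n =>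
    (φ n).hasCompactSupport_normed.continuous_convolution_left _ (φ n).continuous_normed
      hGi.locallyIntegrable
  have huv : ∀ n, ∀ x ∈ Q, ‖fderiv ℝ (u n) x‖ₑ ≤ ‖v n x‖ₑ := fun n x hx => by
    refine h.fderiv_convolution_le hK hrΩ (φ n) ?_
    exact (Metric.closedBall_subset_closedBall (hφr n)).trans
      (Metric.closedBall_subset_cthickening (subset_closure hx) r)
  have hulim : ∀ᵐ x ∂(volume.restrict Q), Tendsto (fun n => u n x) atTop (𝓝 (g x)) := by
    have := ContDiffBump.ae_convolution_tendsto_right_of_locallyIntegrable (K := 2) hφ0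
      (Eventually.of_forall fun n => by change r / (n + 1) ≤ 2 * (r / (n + 1) / 2); linarith)
      hgi.locallyIntegrable
    filter_upwards [ae_restrict_of_ae this, self_mem_ae_restrict hQ] with x hx hxQ
    rwa [Set.indicator_of_mem (hQK hxQ)] at hx
  -- a measurable representative of the gradient
  obtain ⟨G', hG'm, hG'⟩ := hGi.1
  have hG'i : Integrable G' volume := hGi.congr hG'
  have hGG' : ∀ᵐ x ∂(volume.restrict Q), G x = G' x := by
    filter_upwards [ae_restrict_of_ae hG', self_mem_ae_restrict hQ] with x hx hxQ
    rwa [Set.indicator_of_mem (hQK hxQ)] at hx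
  have hvlim : Tendsto (fun n => ∫⁻ x in Q, ‖v n x - G' x‖ₑ) atTop (𝓝 0) := by
    have := tendsto_lintegral_convolution_sub hφ0 hGi hQt
    refine this.congr fun n => lintegral_congr_ae ?_
    filter_upwards [ae_restrict_of_ae hG'] with x hx
    rw [hx]
  have hDc : Continuous (fderiv ℝ Φ) := hΦ.continuous_fderiv one_ne_zero
  set w : EuclideanSpace ℝ (Fin d) → ℝ≥0∞ := fun x => ‖fderiv ℝ Φ (g x)‖ₑ * ‖G' x‖ₑ with hw
  have hwm : Measurable w := ((hDc.enorm.measurable).comp hg).mul hG'm.enorm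
  -- The error made by replacing, in the chain rule bound for the mollification, the derivative of Φ
  -- at u n by that at g, and the mollified gradient by the gradient itself. Boundedness and
  -- continuity of the derivative of Φ make it small in L¹.
  set e : ℕ → EuclideanSpace ℝ (Fin d) → ℝ≥0∞ := fun n x =>
    ‖fderiv ℝ Φ (u n x) - fderiv ℝ Φ (g x)‖ₑ * ‖G' x‖ₑ + B * ‖v n x - G' x‖ₑ with he
  have hpair : Continuous fun z : 𝕜 × 𝕜 => ‖fderiv ℝ Φ z.1 - fderiv ℝ Φ z.2‖ₑ := by fun_prop
  have he1m : ∀ n, Measurable fun x => ‖fderiv ℝ Φ (u n x) - fderiv ℝ Φ (g x)‖ₑ * ‖G' x‖ₑ :=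
    fun n => (hpair.measurable.comp ((huc n).continuous.measurable.prodMk hg)).mul hG'm.enorm
  have he2m : ∀ n, Measurable fun x => ‖v n x - G' x‖ₑ := fun n =>
    ((hvc n).stronglyMeasurable.sub hG'm).enorm
  have hem : ∀ n, Measurable (e n) := fun n => (he1m n).add ((he2m n).const_mul B)
  have helim : Tendsto (fun n => ∫⁻ x in Q, e n x) atTop (𝓝 0) := by
    have h1 : Tendsto (fun n => ∫⁻ x in Q, ‖fderiv ℝ Φ (u n x) - fderiv ℝ Φ (g x)‖ₑ * ‖G' x‖ₑ)
        atTop (𝓝 0) := by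
      have := tendsto_lintegral_of_dominated_convergence (μ := volume.restrict Q)
        (F := fun n x => ‖fderiv ℝ Φ (u n x) - fderiv ℝ Φ (g x)‖ₑ * ‖G' x‖ₑ) (f := fun _ => 0)
        (fun x => (B + B) * ‖G' x‖ₑ) he1m
        (fun n => ae_of_all _ fun x => by
          beta_reduce
          gcongr
          exact enorm_sub_le.trans (add_le_add (hΦB _) (hΦB _)))
        (by
          rw [lintegral_const_mul _ hG'm.enorm]
          exact ENNReal.mul_ne_top (by finiteness) hG'i.restrict.2.ne)
        (by
          filter_upwards [hulim] with x hx
          have h2 : Tendsto (fun n => ‖fderiv ℝ Φ (u n x) - fderiv ℝ Φ (g x)‖ₑ) atTop (𝓝 0) := by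
            have := (((hDc.tendsto (g x)).comp hx).sub_const (fderiv ℝ Φ (g x))).enorm
            rwa [sub_self, ← ofReal_norm, norm_zero, ENNReal.ofReal_zero] at this
          have := ENNReal.Tendsto.mul_const h2 (b := ‖G' x‖ₑ) (Or.inr enorm_ne_top)
          simpa using this)
      simpa using this
    have h2 := ENNReal.Tendsto.const_mul hvlim (a := B) (Or.inr hB)
    have h3 := h1.add h2
    simp only [mul_zero, add_zero] at h3
    refine h3.congr fun n => ?_
    rw [he, lintegral_add_left (he1m n), lintegral_const_mul _ (he2m n)]
  set T : (EuclideanSpace ℝ (Fin d) → ℝ≥0∞) →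
      EuclideanSpace ℝ (Fin d) × EuclideanSpace ℝ (Fin d) → ℝ≥0∞ := fun f z =>
    ∫⁻ t in Set.Icc (0:ℝ) 1, f (z.1 + t • (z.2 - z.1)) with hT
  have hTm : ∀ f, Measurable f → Measurable (T f) := fun f hf => by
    have hm3 : Measurable fun z : (EuclideanSpace ℝ (Fin d) × EuclideanSpace ℝ (Fin d)) × ℝ =>
      f (z.1.1 + z.2 • (z.1.2 - z.1.1)) := hf.comp (by fun_prop)
    exact hm3.lintegral_prod_right'
  set m := (volume.restrict Q).prod (volume.restrict Q) with hm
  have hTint : ∀ f, Measurable f → ∫⁻ z, T f z ∂m ≤ 2 ^ d * volume Q * ∫⁻ x in Q, f x :=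
    fun f hf => by
      rw [hm, lintegral_prod _ (hTm f hf).aemeasurable]
      exact lintegral_cube_segment_le hQ hQc hf
  have hmQ : ∀ᵐ z ∂m, z.1 ∈ Q ∧ z.2 ∈ Q :=
    (Measure.quasiMeasurePreserving_fst.ae (self_mem_ae_restrict hQ)).and
      (Measure.quasiMeasurePreserving_snd.ae (self_mem_ae_restrict hQ))
  have hmu : ∀ᵐ z ∂m, Tendsto (fun n => u n z.1) atTop (𝓝 (g z.1)) ∧
      Tendsto (fun n => u n z.2) atTop (𝓝 (g z.2)) :=
    (Measure.quasiMeasurePreserving_fst.ae hulim).and (Measure.quasiMeasurePreserving_snd.ae hulim)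
  -- Averaging along segments is bounded on L¹, so the averaged errors tend to zero in mean. Fatou's
  -- lemma turns this into smallness for infinitely many n at almost every pair, which is enough to
  -- pass to the limit.
  have hliminf : ∀ᵐ z ∂m, liminf (fun n => T (e n) z) atTop = 0 := by
    have h1 : ∫⁻ z, liminf (fun n => T (e n) z) atTop ∂m = 0 := by
      refine le_antisymm ?_ zero_le
      refine (lintegral_liminf_le fun n => hTm _ (hem n)).trans ?_
      have h2 : Tendsto (fun n => ∫⁻ z, T (e n) z ∂m) atTop (𝓝 0) := by
        have h3 := ENNReal.Tendsto.const_mul helim (a := 2 ^ d * volume Q) (Or.inr (by finiteness))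
        rw [mul_zero] at h3
        exact tendsto_of_tendsto_of_tendsto_of_le_of_le tendsto_const_nhds h3
          (fun _ => zero_le) (fun n => hTint _ (hem n))
      exact h2.liminf_eq.le
    have := (lintegral_eq_zero_iff (Measurable.liminf fun n => hTm _ (hem n))).1 h1
    filter_upwards [this] with z hz using hz
  have hae : ∀ᵐ z ∂m, ‖Φ (g z.1) - Φ (g z.2)‖ₑ ≤ ‖z.1 - z.2‖ₑ * T w z := by
    filter_upwards [hmQ, hmu, hliminf] with z ⟨hz1, hz2⟩ ⟨hu1, hu2⟩ hz
    have hn : ∀ n, ‖Φ (u n z.1) - Φ (u n z.2)‖ₑ ≤ ‖z.1 - z.2‖ₑ * (T w z + T (e n) z) := fun n => by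
      refine (enorm_comp_sub_le_lintegral_segment (huc n) hΦ z.1 z.2).trans ?_
      gcongr
      rw [hT]
      simp only
      have hwt : Measurable fun t : ℝ => w (z.1 + t • (z.2 - z.1)) := hwm.comp (by fun_prop)
      rw [← lintegral_add_left hwt]
      refine setLIntegral_mono' measurableSet_Icc fun t ht => ?_
      have hmem : z.1 + t • (z.2 - z.1) ∈ Q := by
        have : z.1 + t • (z.2 - z.1) = (1 - t) • z.1 + t • z.2 := by module
        rw [this]
        exact hQc hz1 hz2 (by linarith [ht.2]) ht.1 (by ring)
      generalize z.1 + t • (z.2 - z.1) = x at hmem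
      simp only [hw, he]
      set D₁ := fderiv ℝ Φ (u n x)
      set D₂ := fderiv ℝ Φ (g x)
      have hD : ‖D₁‖ₑ ≤ ‖D₂‖ₑ + ‖D₁ - D₂‖ₑ := by
        rw [← ofReal_norm, ← ofReal_norm, ← ofReal_norm,
          ← ENNReal.ofReal_add (norm_nonneg _) (norm_nonneg _)]
        exact ENNReal.ofReal_le_ofReal (norm_le_norm_add_norm_sub' _ _)
      have hV : ‖v n x‖ₑ ≤ ‖G' x‖ₑ + ‖v n x - G' x‖ₑ := by
        calc ‖v n x‖ₑ = ‖G' x + (v n x - G' x)‖ₑ := by rw [add_sub_cancel]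
          _ ≤ _ := enorm_add_le _ _
      calc ‖D₁‖ₑ * ‖fderiv ℝ (u n) x‖ₑ ≤ ‖D₁‖ₑ * (‖G' x‖ₑ + ‖v n x - G' x‖ₑ) := by
            gcongr; exact (huv n x hmem).trans hV
        _ = ‖D₁‖ₑ * ‖G' x‖ₑ + ‖D₁‖ₑ * ‖v n x - G' x‖ₑ := by ring
        _ ≤ (‖D₂‖ₑ + ‖D₁ - D₂‖ₑ) * ‖G' x‖ₑ + B * ‖v n x - G' x‖ₑ := by
            gcongr; exact hΦB _
        _ = _ := by ring
    have hlim : Tendsto (fun n => ‖Φ (u n z.1) - Φ (u n z.2)‖ₑ) atTop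
        (𝓝 ‖Φ (g z.1) - Φ (g z.2)‖ₑ) :=
      (((hΦ.continuous.tendsto _).comp hu1).sub ((hΦ.continuous.tendsto _).comp hu2)).enorm
    have hε : ∀ ε : ℝ≥0, 0 < ε →
        ‖Φ (g z.1) - Φ (g z.2)‖ₑ ≤ ‖z.1 - z.2‖ₑ * (T w z + ε) := fun ε hε => by
      refine le_of_tendsto_of_frequently hlim ?_
      have hfr : ∃ᶠ n in atTop, T (e n) z < ε :=
        frequently_lt_of_liminf_lt (by isBoundedDefault) (by rw [hz]; exact_mod_cast hε)
      exact hfr.mono fun n hn' => (hn n).trans (by gcongr)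
    by_cases hne : ‖z.1 - z.2‖ₑ = 0
    · have := hε 1 one_pos
      rw [hne, zero_mul] at this ⊢; exact this
    have hne' : ‖z.1 - z.2‖ₑ ≠ ⊤ := enorm_ne_top
    refine (ENNReal.div_le_iff_le_mul (Or.inl hne) (Or.inl hne')).1 ?_ |>.trans_eq (mul_comm _ _)
    refine ENNReal.le_of_forall_pos_le_add fun ε hε' _ => ?_
    rw [ENNReal.div_le_iff_le_mul (Or.inl hne) (Or.inl hne'), mul_comm]
    exact hε ε hε'
  have hΦm : Measurable fun z : EuclideanSpace ℝ (Fin d) × EuclideanSpace ℝ (Fin d) =>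
      ‖Φ (g z.1) - Φ (g z.2)‖ₑ := by
    have : Continuous fun z : 𝕜 × 𝕜 => ‖Φ z.1 - Φ z.2‖ₑ := by
      have := hΦ.continuous; fun_prop
    exact this.measurable.comp ((hg.comp measurable_fst).prodMk (hg.comp measurable_snd))
  -- Jensen's inequality on the unit interval.
  have hTp : ∀ z, T w z ^ p ≤ T (fun x => w x ^ p) z := fun z => by
    have := lintegral_rpow_le (volume.restrict (Set.Icc (0:ℝ) 1))
      (h := fun t => w (z.1 + t • (z.2 - z.1))) (hwm.comp (by fun_prop)).aemeasurable hp
    simpa using this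
  calc ∫⁻ x in Q, ∫⁻ y in Q, ‖Φ (g x) - Φ (g y)‖ₑ ^ p
      = ∫⁻ z, ‖Φ (g z.1) - Φ (g z.2)‖ₑ ^ p ∂m := by
        rw [hm, lintegral_prod _ (hΦm.pow_const p).aemeasurable]
    _ ≤ ∫⁻ z, ENNReal.ofReal (d * L) ^ p * T (fun x => w x ^ p) z ∂m := by
        refine lintegral_mono_ae ?_
        filter_upwards [hae, hmQ] with z hz ⟨hz1, hz2⟩
        have h1 : ‖z.1 - z.2‖ₑ ≤ ENNReal.ofReal (d * L) := by
          rw [← ofReal_norm]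
          exact ENNReal.ofReal_le_ofReal (norm_sub_le_of_mem_cube hz1 hz2 hL)
        calc _ ≤ (ENNReal.ofReal (d * L) * T w z) ^ p := by
              gcongr; exact hz.trans (by gcongr)
          _ = ENNReal.ofReal (d * L) ^ p * T w z ^ p := ENNReal.mul_rpow_of_nonneg _ _ hp0
          _ ≤ _ := by gcongr; exact hTp z
    _ = ENNReal.ofReal (d * L) ^ p * ∫⁻ z, T (fun x => w x ^ p) z ∂m :=
        lintegral_const_mul _ (hTm _ (hwm.pow_const p))
    _ ≤ ENNReal.ofReal (d * L) ^ p * (2 ^ d * volume Q * ∫⁻ x in Q, w x ^ p) := by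
        gcongr; exact hTint _ (hwm.pow_const p)
    _ = _ := by
        congr 2
        refine lintegral_congr_ae ?_
        filter_upwards [hGG'] with x hx
        rw [hw, hx]

end WeakGradient

/-! ### Smooth truncation and the first order Poincaré inequality -/

section FirstOrder

theorem ENNReal.ofReal_two_zpow (k : ℤ) : ENNReal.ofReal ((2:ℝ) ^ k) = 2 ^ k := by
  have h : (2:ℝ≥0∞) = ((2:ℝ≥0) : ℝ≥0∞) := rfl
  rw [h, ← ENNReal.coe_zpow (by norm_num), ENNReal.ofReal, ENNReal.coe_inj]
  ext
  rw [Real.coe_toNNReal _ (by positivity)]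
  push_cast
  rfl

theorem two_zpow_le_enorm_iff {F : Type*} [SeminormedAddCommGroup F] (k : ℤ) (w : F) :
    (2:ℝ≥0∞) ^ k ≤ ‖w‖ₑ ↔ (2:ℝ) ^ k ≤ ‖w‖ := by
  rw [← ENNReal.ofReal_two_zpow, ← ofReal_norm, ENNReal.ofReal_le_ofReal_iff (norm_nonneg _)]

variable {d : ℕ} {𝕜 : Type*} [RCLike 𝕜]

/-- A smooth step in |z|², which is a polynomial in the real and imaginary parts. The step takes
place for |z|² between 3/2 and 5/2, so that Φ is locally constant also at |z| = 2; this makes the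
upper bound strict and the dyadic ranges disjoint. -/
theorem exists_smooth_truncation (𝕜 : Type*) [RCLike 𝕜] : ∃ (Φ : 𝕜 → ℝ) (B : ℝ), ContDiff ℝ 1 Φ ∧
    (∀ z, ‖fderiv ℝ Φ z‖ ≤ B) ∧ (∀ z, ‖z‖ < 1 → Φ z = 0) ∧ (∀ z, 2 ≤ ‖z‖ → Φ z = 1) ∧
    ∀ z, fderiv ℝ Φ z ≠ 0 → 1 ≤ ‖z‖ ∧ ‖z‖ < 2 := by
  set N : 𝕜 → ℝ := fun z => RCLike.reCLM z ^ 2 + RCLike.imCLM z ^ 2 with hN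
  have hNn : ∀ z, N z = ‖z‖ ^ 2 := fun z => by
    rw [RCLike.norm_sq_eq_def]; simp [hN, sq]
  set Φ : 𝕜 → ℝ := fun z => Real.smoothTransition (N z - 3 / 2) with hΦ
  have hΦc : ContDiff ℝ 1 Φ := by
    refine Real.smoothTransition.contDiff.comp ?_
    have h1 : ContDiff ℝ 1 fun z : 𝕜 => RCLike.reCLM z := (RCLike.reCLM : 𝕜 →L[ℝ] ℝ).contDiff
    have h2 : ContDiff ℝ 1 fun z : 𝕜 => RCLike.imCLM z := (RCLike.imCLM : 𝕜 →L[ℝ] ℝ).contDiff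
    exact ((h1.pow 2).add (h2.pow 2)).sub contDiff_const
  have hlow : ∀ z, ‖z‖ < 1 → Φ z = 0 := fun z hz =>
    Real.smoothTransition.zero_of_nonpos (by rw [hNn]; nlinarith [norm_nonneg z])
  have hup : ∀ z, 19 / 10 < ‖z‖ → Φ z = 1 := fun z hz =>
    Real.smoothTransition.one_of_one_le (by rw [hNn]; nlinarith [norm_nonneg z])
  have hd : ∀ z, fderiv ℝ Φ z ≠ 0 → 1 ≤ ‖z‖ ∧ ‖z‖ < 2 := by
    intro z hz
    constructor
    · by_contra! hlt
      apply hz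
      have : Φ =ᶠ[𝓝 z] fun _ => 0 := by
        filter_upwards [continuous_norm.tendsto z |>.eventually (gt_mem_nhds hlt)] with y hy
        exact hlow y hy
      rw [this.fderiv_eq, fderiv_fun_const]; rfl
    · by_contra! hlt
      apply hz
      have : Φ =ᶠ[𝓝 z] fun _ => 1 := by
        filter_upwards [continuous_norm.tendsto z |>.eventually
          (lt_mem_nhds (show 19 / 10 < ‖z‖ by linarith))] with y hy
        exact hup y hy
      rw [this.fderiv_eq, fderiv_fun_const]; rfl
  have hs : HasCompactSupport (fderiv ℝ Φ) :=
    HasCompactSupport.intro (isCompact_closedBall (0:𝕜) 2) fun z hz => by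
      by_contra hne
      exact hz (mem_closedBall_zero_iff.2 (hd z hne).2.le)
  obtain ⟨B, hB⟩ := (hΦc.continuous_fderiv one_ne_zero).bounded_above_of_compact_support hs
  exact ⟨Φ, B, hΦc, hB, hlow, fun z hz => hup z (by linarith), hd⟩

theorem tsum_dyadic_indicator_le (X Y : ℝ≥0∞) :
    ∑' k : ℤ, (if (2:ℝ≥0∞) ^ k ≤ X ∧ X < 2 ^ (k + 1) then Y else 0) ≤ Y := by
  by_cases h : ∃ n : ℤ, (2:ℝ≥0∞) ^ n ≤ X ∧ X < 2 ^ (n + 1)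
  · obtain ⟨n, hn⟩ := h
    rw [tsum_eq_single n, if_pos hn]
    intro k hk
    rw [if_neg]
    rintro ⟨h1, h2⟩
    rcases lt_or_gt_of_ne hk with hlt | hlt
    · have : (2:ℝ≥0∞) ^ (k + 1) ≤ 2 ^ n := ENNReal.zpow_le_of_le (by norm_num) (by omega)
      exact absurd (h2.trans_le (this.trans hn.1)) (lt_irrefl _)
    · have : (2:ℝ≥0∞) ^ (n + 1) ≤ 2 ^ k := ENNReal.zpow_le_of_le (by norm_num) (by omega)
      exact absurd (hn.2.trans_le (this.trans h1)) (lt_irrefl _)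
  · push Not at h
    have : ∀ k : ℤ, ¬ ((2:ℝ≥0∞) ^ k ≤ X ∧ X < 2 ^ (k + 1)) := fun k hk =>
      absurd hk.2 (not_lt.2 (h k hk.1))
    simp [this]

/-- The first order Poincaré inequality. -/
theorem exists_hasPoincare_one (d : ℕ) (𝕜 : Type*) [RCLike 𝕜] {p : ℝ} (hp : 1 ≤ p) :
    ∃ A : ℝ≥0∞, A ≠ ⊤ ∧ ∀ (Ω : Set (EuclideanSpace ℝ (Fin d))) (g : EuclideanSpace ℝ (Fin d) → 𝕜)
      (G : EuclideanSpace ℝ (Fin d) → EuclideanSpace 𝕜 (Fin d)) (a : EuclideanSpace ℝ (Fin d))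
      (L : ℝ), IsOpen Ω → HasWeakGradientOn Ω g G → Measurable g → 0 < L →
      closure (cube a L) ⊆ Ω →
      HasPoincare A 1 p a L g (∫⁻ x in cube a L, ‖G x‖ₑ ^ p) := by
  obtain ⟨Φ, B, hΦ, hΦB, hΦ0, hΦ1, hΦd⟩ := exists_smooth_truncation 𝕜
  have hp0 : 0 ≤ p := by linarith
  set b := ENNReal.ofReal B with hb
  have hbt : b ≠ ⊤ := ENNReal.ofReal_ne_top
  set D : ℝ≥0∞ := (d : ℝ≥0∞) ^ p * 2 ^ d with hD
  have hDt : D ≠ ⊤ := ENNReal.mul_ne_top (ENNReal.rpow_ne_top_of_nonneg hp0 (by finiteness))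
    (by finiteness)
  have hbp : b ^ p ≠ ⊤ := ENNReal.rpow_ne_top_of_nonneg hp0 hbt
  have hdl : ∀ l : ℝ, 0 < l → ENNReal.ofReal (d * l) ^ p * (2 ^ d * ENNReal.ofReal l ^ d) =
      D * ENNReal.ofReal l ^ (d + 1 * p) := fun l hl => by
    rw [ENNReal.ofReal_mul (by positivity), ENNReal.mul_rpow_of_nonneg _ _ hp0,
      ENNReal.ofReal_natCast, one_mul, ENNReal.rpow_add _ _ (by simpa using hl) (by simp),
      ENNReal.rpow_natCast, hD]
    ring
  refine ⟨1 + D * (1 + b ^ p), by finiteness, ?_⟩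
  intro Ω g G a L hΩ h hg hL hQΩ
  unfold HasPoincare
  set Q := cube a L with hQdef
  have hQ : MeasurableSet Q := measurableSet_cube a L
  have hQb : IsCompact (closure Q) := by
    refine Bornology.IsBounded.isCompact_closure (Metric.isBounded_iff.2 ⟨d * L, fun x hx y hy => ?_⟩)
    rw [dist_eq_norm]; exact norm_sub_le_of_mem_cube hx hy hL
  have hGm : AEMeasurable (fun x => ‖G x‖ₑ ^ p) (volume.restrict Q) :=
    (((h.2.1.integrableOn_compact_subset hQΩ hQb).mono_set subset_closure).1.enorm).pow_const p
  set c := ⨍ z in Q, g z with hc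
  set S : ℤ → Set (EuclideanSpace ℝ (Fin d)) := fun k =>
    {x | (2:ℝ≥0∞) ^ k ≤ ‖g x - c‖ₑ ∧ ‖g x - c‖ₑ < 2 ^ (k + 1)} with hS
  have hSm : ∀ k, MeasurableSet (S k) := fun k =>
    (measurableSet_le measurable_const (hg.sub_const c).enorm).inter
      (measurableSet_lt (hg.sub_const c).enorm measurable_const)
  -- The truncation at level k sees the gradient only where |g - c| lies in [2^k, 2^{k+1}). These
  -- sets are disjoint, so the energies of the levels add up to at most the full one.
  set M : ℤ → Measure (EuclideanSpace ℝ (Fin d) × EuclideanSpace ℝ (Fin d)) := fun k =>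
    (volume.withDensity ((S k).indicator fun x => ‖G x‖ₑ ^ p)).map fun x => (x, x) with hM
  have hMR : ∀ k R, MeasurableSet R → M k (R ×ˢ R) =
      ∫⁻ x in R, (S k).indicator (fun x => ‖G x‖ₑ ^ p) x := by
    intro k R hR
    rw [hM, map_diag_prod_self _ hR, withDensity_apply _ hR]
  refine ⟨⟨M, ?_, ?_⟩, ?_⟩
  · simp only [fun k => hMR k Q hQ]
    rw [← lintegral_tsum fun k => hGm.indicator (hSm k)]
    refine le_trans ?_ (mul_le_mul_left (le_self_add : (1:ℝ≥0∞) ≤ _) _)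
    rw [one_mul]
    refine lintegral_mono fun x => ?_
    refine le_trans (le_of_eq ?_) (tsum_dyadic_indicator_le ‖g x - c‖ₑ (‖G x‖ₑ ^ p))
    refine tsum_congr fun k => ?_
    simp only [Set.indicator_apply, hS, Set.mem_ofPred_eq]
  · intro k a' l hl hlL hsub
    set R := cube a' l with hRdef
    have hR : MeasurableSet R := measurableSet_cube a' l
    set τ : ℝ := 2 ^ k with hτ
    have hτ0 : 0 < τ := by positivity
    have hτE : ENNReal.ofReal τ = 2 ^ k := ENNReal.ofReal_two_zpow k
    have h2k0 : (2:ℝ≥0∞) ^ k ≠ 0 := (ENNReal.zpow_pos (by simp) (by simp) k).ne'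
    have h2kt : (2:ℝ≥0∞) ^ k ≠ ⊤ := ENNReal.zpow_ne_top (by simp) (by simp) k
    -- The rescaled truncation is 0 below height 2^k and 1 above height 2^{k+1}, with derivative of
    -- order 2^{-k}. The p-th power of that derivative is what the factor 2^{kp} compensates.
    set Ψ : 𝕜 → ℝ := fun z => Φ (τ⁻¹ • (z - c)) with hΨ
    have hΨc : ContDiff ℝ 1 Ψ := hΦ.comp (by fun_prop)
    have hΨd : ∀ z, fderiv ℝ Ψ z = τ⁻¹ • fderiv ℝ Φ (τ⁻¹ • (z - c)) := fun z => by
      have h3 : HasFDerivAt (fun z : 𝕜 => τ⁻¹ • (z - c)) (τ⁻¹ • ContinuousLinearMap.id ℝ 𝕜) z :=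
        ((hasFDerivAt_id z).sub_const c).const_smul τ⁻¹
      refine ((hΦ.differentiable one_ne_zero _).hasFDerivAt.comp z h3).fderiv.trans ?_
      ext; simp
    have hnorm : ∀ z, ‖fderiv ℝ Ψ z‖ ≤ τ⁻¹ * B := fun z => by
      rw [hΨd, norm_smul, Real.norm_of_nonneg (by positivity)]
      gcongr; exact hΦB _
    have hnormE : ∀ z, ‖fderiv ℝ Ψ z‖ₑ ≤ (2 ^ k)⁻¹ * b := fun z => by
      rw [← ofReal_norm, ← hτE, hb, ← ENNReal.ofReal_inv_of_pos hτ0,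
        ← ENNReal.ofReal_mul (by positivity)]
      exact ENNReal.ofReal_le_ofReal (hnorm z)
    have hscale : ∀ z, ‖τ⁻¹ • (z - c)‖ = τ⁻¹ * ‖z - c‖ := fun z => by
      rw [norm_smul, Real.norm_of_nonneg (by positivity)]
    have h2k1 : (2:ℝ) ^ (k + 1) = τ * 2 := by rw [zpow_add₀ (by norm_num), zpow_one]
    have hΨ0 : ∀ x, x ∉ {x | (2:ℝ≥0∞) ^ k ≤ ‖g x - c‖ₑ} → Ψ (g x) = 0 := fun x hx => by
      rw [Set.mem_ofPred_eq, two_zpow_le_enorm_iff, not_le] at hx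
      refine hΦ0 _ ?_
      rw [hscale, inv_mul_lt_iff₀ hτ0, mul_one]; exact hx
    have hΨ1 : ∀ x, x ∈ {x | (2:ℝ≥0∞) ^ (k + 1) ≤ ‖g x - c‖ₑ} → Ψ (g x) = 1 := fun x hx => by
      rw [Set.mem_ofPred_eq, two_zpow_le_enorm_iff, h2k1] at hx
      refine hΦ1 _ ?_
      rw [hscale, le_inv_mul_iff₀ hτ0]; exact hx
    have hsupp : ∀ x, x ∉ S k → fderiv ℝ Ψ (g x) = 0 := fun x hx => by
      by_contra hne
      rw [hΨd] at hne
      obtain ⟨h1, h2⟩ := hΦd _ (fun h0 => hne (by rw [h0, smul_zero]))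
      rw [hscale] at h1 h2
      rw [le_inv_mul_iff₀ hτ0, mul_one] at h1
      rw [inv_mul_lt_iff₀ hτ0, ← h2k1] at h2
      refine hx ⟨(two_zpow_le_enorm_iff k _).2 h1, ?_⟩
      rw [← not_le, two_zpow_le_enorm_iff, not_le]; exact h2
    have hpoin := h.lintegral_comp_sub_rpow_le hΩ hg hl ((closure_mono hsub).trans hQΩ) hΨc
      (ENNReal.mul_ne_top (ENNReal.inv_ne_top.2 h2k0) hbt) hnormE hp
    have hlow : volume ({x | (2:ℝ≥0∞) ^ (k + 1) ≤ ‖g x - c‖ₑ} ∩ R) *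
        volume (R \ {x | (2:ℝ≥0∞) ^ k ≤ ‖g x - c‖ₑ}) ≤
        ∫⁻ x in R, ∫⁻ y in R, ‖Ψ (g x) - Ψ (g y)‖ₑ ^ p := by
      set E₁ := {x | (2:ℝ≥0∞) ^ (k + 1) ≤ ‖g x - c‖ₑ}
      set E₀ := {x | (2:ℝ≥0∞) ^ k ≤ ‖g x - c‖ₑ}
      have hE₁ : MeasurableSet E₁ := measurableSet_le measurable_const (by fun_prop)
      have hE₀ : MeasurableSet E₀ := measurableSet_le measurable_const (by fun_prop)
      calc volume (E₁ ∩ R) * volume (R \ E₀)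
          = ∫⁻ _x in E₁ ∩ R, ∫⁻ _y in R \ E₀, 1 := by
            simp [mul_comm]
        _ ≤ ∫⁻ x in E₁ ∩ R, ∫⁻ y in R \ E₀, ‖Ψ (g x) - Ψ (g y)‖ₑ ^ p := by
            refine setLIntegral_mono' (hE₁.inter hR) fun x hx =>
              setLIntegral_mono' (MeasurableSet.diff hR hE₀) fun y hy => ?_
            rw [hΨ1 x hx.1, hΨ0 y hy.2]; simp
        _ ≤ ∫⁻ x in R, ∫⁻ y in R, ‖Ψ (g x) - Ψ (g y)‖ₑ ^ p := by
            refine (lintegral_mono_set Set.inter_subset_right).trans ?_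
            exact lintegral_mono fun x => lintegral_mono_set Set.sdiff_subset
    have hup : ∫⁻ x in R, (‖fderiv ℝ Ψ (g x)‖ₑ * ‖G x‖ₑ) ^ p ≤
        ((2 ^ k)⁻¹ * b) ^ p * M k (R ×ˢ R) := by
      rw [hMR k R hR, ← lintegral_const_mul' _ _ (ENNReal.rpow_ne_top_of_nonneg hp0
        (ENNReal.mul_ne_top (ENNReal.inv_ne_top.2 h2k0) hbt))]
      refine lintegral_mono fun x => ?_
      by_cases hx : x ∈ S k
      · rw [Set.indicator_of_mem hx, ENNReal.mul_rpow_of_nonneg _ _ hp0]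
        gcongr; exact hnormE _
      · have h0 : ‖fderiv ℝ Ψ (g x)‖ₑ = 0 := by
          rw [hsupp x hx, ← ofReal_norm, norm_zero, ENNReal.ofReal_zero]
        rw [h0, zero_mul, ENNReal.zero_rpow_of_pos (by linarith)]; exact zero_le
    have hvol : volume R = ENNReal.ofReal l ^ d := volume_cube _ _
    rw [hvol] at hpoin
    calc ((2:ℝ≥0∞) ^ k) ^ p * volume ({x | (2:ℝ≥0∞) ^ (k + 1) ≤ ‖g x - c‖ₑ} ∩ R) *
          volume (R \ {x | (2:ℝ≥0∞) ^ k ≤ ‖g x - c‖ₑ})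
        = ((2:ℝ≥0∞) ^ k) ^ p * (volume ({x | (2:ℝ≥0∞) ^ (k + 1) ≤ ‖g x - c‖ₑ} ∩ R) *
          volume (R \ {x | (2:ℝ≥0∞) ^ k ≤ ‖g x - c‖ₑ})) := by rw [mul_assoc]
      _ ≤ ((2:ℝ≥0∞) ^ k) ^ p * (ENNReal.ofReal (d * l) ^ p * (2 ^ d * ENNReal.ofReal l ^ d *
            (((2 ^ k)⁻¹ * b) ^ p * M k (R ×ˢ R)))) := by
          refine mul_le_mul_right ((hlow.trans hpoin).trans ?_) _
          gcongr
      _ = (2 ^ k * (2 ^ k)⁻¹) ^ p * b ^ p * (ENNReal.ofReal (d * l) ^ p * (2 ^ d *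
            ENNReal.ofReal l ^ d)) * M k (R ×ˢ R) := by
          rw [ENNReal.mul_rpow_of_nonneg _ _ hp0, ENNReal.mul_rpow_of_nonneg _ _ hp0]; ring
      _ = D * b ^ p * ENNReal.ofReal l ^ (d + 1 * p) * M k (R ×ˢ R) := by
          rw [ENNReal.mul_inv_cancel h2k0 h2kt, ENNReal.one_rpow, hdl l hl]; ring
      _ ≤ _ := by
          gcongr
          calc D * b ^ p ≤ D * (1 + b ^ p) := by gcongr; exact le_add_self
            _ ≤ _ := le_add_self
  -- The untruncated inequality is the case of the identity map.
  · have hpoin := h.lintegral_comp_sub_rpow_le hΩ hg hL hQΩ (Φ := fun z : 𝕜 => z) contDiff_id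
      ENNReal.one_ne_top (fun z => by
        rw [← ofReal_norm]
        refine ENNReal.ofReal_le_one.2 ?_
        rw [show (fun z : 𝕜 => z) = id from rfl, fderiv_id]
        exact ContinuousLinearMap.norm_id_le) hp
    refine hpoin.trans ?_
    have hvol : volume Q = ENNReal.ofReal L ^ d := volume_cube _ _
    have hle : ∫⁻ x in Q, (‖fderiv ℝ (fun z : 𝕜 => z) (g x)‖ₑ * ‖G x‖ₑ) ^ p ≤
        ∫⁻ x in Q, ‖G x‖ₑ ^ p := by
      refine lintegral_mono fun x => ?_
      gcongr
      calc _ ≤ 1 * ‖G x‖ₑ := by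
            gcongr
            rw [← ofReal_norm]
            refine ENNReal.ofReal_le_one.2 ?_
            rw [show (fun z : 𝕜 => z) = id from rfl, fderiv_id]
            exact ContinuousLinearMap.norm_id_le
        _ = _ := one_mul _
    calc _ ≤ ENNReal.ofReal (d * L) ^ p * (2 ^ d * ENNReal.ofReal L ^ d *
          ∫⁻ x in Q, ‖G x‖ₑ ^ p) := by rw [← hvol]; gcongr
      _ = D * ENNReal.ofReal L ^ (d + 1 * p) * ∫⁻ x in Q, ‖G x‖ₑ ^ p := by
          rw [← hdl L hL]; ring
      _ ≤ _ := by
          gcongr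
          calc D = D * 1 := (mul_one _).symm
            _ ≤ D * (1 + b ^ p) := by gcongr; exact le_self_add
            _ ≤ _ := le_add_self

end FirstOrder

/-! ### Cubes along the axes and comparison of weights -/

section AxisCube

variable {d : ℕ}

/-- The lower corner of `axisCube`. -/
noncomputable def axisCorner (i : Fin d) (σ R : ℝ) : EuclideanSpace ℝ (Fin d) :=
  WithLp.toLp 2 fun j => R * ((if j = i then 5 * σ else 0) - 9 / 2)

/-- The cube of side `9R` centered at the point `5σR` of the `i`-th axis. -/
noncomputable def axisCube (i : Fin d) (σ R : ℝ) : Set (EuclideanSpace ℝ (Fin d)) :=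
  cube (axisCorner i σ R) (9 * R)

/-- The part of the dyadic shell of size `R` in which the `i`-th coordinate dominates. -/
def axisShell (i : Fin d) (σ R : ℝ) : Set (EuclideanSpace ℝ (Fin d)) :=
  {x | R ≤ σ * x i ∧ ∀ j, |x j| ≤ 2 * R}

theorem measurableSet_axisCube (i : Fin d) (σ R : ℝ) : MeasurableSet (axisCube i σ R) :=
  measurableSet_cube _ _

theorem measurableSet_axisShell (i : Fin d) (σ R : ℝ) : MeasurableSet (axisShell i σ R) := by
  have : axisShell i σ R = {x | R ≤ σ * x i} ∩ ⋂ j, {x | |x j| ≤ 2 * R} := by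
    ext x; simp [axisShell]
  rw [this]
  refine (measurableSet_le measurable_const (by fun_prop)).inter (MeasurableSet.iInter fun j => ?_)
  exact measurableSet_le (by fun_prop) measurable_const

variable {i : Fin d} {σ R : ℝ}

theorem half_le_of_mem_axisCube (hσ : σ = 1 ∨ σ = -1) {x : EuclideanSpace ℝ (Fin d)}
    (hx : x ∈ axisCube i σ R) : R / 2 ≤ σ * x i ∧ σ * x i ≤ 19 / 2 * R := by
  have h := hx i
  simp only [axisCorner, if_true] at h
  rcases hσ with rfl | rfl <;> constructor <;> linarith [h.1, h.2]

theorem le_norm_of_mem_axisCube (hσ : σ = 1 ∨ σ = -1) {x : EuclideanSpace ℝ (Fin d)}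
    (hx : x ∈ axisCube i σ R) : R / 2 ≤ ‖x‖ := by
  have h := (half_le_of_mem_axisCube hσ hx).1
  have h2 : |x i| ≤ ‖x‖ := PiLp.norm_apply_le x i
  have h3 : σ * x i ≤ |x i| := by
    rcases hσ with rfl | rfl
    · rw [one_mul]; exact le_abs_self _
    · rw [neg_one_mul]; exact neg_le_abs _
  linarith

theorem norm_le_of_mem_axisCube (hσ : σ = 1 ∨ σ = -1) (hR : 0 < R) {x : EuclideanSpace ℝ (Fin d)}
    (hx : x ∈ axisCube i σ R) : ‖x‖ ≤ 10 * d * R := by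
  refine (norm_le_card_mul (r := 10 * R) (by positivity) fun j => ?_).trans (le_of_eq (by ring))
  have h := hx j
  simp only [axisCorner] at h
  rw [abs_le]
  by_cases hj : j = i
  · simp only [hj, if_true] at h
    rw [hj]
    rcases hσ with rfl | rfl <;> constructor <;> linarith [h.1, h.2]
  · simp only [hj, if_false] at h
    constructor <;> linarith [h.1, h.2]

theorem closure_axisCube_subset (hσ : σ = 1 ∨ σ = -1) (hR : 0 < R) :
    closure (axisCube i σ R) ⊆ {(0 : EuclideanSpace ℝ (Fin d))}ᶜ := by
  have hcl : IsClosed {x : EuclideanSpace ℝ (Fin d) | R / 2 ≤ σ * x i} :=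
    isClosed_le continuous_const (by fun_prop)
  refine (closure_minimal (fun x hx => (half_le_of_mem_axisCube hσ hx).1) hcl).trans ?_
  intro x hx h0
  rw [Set.mem_singleton_iff] at h0
  subst h0
  have h1 : R / 2 ≤ σ * (0 : EuclideanSpace ℝ (Fin d)) i := hx
  simp only [PiLp.zero_apply, mul_zero] at h1
  linarith

theorem axisShell_subset (hσ : σ = 1 ∨ σ = -1) (hR : 0 < R) :
    axisShell i σ R ⊆ axisCube i σ R := by
  intro x hx j
  have h1 := abs_le.1 (hx.2 j)
  have h2 := hx.1
  simp only [axisCorner]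
  by_cases hj : j = i
  · subst hj
    simp only [if_true]
    rcases hσ with rfl | rfl <;> constructor <;> linarith
  · simp only [hj, if_false]
    constructor <;> linarith

/-- Along the axis the cube covers from R/2 to 19R/2, and it reaches 9R/2 in the other directions.
It therefore holds two consecutive dyadic shells, which is what the telescoping over scales needs.
-/
theorem axisShell_two_mul_subset (hσ : σ = 1 ∨ σ = -1) (hR : 0 < R) :
    axisShell i σ (2 * R) ⊆ axisCube i σ R := by
  intro x hx j
  have h1 := abs_le.1 (hx.2 j)
  have h2 := hx.1
  simp only [axisCorner]
  by_cases hj : j = i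
  · subst hj
    simp only [if_true]
    rcases hσ with rfl | rfl <;> constructor <;> linarith
  · simp only [hj, if_false]
    constructor <;> linarith

theorem disjoint_axisCube (hσ : σ = 1 ∨ σ = -1) (hR : 0 < R) {R' : ℝ} (h : 32 * R ≤ R') :
    Disjoint (axisCube i σ R) (axisCube i σ R') := by
  refine Set.disjoint_left.2 fun x hx hx' => ?_
  have h1 := (half_le_of_mem_axisCube hσ hx).2
  have h2 := (half_le_of_mem_axisCube hσ hx').1
  linarith

/-- The sign attached to a Boolean. -/
def boolSign (b : Bool) : ℝ := if b then 1 else -1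

theorem boolSign_eq (b : Bool) : boolSign b = 1 ∨ boolSign b = -1 := by
  cases b <;> simp [boolSign]

theorem exists_mem_axisShell {x : EuclideanSpace ℝ (Fin d)} (hx : x ≠ 0) :
    ∃ (i : Fin d) (b : Bool) (k : ℤ), x ∈ axisShell i (boolSign b) (2 ^ k) := by
  obtain ⟨j, hj⟩ : ∃ j, x j ≠ 0 := by
    by_contra! h
    exact hx (by ext j; simp [h j])
  obtain ⟨i, -, hi⟩ := Finset.exists_max_image Finset.univ (fun j => |x j|) ⟨j, Finset.mem_univ _⟩
  have hpos : 0 < |x i| := (abs_pos.2 hj).trans_le (hi j (Finset.mem_univ _))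
  obtain ⟨k, hk, hk'⟩ := exists_mem_Ico_zpow hpos (y := (2:ℝ)) (by norm_num)
  have h2 : ∀ j, |x j| ≤ 2 * 2 ^ k := fun j => by
    have : (2:ℝ) ^ (k + 1) = 2 * 2 ^ k := by rw [zpow_add₀ (by norm_num)]; ring
    exact (hi j (Finset.mem_univ _)).trans (hk'.le.trans this.le)
  rcases le_total 0 (x i) with h | h
  · exact ⟨i, true, k, by simpa [boolSign, abs_of_nonneg h] using hk, h2⟩
  · exact ⟨i, false, k, by simpa [boolSign, abs_of_nonpos h] using hk, h2⟩

/-- The comparison constant between `‖x‖^t` and `R^t` in `axisCube i σ R`. -/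
noncomputable def weightConst (d : ℕ) (t : ℝ) : ℝ≥0∞ := (10 * d : ℝ≥0∞) ^ |t|

theorem weightConst_ne_top (d : ℕ) (t : ℝ) : weightConst d t ≠ ⊤ :=
  ENNReal.rpow_ne_top_of_nonneg (abs_nonneg t) (by finiteness)

theorem one_le_weightConst (hd : 1 ≤ d) (t : ℝ) : 1 ≤ weightConst d t := by
  have h1 : (1:ℝ≥0∞) ≤ d := by exact_mod_cast hd
  have h2 : (1:ℝ≥0∞) ≤ 10 * d := by
    calc (1:ℝ≥0∞) = 1 * 1 := by simp
      _ ≤ 10 * d := by gcongr; norm_num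
  calc (1:ℝ≥0∞) = 1 ^ |t| := (ENNReal.one_rpow _).symm
    _ ≤ _ := ENNReal.rpow_le_rpow h2 (abs_nonneg t)

/-- Both comparisons are needed because the exponent of a weight may have either sign. -/
theorem ENNReal.rpow_le_rpow_abs_mul {x y m : ℝ≥0∞} (t : ℝ) (hm0 : m ≠ 0) (hm : m ≠ ⊤)
    (hxy : x ≤ m * y) (hyx : y ≤ m * x) : x ^ t ≤ m ^ |t| * y ^ t := by
  rcases le_total 0 t with h | h
  · rw [abs_of_nonneg h, ← ENNReal.mul_rpow_of_nonneg _ _ h]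
    exact ENNReal.rpow_le_rpow hxy h
  · rw [abs_of_nonpos h]
    have h1 : y ^ (-t) ≤ m ^ (-t) * x ^ (-t) := by
      rw [← ENNReal.mul_rpow_of_nonneg _ _ (by linarith)]
      exact ENNReal.rpow_le_rpow hyx (by linarith)
    have hmt0 : m ^ (-t) ≠ 0 := by simp [hm0, hm]
    have hmt : m ^ (-t) ≠ ⊤ := ENNReal.rpow_ne_top_of_nonneg (by linarith) hm
    have h2 : (m ^ (-t))⁻¹ * (x ^ (-t))⁻¹ ≤ (y ^ (-t))⁻¹ := by
      rw [← ENNReal.mul_inv (Or.inl hmt0) (Or.inl hmt)]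
      exact ENNReal.inv_le_inv.2 h1
    rw [← ENNReal.rpow_neg x, ← ENNReal.rpow_neg y, neg_neg] at h2
    calc x ^ t = m ^ (-t) * ((m ^ (-t))⁻¹ * x ^ t) := by
          rw [← mul_assoc, ENNReal.mul_inv_cancel hmt0 hmt, one_mul]
      _ ≤ _ := by gcongr

theorem weight_comparison (hd : 1 ≤ d) (hσ : σ = 1 ∨ σ = -1) (hR : 0 < R) (t : ℝ)
    {x : EuclideanSpace ℝ (Fin d)} (hx : x ∈ axisCube i σ R) :
    ‖x‖ₑ ^ t ≤ weightConst d t * ENNReal.ofReal R ^ t ∧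
      ENNReal.ofReal R ^ t ≤ weightConst d t * ‖x‖ₑ ^ t := by
  have hdR : (1:ℝ) ≤ d := by exact_mod_cast hd
  have h10 : (10 * d : ℝ≥0∞) = ENNReal.ofReal (10 * d) := by
    rw [ENNReal.ofReal_mul (by norm_num), ENNReal.ofReal_natCast]; norm_num
  have h1 : ‖x‖ₑ ≤ 10 * d * ENNReal.ofReal R := by
    rw [h10, ← ENNReal.ofReal_mul (by positivity), ← ofReal_norm]
    exact ENNReal.ofReal_le_ofReal (norm_le_of_mem_axisCube hσ hR hx)
  have h2 : ENNReal.ofReal R ≤ 10 * d * ‖x‖ₑ := by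
    rw [h10, ← ofReal_norm, ← ENNReal.ofReal_mul (by positivity)]
    refine ENNReal.ofReal_le_ofReal ?_
    have := le_norm_of_mem_axisCube hσ hx
    nlinarith
  have hm0 : (10 * d : ℝ≥0∞) ≠ 0 := by
    have : d ≠ 0 := by omega
    simp [this]
  have hmt : (10 * d : ℝ≥0∞) ≠ ⊤ := by finiteness
  exact ⟨ENNReal.rpow_le_rpow_abs_mul t hm0 hmt h1 h2, ENNReal.rpow_le_rpow_abs_mul t hm0 hmt h2 h1⟩

theorem one_le_weight (hd : 1 ≤ d) (hσ : σ = 1 ∨ σ = -1) (hR : 0 < R) (t : ℝ)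
    {x : EuclideanSpace ℝ (Fin d)} (hx : x ∈ axisCube i σ R) :
    1 ≤ weightConst d t * ENNReal.ofReal R ^ (-t) * ‖x‖ₑ ^ t := by
  have hR0 : ENNReal.ofReal R ≠ 0 := by simpa using hR
  calc (1:ℝ≥0∞) = ENNReal.ofReal R ^ (-t) * ENNReal.ofReal R ^ t := by
        rw [← ENNReal.rpow_add _ _ hR0 ENNReal.ofReal_ne_top]; simp
    _ ≤ ENNReal.ofReal R ^ (-t) * (weightConst d t * ‖x‖ₑ ^ t) := by
        gcongr; exact (weight_comparison hd hσ hR t hx).2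
    _ = _ := by ring

/-- Cubes whose sizes differ by a factor of at least 32 = 2^5 are disjoint. Splitting k modulo 5
yields five disjoint families. -/
theorem tsum_axisCube_le (hσ : σ = 1 ∨ σ = -1)
    (m : Measure (EuclideanSpace ℝ (Fin d) × EuclideanSpace ℝ (Fin d))) :
    ∑' k : ℤ, m (axisCube i σ (2 ^ k) ×ˢ axisCube i σ (2 ^ k)) ≤ 5 * m Set.univ := by
  have hmod : ∀ r : Fin 5, ∑' j : ℤ, m (axisCube i σ (2 ^ (j * 5 + (r : ℤ))) ×ˢ
      axisCube i σ (2 ^ (j * 5 + (r : ℤ)))) ≤ m Set.univ := fun r => by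
    have key : ∀ j j' : ℤ, j < j' → Disjoint (axisCube i σ (2 ^ (j * 5 + (r : ℤ))))
        (axisCube i σ (2 ^ (j' * 5 + (r : ℤ)))) := fun j j' hlt => by
      refine disjoint_axisCube hσ (by positivity) ?_
      calc (32:ℝ) * 2 ^ (j * 5 + (r : ℤ)) = 2 ^ (5 + (j * 5 + (r : ℤ))) := by
            rw [zpow_add₀ (by norm_num) 5]; norm_num
        _ ≤ _ := zpow_le_zpow_right₀ (by norm_num) (by omega)
    rw [← Set.univ_prod_univ]
    refine m.tsum_prod_self_le (fun j => measurableSet_axisCube _ _ _) ?_ (fun _ => Set.subset_univ _)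
    intro j j' hne
    rcases lt_or_gt_of_ne hne with h | h
    · exact key _ _ h
    · exact (key _ _ h).symm
  rw [← (Int.divModEquiv 5).symm.tsum_eq, ENNReal.tsum_prod', ENNReal.tsum_comm, tsum_fintype]
  calc _ ≤ ∑ _r : Fin 5, m Set.univ := Finset.sum_le_sum fun r _ => by
        simpa [Int.divModEquiv] using hmod r
    _ = _ := by simp

end AxisCube

/-! ### From unweighted to weighted energies -/

section Mono

variable {d : ℕ} {𝕜 : Type*} [RCLike 𝕜]

/-- The condition 1 ≤ K is needed because the constant A also occurs in the truncated estimate,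
where the energy does not appear. -/
theorem HasPoincare.mono {A K : ℝ≥0∞} {s p : ℝ} {a : EuclideanSpace ℝ (Fin d)} {L : ℝ}
    {g : EuclideanSpace ℝ (Fin d) → 𝕜} {μ μ' : ℝ≥0∞} (h : HasPoincare A s p a L g μ)
    (hK : 1 ≤ K) (hμ : μ ≤ K * μ') : HasPoincare (A * K) s p a L g μ' := by
  obtain ⟨⟨M, hM, hP⟩, ho⟩ := h
  refine ⟨⟨M, ?_, fun k b l hl hlL hsub => ?_⟩, ?_⟩
  · calc _ ≤ A * μ := hM
      _ ≤ A * (K * μ') := by gcongr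
      _ = _ := by ring
  · refine (hP k b l hl hlL hsub).trans ?_
    gcongr
    exact le_mul_of_one_le_right' hK
  · refine ho.trans ?_
    calc _ ≤ A * ENNReal.ofReal L ^ (d + s * p) * (K * μ') := by gcongr
      _ = _ := by ring

/-- `HasPoincare` in all the axis cubes, with energies dominated by a measure on the square. -/
def HasWeightedPoincare (A : ℝ≥0∞) (s p α₁ : ℝ) (g : EuclideanSpace ℝ (Fin d) → 𝕜)
    (m : Measure (EuclideanSpace ℝ (Fin d) × EuclideanSpace ℝ (Fin d))) : Prop :=
  ∀ (i : Fin d) (σ R : ℝ), (σ = 1 ∨ σ = -1) → 0 < R →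
    HasPoincare A s p (axisCorner i σ R) (9 * R) g
      (ENNReal.ofReal R ^ (-(α₁ * p)) * m (axisCube i σ R ×ˢ axisCube i σ R))

theorem setLIntegral_le_weighted (hd : 1 ≤ d) {i : Fin d} {σ R : ℝ} (hσ : σ = 1 ∨ σ = -1)
    (hR : 0 < R) (t : ℝ) (f : EuclideanSpace ℝ (Fin d) → ℝ≥0∞) :
    ∫⁻ x in axisCube i σ R, f x ≤ weightConst d t *
      (ENNReal.ofReal R ^ (-t) * ∫⁻ x in axisCube i σ R, f x * ‖x‖ₑ ^ t) := by
  have hR0 : ENNReal.ofReal R ≠ 0 := by simpa using hR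
  have hc : weightConst d t * ENNReal.ofReal R ^ (-t) ≠ ⊤ :=
    ENNReal.mul_ne_top (weightConst_ne_top d t) (ENNReal.rpow_ne_top_of_ne_zero hR0 ENNReal.ofReal_ne_top)
  rw [← mul_assoc, ← lintegral_const_mul' _ _ hc]
  refine setLIntegral_mono' (measurableSet_axisCube _ _ _) fun x hx => ?_
  calc f x = 1 * f x := (one_mul _).symm
    _ ≤ (weightConst d t * ENNReal.ofReal R ^ (-t) * ‖x‖ₑ ^ t) * f x := by
        gcongr; exact one_le_weight hd hσ hR t hx
    _ = _ := by ring

theorem setLIntegral_prod_le_weighted (hd : 1 ≤ d) {i : Fin d} {σ R : ℝ} (hσ : σ = 1 ∨ σ = -1)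
    (hR : 0 < R) (t₁ t₂ : ℝ)
    (f : EuclideanSpace ℝ (Fin d) → EuclideanSpace ℝ (Fin d) → ℝ≥0∞) :
    ∫⁻ x in axisCube i σ R, ∫⁻ y in axisCube i σ R, f x y ≤ weightConst d t₁ * weightConst d t₂ *
      (ENNReal.ofReal R ^ (-(t₁ + t₂)) * ∫⁻ x in axisCube i σ R, ∫⁻ y in axisCube i σ R,
        f x y * ‖x‖ₑ ^ t₁ * ‖y‖ₑ ^ t₂) := by
  have hR0 : ENNReal.ofReal R ≠ 0 := by simpa using hR
  have hRt : ∀ t : ℝ, ENNReal.ofReal R ^ t ≠ ⊤ := fun t => ENNReal.rpow_ne_top_of_ne_zero hR0 ENNReal.ofReal_ne_top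
  have hc : weightConst d t₂ * ENNReal.ofReal R ^ (-t₂) ≠ ⊤ :=
    ENNReal.mul_ne_top (weightConst_ne_top d _) (hRt _)
  calc ∫⁻ x in axisCube i σ R, ∫⁻ y in axisCube i σ R, f x y
      ≤ weightConst d t₁ * (ENNReal.ofReal R ^ (-t₁) * ∫⁻ x in axisCube i σ R,
          (∫⁻ y in axisCube i σ R, f x y) * ‖x‖ₑ ^ t₁) :=
        setLIntegral_le_weighted hd hσ hR t₁ _
    _ ≤ weightConst d t₁ * (ENNReal.ofReal R ^ (-t₁) * ∫⁻ x in axisCube i σ R,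
          weightConst d t₂ * ENNReal.ofReal R ^ (-t₂) * ∫⁻ y in axisCube i σ R,
            f x y * ‖x‖ₑ ^ t₁ * ‖y‖ₑ ^ t₂) := by
        refine mul_le_mul_right (mul_le_mul_right
          (setLIntegral_mono' (measurableSet_axisCube _ _ _) fun x hx => ?_) _) _
        have hx0 : ‖x‖ₑ ≠ 0 := by
          rw [enorm_ne_zero]
          rintro rfl
          have := le_norm_of_mem_axisCube hσ hx
          rw [norm_zero] at this; linarith
        rw [mul_comm, ← lintegral_const_mul' _ _ (ENNReal.rpow_ne_top_of_ne_zero hx0 enorm_ne_top), mul_assoc]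
        refine (setLIntegral_le_weighted hd hσ hR t₂ _).trans (le_of_eq ?_)
        simp only [mul_comm (‖x‖ₑ ^ t₁)]
    _ = _ := by
        rw [lintegral_const_mul' _ _ hc, neg_add, ENNReal.rpow_add _ _ hR0 ENNReal.ofReal_ne_top]
        ring

end Mono

/-! ### The oscillation estimate at a single scale -/

section WeightedAnnulus

variable {d : ℕ} {𝕜 : Type*} [RCLike 𝕜]

/-- Control of the unweighted Coulomb energies of `g` in the axis cubes by a measure on the square
with the scaling of the weighted Coulomb energy. -/
def HasWeightedCoulomb (B : ℝ≥0∞) (α q α₂ : ℝ) (g : EuclideanSpace ℝ (Fin d) → 𝕜)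
    (n : Measure (EuclideanSpace ℝ (Fin d) × EuclideanSpace ℝ (Fin d))) : Prop :=
  ∀ (i : Fin d) (σ R : ℝ), (σ = 1 ∨ σ = -1) → 0 < R →
    ∫⁻ x in axisCube i σ R, ∫⁻ y in axisCube i σ R,
        ‖g x‖ₑ ^ q * ‖g y‖ₑ ^ q * ‖x - y‖ₑ ^ (-(d - α)) ≤
      B * (ENNReal.ofReal R ^ (-(α₂ * q)) * n (axisCube i σ R ×ˢ axisCube i σ R))

theorem hasWeightedCoulomb_withDensity (hd : 1 ≤ d) {α q α₂₁ α₂₂ α₂ : ℝ} (hα₂ : α₂ = α₂₁ + α₂₂)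
    {g : EuclideanSpace ℝ (Fin d) → 𝕜} (hg : Measurable g) :
    HasWeightedCoulomb (weightConst d (α₂₁ * q) * weightConst d (α₂₂ * q)) α q α₂ g
      ((volume.prod volume).withDensity fun z => ‖g z.1‖ₑ ^ q * ‖g z.2‖ₑ ^ q *
        ‖z.1 - z.2‖ₑ ^ (-(d - α)) * ‖z.1‖ₑ ^ (α₂₁ * q) * ‖z.2‖ₑ ^ (α₂₂ * q)) := by
  intro i σ R hσ hR
  rw [withDensity_prod_self _ (by fun_prop) (measurableSet_axisCube _ _ _), hα₂, add_mul]
  exact setLIntegral_prod_le_weighted hd hσ hR _ _ _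

theorem hasWeightedPoincare_zero (hd : 1 ≤ d) {p t : ℝ} (hp : 1 ≤ p)
    {g : EuclideanSpace ℝ (Fin d) → 𝕜} (hg : Measurable g) :
    HasWeightedPoincare (2 * (2 * 2 ^ p) * weightConst d (t * p)) 0 p t g
      ((volume.withDensity fun x => ‖g x‖ₑ ^ p * ‖x‖ₑ ^ (t * p)).map fun x => (x, x)) := by
  intro i σ R hσ hR
  rw [map_diag_prod_self _ (measurableSet_axisCube _ _ _),
    withDensity_apply _ (measurableSet_axisCube _ _ _)]
  exact (hasPoincare_zero hp _ _ hg).mono (one_le_weightConst hd _)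
    (setLIntegral_le_weighted hd hσ hR _ _)

theorem hasWeightedPoincare_fractional (hd : 1 ≤ d) {s p t t₁ t₂ : ℝ} (hs : 0 < s) (hp : 1 ≤ p)
    (ht : t = t₁ + t₂) {g : EuclideanSpace ℝ (Fin d) → 𝕜} (hg : Measurable g) :
    HasWeightedPoincare ((2 + (d : ℝ≥0∞) ^ (d + s * p)) *
      (weightConst d (t₁ * p) * weightConst d (t₂ * p))) s p t g
      ((volume.prod volume).withDensity fun z => ‖g z.1 - g z.2‖ₑ ^ p *
        ‖z.1 - z.2‖ₑ ^ (-(d + s * p)) * ‖z.1‖ₑ ^ (t₁ * p) * ‖z.2‖ₑ ^ (t₂ * p)) := by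
  intro i σ R hσ hR
  rw [withDensity_prod_self _ (by fun_prop) (measurableSet_axisCube _ _ _), ht, show (t₁ + t₂) * p = t₁ * p + t₂ * p from add_mul _ _ _]
  refine (hasPoincare_fractional hd hs hp _ (by positivity) hg).mono ?_
    (setLIntegral_prod_le_weighted hd hσ hR _ _ _)
  exact one_le_mul (one_le_weightConst hd _) (one_le_weightConst hd _)

theorem exists_hasWeightedPoincare_one (hd : 1 ≤ d) (𝕜 : Type*) [RCLike 𝕜] {p : ℝ} (t : ℝ)
    (hp : 1 ≤ p) :
    ∃ A : ℝ≥0∞, A ≠ ⊤ ∧ ∀ (g : EuclideanSpace ℝ (Fin d) → 𝕜)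
      (G : EuclideanSpace ℝ (Fin d) → EuclideanSpace 𝕜 (Fin d)), HasWeakGradientOn {0}ᶜ g G →
      Measurable g → HasWeightedPoincare A 1 p t g
        ((volume.withDensity fun x => ‖G x‖ₑ ^ p * ‖x‖ₑ ^ (t * p)).map fun x => (x, x)) := by
  obtain ⟨A, hA, h⟩ := exists_hasPoincare_one d 𝕜 hp
  refine ⟨A * weightConst d (t * p), ENNReal.mul_ne_top hA (weightConst_ne_top d _),
    fun g G hG hg i σ R hσ hR => ?_⟩
  rw [map_diag_prod_self _ (measurableSet_axisCube _ _ _),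
    withDensity_apply _ (measurableSet_axisCube _ _ _)]
  exact (h _ g G _ _ isOpen_compl_singleton hG hg (by positivity)
    (closure_axisCube_subset hσ hR)).mono (one_le_weightConst hd _)
    (setLIntegral_le_weighted hd hσ hR _ _)

/-- The local inequality with exponent γ, followed by Hölder down to γ' on a cube of volume (9R)^d.
The exponent e collects all powers of R; it vanishes under the scaling relation, but is left free
for the use with perturbed β₁, β₂ and γ. -/
theorem exists_axisCube_estimate (hd : 1 ≤ d) (𝕜 : Type*) [RCLike 𝕜]
    {s p q α β₁ β₂ γ γ' α₁ α₂ τ' e : ℝ}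
    (hp : 1 ≤ p) (hq : 1 ≤ q) (hα₀ : 0 < α) (hαd : α < d)
    (hβ₁ : 0 < β₁) (hβ₂ : 0 < β₂) (hγ'0 : 0 < γ') (hγγ' : γ' ≤ γ)
    (hγ : (d - s * p) * β₁ + (d + α) * β₂ = d / γ) (hβ : β₁ * p + 2 * β₂ * q = 1)
    (hβγ : 1 ≤ β₁ * γ + β₂ * γ) {A B : ℝ≥0∞} (hA : A ≠ ⊤) (hB : B ≠ ⊤)
    (he : e = d / γ' + τ' - d / γ - (β₁ * p * α₁ + β₂ * q * α₂)) :
    ∃ C : ℝ≥0∞, C ≠ ⊤ ∧ ∀ (g : EuclideanSpace ℝ (Fin d) → 𝕜)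
      (m n : Measure (EuclideanSpace ℝ (Fin d) × EuclideanSpace ℝ (Fin d))), Measurable g →
      HasWeightedPoincare A s p α₁ g m → HasWeightedCoulomb B α q α₂ g n →
      ∀ (i : Fin d) (σ R : ℝ), (σ = 1 ∨ σ = -1) → 0 < R → IntegrableOn g (axisCube i σ R) →
      ENNReal.ofReal R ^ (τ' * γ') *
        ∫⁻ x in axisCube i σ R, ‖g x - ⨍ z in axisCube i σ R, g z‖ₑ ^ γ' ≤
        C * (ENNReal.ofReal R ^ e * (m (axisCube i σ R ×ˢ axisCube i σ R) ^ β₁ *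
          n (axisCube i σ R ×ˢ axisCube i σ R) ^ β₂)) ^ γ' := by
  have hγ0 : 0 < γ := hγ'0.trans_le hγγ'
  obtain ⟨C, hC, h⟩ := exists_coulomb_sobolev_cube (𝕜 := 𝕜) hd hp hq hα₀ hαd hβ₁ hβ₂ hγ0 hγ hβ
    hβγ hA
  have h1γ : 0 ≤ 1 - γ' / γ := by
    rw [sub_nonneg, div_le_one hγ0]; exact hγγ'
  refine ⟨9 ^ (d * (1 - γ' / γ)) * (C ^ (γ' / γ) * (B ^ β₂) ^ γ'), ?_, ?_⟩
  · refine ENNReal.mul_ne_top (ENNReal.rpow_ne_top_of_nonneg (by positivity) (by finiteness))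
      (ENNReal.mul_ne_top (ENNReal.rpow_ne_top_of_nonneg (by positivity) hC)
      (ENNReal.rpow_ne_top_of_nonneg hγ'0.le (ENNReal.rpow_ne_top_of_nonneg hβ₂.le hB)))
  intro g m n hg hm hn i σ R hσ hR hint
  have hR0 : ENNReal.ofReal R ≠ 0 := by simpa using hR
  have hRt : ENNReal.ofReal R ≠ ⊤ := ENNReal.ofReal_ne_top
  have hloc := h (axisCorner i σ R) (9 * R) g _ (by positivity) hg hint (hm i σ R hσ hR)
  change (∫⁻ x in axisCube i σ R, ‖g x - ⨍ z in axisCube i σ R, g z‖ₑ ^ γ) ≤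
    C * (_ * (∫⁻ x in axisCube i σ R, ∫⁻ y in axisCube i σ R, _) ^ β₂) ^ γ at hloc
  have hc := hn i σ R hσ hR
  set c := ⨍ z in axisCube i σ R, g z
  set r := ENNReal.ofReal R
  set X := m (axisCube i σ R ×ˢ axisCube i σ R)
  set Y := n (axisCube i σ R ×ˢ axisCube i σ R)
  have hJ := hloc.trans (mul_le_mul_right (ENNReal.rpow_le_rpow (mul_le_mul_right
    (ENNReal.rpow_le_rpow hc hβ₂.le) _) hγ0.le) C)
  have hholder := lintegral_rpow_le (volume.restrict (axisCube i σ R))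
    (h := fun x => ‖g x - c‖ₑ ^ γ') (by fun_prop) (p := γ / γ') (by rwa [le_div_iff₀ hγ'0, one_mul])
  simp only [← ENNReal.rpow_mul, mul_div_cancel₀ _ hγ'0.ne'] at hholder
  have hV : volume.restrict (axisCube i σ R) Set.univ = 9 ^ (d : ℝ) * r ^ (d : ℝ) := by
    rw [Measure.restrict_apply_univ, axisCube, volume_cube, ENNReal.ofReal_mul (by norm_num),
      mul_pow, ENNReal.rpow_natCast, ENNReal.rpow_natCast]
    norm_num; rfl
  rw [hV] at hholder
  have hI : ∫⁻ x in axisCube i σ R, ‖g x - c‖ₑ ^ γ' ≤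
      (9 ^ (d * (1 - γ' / γ)) * r ^ (d * (1 - γ' / γ))) *
        (C * ((r ^ (-(α₁ * p)) * X) ^ β₁ * (B * (r ^ (-(α₂ * q)) * Y)) ^ β₂) ^ γ) ^ (γ' / γ) := by
    have h2 := ENNReal.rpow_le_rpow (hholder.trans (mul_le_mul_right hJ _))
      (show 0 ≤ γ' / γ by positivity)
    rw [← ENNReal.rpow_mul, div_mul_div_comm, mul_comm γ γ', div_self (by positivity),
      ENNReal.rpow_one] at h2
    refine h2.trans (le_of_eq ?_)
    rw [ENNReal.mul_rpow_of_nonneg _ _ (by positivity : 0 ≤ γ' / γ), ← ENNReal.rpow_mul,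
      show (γ / γ' - 1) * (γ' / γ) = 1 - γ' / γ by field_simp,
      ENNReal.mul_rpow_of_nonneg _ _ h1γ, ← ENNReal.rpow_mul, ← ENNReal.rpow_mul]
  refine (mul_le_mul_right hI _).trans (le_of_eq ?_)
  have hexp : e * γ' = τ' * γ' + d * (1 - γ' / γ) + (-(α₁ * p * β₁)) * γ'
      + (-(α₂ * q * β₂)) * γ' := by
    rw [he]; field_simp; ring
  rw [ENNReal.mul_rpow_of_nonneg _ _ (by positivity : 0 ≤ γ' / γ), ← ENNReal.rpow_mul _ γ,
    mul_div_cancel₀ _ hγ0.ne', ENNReal.mul_rpow_of_nonneg _ _ hβ₁.le,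
    ENNReal.mul_rpow_of_nonneg _ _ hβ₂.le, ENNReal.mul_rpow_of_nonneg _ _ hβ₂.le,
    ← ENNReal.rpow_mul, ← ENNReal.rpow_mul]
  simp only [ENNReal.mul_rpow_of_nonneg _ _ hγ'0.le]
  rw [← ENNReal.rpow_mul r, ← ENNReal.rpow_mul r, ← ENNReal.rpow_mul r e, hexp,
    ENNReal.rpow_add _ _ hR0 hRt, ENNReal.rpow_add _ _ hR0 hRt, ENNReal.rpow_add _ _ hR0 hRt]
  simp only [neg_mul]
  ring

end WeightedAnnulus

/-! ### Recovering a function from its oscillations over dyadic scales -/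

section Telescoping

/-- The recursion is run downwards from an index beyond which y vanishes. That zero initial value is
what makes the bound free of y. -/
theorem ENNReal.tsum_int_le_of_le_mul_succ {y e : ℤ → ℝ≥0∞} {θ : ℝ≥0∞} (hθ : θ < 1)
    (h : ∀ k, y k ≤ θ * y (k + 1) + e k) (h0 : ∃ k₀, ∀ k, k₀ ≤ k → y k = 0) :
    ∑' k, y k ≤ (1 - θ)⁻¹ * ∑' k, e k := by
  obtain ⟨k₀, h0⟩ := h0
  have h1 := ENNReal.tsum_le_of_le_mul_add (y := fun n : ℕ => y (k₀ - n))
    (A := fun n : ℕ => e (k₀ - n - 1)) hθ fun n => by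
      have := h (k₀ - n - 1)
      rw [sub_add_cancel] at this
      rw [show k₀ - ((n + 1 : ℕ) : ℤ) = k₀ - n - 1 by push_cast; ring]
      exact this
  calc ∑' k, y k ≤ ∑' n : ℕ, y (k₀ + n) + ∑' n : ℕ, y (k₀ - n) := ENNReal.tsum_int_le y k₀
    _ = ∑' n : ℕ, y (k₀ - n) := by
        rw [ENNReal.tsum_eq_zero.2 fun n : ℕ => h0 _ (by omega), zero_add]
    _ ≤ _ := h1
    _ ≤ _ := by
        rw [show y (k₀ - ((0 : ℕ) : ℤ)) = 0 from h0 _ (by simp), zero_add]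
        refine mul_le_mul_right (ENNReal.tsum_comp_le_tsum_of_injective (f := fun n : ℕ => k₀ - n - 1)
          (fun a b hab => ?_) e) _
        simp only at hab
        omega

theorem ENNReal.tsum_int_le_of_succ_le_mul {y e : ℤ → ℝ≥0∞} {θ : ℝ≥0∞} (hθ : θ < 1)
    (h : ∀ k, y (k + 1) ≤ θ * y k + e k) (h0 : ∃ k₀, ∀ k, k ≤ k₀ → y k = 0) :
    ∑' k, y k ≤ (1 - θ)⁻¹ * ∑' k, e k := by
  obtain ⟨k₀, h0⟩ := h0
  have h1 := ENNReal.tsum_int_le_of_le_mul_succ (y := fun k => y (-k)) (e := fun k => e (-k - 1)) hθ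
    (fun k => by
      have := h (-k - 1)
      rw [sub_add_cancel] at this
      rw [show -(k + 1) = -k - 1 by ring]
      exact this) ⟨-k₀, fun k hk => h0 _ (by omega)⟩
  rw [← (Equiv.neg ℤ).tsum_eq y]
  refine h1.trans (mul_le_mul_right ?_ _)
  refine ENNReal.tsum_comp_le_tsum_of_injective (f := fun k : ℤ => -k - 1) (fun a b hab => ?_) e
  simp only at hab
  omega

/-- Convexity of the power with weights θ and 1 - θ. Unlike the bound with 2^{r-1}, it allows the
coefficient of the main term to be as close to 1 as the telescoping requires. -/
theorem ENNReal.add_rpow_le_of_lt_one {θ : ℝ≥0∞} (h0 : θ ≠ 0) (h1 : θ < 1) {r : ℝ} (hr : 1 ≤ r)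
    (a b : ℝ≥0∞) : (a + b) ^ r ≤ θ ^ (1 - r) * a ^ r + (1 - θ) ^ (1 - r) * b ^ r := by
  have hθt : θ ≠ ⊤ := h1.ne_top
  have h20 : 1 - θ ≠ 0 := (tsub_pos_of_lt h1).ne'
  have h2t : 1 - θ ≠ ⊤ := by finiteness
  have key : ∀ w a : ℝ≥0∞, w ≠ 0 → w ≠ ⊤ → w * (w⁻¹ * a) ^ r = w ^ (1 - r) * a ^ r := by
    intro w a hw hwt
    rw [ENNReal.mul_rpow_of_nonneg _ _ (by linarith), ← mul_assoc, ENNReal.inv_rpow,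
      ENNReal.rpow_sub _ _ hw hwt, ENNReal.rpow_one, div_eq_mul_inv]
  have h := ENNReal.rpow_arith_mean_le_arith_mean2_rpow θ (1 - θ) (θ⁻¹ * a) ((1 - θ)⁻¹ * b)
    (add_tsub_cancel_of_le h1.le) hr
  rwa [key _ _ h0 hθt, key _ _ h20 h2t, ← mul_assoc, ← mul_assoc, ENNReal.mul_inv_cancel h0 hθt,
    ENNReal.mul_inv_cancel h20 h2t, one_mul, one_mul] at h

theorem lintegral_enorm_rpow_le_of_sub {X 𝕜 : Type*} [MeasurableSpace X] [RCLike 𝕜] (μ : Measure X)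
    {f₁ f₂ : X → 𝕜} (hf₁ : Measurable f₁) (hf₂ : Measurable f₂) (c : 𝕜) {θ : ℝ≥0∞} (h0 : θ ≠ 0)
    (h1 : θ < 1) {r : ℝ} (hr : 1 ≤ r) :
    ∫⁻ x, ‖f₁ x‖ₑ ^ r ∂μ ≤ θ ^ (1 - r) * ∫⁻ x, ‖f₂ x‖ₑ ^ r ∂μ + (1 - θ) ^ (1 - r) * 2 ^ (r - 1) *
      (∫⁻ x, ‖f₁ x - c‖ₑ ^ r ∂μ + ∫⁻ x, ‖f₂ x - c‖ₑ ^ r ∂μ) := by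
  rw [← lintegral_add_left (by fun_prop), ← lintegral_const_mul _ (by fun_prop),
    ← lintegral_const_mul _ (by fun_prop), ← lintegral_add_left (by fun_prop)]
  refine lintegral_mono fun x => ?_
  have htri : ‖f₁ x‖ₑ ≤ ‖f₂ x‖ₑ + (‖f₁ x - c‖ₑ + ‖f₂ x - c‖ₑ) := by
    calc ‖f₁ x‖ₑ = ‖f₂ x + ((f₁ x - c) - (f₂ x - c))‖ₑ := by congr 1; ring
      _ ≤ ‖f₂ x‖ₑ + ‖(f₁ x - c) - (f₂ x - c)‖ₑ := enorm_add_le _ _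
      _ ≤ _ := by gcongr; exact enorm_sub_le
  calc ‖f₁ x‖ₑ ^ r ≤ (‖f₂ x‖ₑ + (‖f₁ x - c‖ₑ + ‖f₂ x - c‖ₑ)) ^ r :=
        ENNReal.rpow_le_rpow htri (by linarith)
    _ ≤ _ := ENNReal.add_rpow_le_of_lt_one h0 h1 hr _ _
    _ ≤ _ := by
        rw [mul_assoc ((1 - θ) ^ (1 - r))]
        gcongr
        exact ENNReal.rpow_add_le_mul_rpow_add_rpow _ _ hr

variable {d : ℕ} {𝕜 : Type*} [RCLike 𝕜]

theorem setLIntegral_axisShell_comp_smul (i : Fin d) (σ R : ℝ)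
    {F : EuclideanSpace ℝ (Fin d) → ℝ≥0∞} (hF : Measurable F) :
    ∫⁻ x in axisShell i σ R, F ((2:ℝ) • x) =
      (2:ℝ≥0∞)⁻¹ ^ d * ∫⁻ x in axisShell i σ (2 * R), F x := by
  have hmem : ∀ x : EuclideanSpace ℝ (Fin d),
      (2:ℝ) • x ∈ axisShell i σ (2 * R) ↔ x ∈ axisShell i σ R := fun x => by
    simp only [axisShell, Set.mem_ofPred_eq, PiLp.smul_apply, smul_eq_mul, abs_mul, abs_two]
    refine and_congr ⟨fun h => by linarith, fun h => by linarith⟩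
      (forall_congr' fun j => ⟨fun h => by linarith, fun h => by linarith⟩)
  have h := lintegral_comp_add_smul ((axisShell i σ (2 * R)).indicator F)
    (hF.indicator (measurableSet_axisShell _ _ _)) 0 (t := 2) (by norm_num)
  rw [lintegral_indicator (measurableSet_axisShell _ _ _)] at h
  rw [← lintegral_indicator (measurableSet_axisShell _ _ _)]
  calc _ = ∫⁻ x, (axisShell i σ (2 * R)).indicator F (0 + (2:ℝ) • x) := by
        refine lintegral_congr fun x => ?_
        rw [zero_add]
        by_cases hx : x ∈ axisShell i σ R
        · rw [Set.indicator_of_mem hx, Set.indicator_of_mem ((hmem x).2 hx)]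
        · rw [Set.indicator_of_notMem hx, Set.indicator_of_notMem (mt (hmem x).1 hx)]
    _ = _ := h
    _ = _ := by
        congr 2
        rw [ENNReal.ofReal_inv_of_pos (by norm_num)]
        norm_num

/-- The scale-`R` part of the weighted Lebesgue norm in the direction of `axisShell i σ`. -/
noncomputable def shellNorm (r τ : ℝ) (g : EuclideanSpace ℝ (Fin d) → 𝕜) (i : Fin d) (σ R : ℝ) :
    ℝ≥0∞ :=
  ENNReal.ofReal R ^ (τ * r) * ∫⁻ x in axisShell i σ R, ‖g x‖ₑ ^ r

/-- The scale-`R` weighted oscillation of `g` in the direction of `axisCube i σ`. -/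
noncomputable def cubeOsc (r τ : ℝ) (g : EuclideanSpace ℝ (Fin d) → 𝕜) (i : Fin d) (σ R : ℝ) :
    ℝ≥0∞ :=
  ENNReal.ofReal R ^ (τ * r) *
    ∫⁻ x in axisCube i σ R, ‖g x - ⨍ z in axisCube i σ R, g z‖ₑ ^ r

section

variable {r τ : ℝ} {g : EuclideanSpace ℝ (Fin d) → 𝕜} {i : Fin d} {σ R : ℝ}

theorem shellNorm_two_mul (hg : Measurable g) (hR : 0 < R) :
    shellNorm r τ g i σ (2 * R) = (2:ℝ≥0∞) ^ (d + τ * r) * (ENNReal.ofReal R ^ (τ * r) *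
      ∫⁻ x in axisShell i σ R, ‖g ((2:ℝ) • x)‖ₑ ^ r) := by
  have hR0 : ENNReal.ofReal R ≠ 0 := by simpa using hR
  rw [setLIntegral_axisShell_comp_smul i σ R (F := fun x => ‖g x‖ₑ ^ r) (by fun_prop), shellNorm,
    ENNReal.ofReal_mul (by norm_num), ENNReal.mul_rpow_of_ne_zero (by simp) hR0,
    ENNReal.rpow_add _ _ (by norm_num) (by norm_num), ENNReal.rpow_natCast,
    show ENNReal.ofReal 2 = 2 by norm_num]
  have h2 : (2:ℝ≥0∞) ^ d * 2⁻¹ ^ d = 1 := by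
    rw [← mul_pow, ENNReal.mul_inv_cancel (by norm_num) (by norm_num), one_pow]
  calc _ = ((2:ℝ≥0∞) ^ d * 2⁻¹ ^ d) * (2 ^ (τ * r) * ENNReal.ofReal R ^ (τ * r) *
        ∫⁻ x in axisShell i σ (2 * R), ‖g x‖ₑ ^ r) := by rw [h2, one_mul]
    _ = _ := by ring

theorem setLIntegral_axisShell_sub_add_le (hσ : σ = 1 ∨ σ = -1) (hg : Measurable g) (hR : 0 < R)
    (c : 𝕜) :
    (∫⁻ x in axisShell i σ R, ‖g x - c‖ₑ ^ r) +
        ∫⁻ x in axisShell i σ R, ‖g ((2:ℝ) • x) - c‖ₑ ^ r ≤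
      2 * ∫⁻ x in axisCube i σ R, ‖g x - c‖ₑ ^ r := by
  rw [setLIntegral_axisShell_comp_smul i σ R (F := fun x => ‖g x - c‖ₑ ^ r) (by fun_prop),
    two_mul (∫⁻ _ in _, _)]
  refine add_le_add (lintegral_mono_set (axisShell_subset hσ hR)) ?_
  calc _ ≤ 1 * ∫⁻ x in axisShell i σ (2 * R), ‖g x - c‖ₑ ^ r := by
        gcongr
        exact pow_le_one' (by norm_num) _
    _ ≤ _ := by
        rw [one_mul]; exact lintegral_mono_set (axisShell_two_mul_subset hσ hR)

theorem shellNorm_le_two_mul (hσ : σ = 1 ∨ σ = -1) (hr : 1 ≤ r) (hg : Measurable g) (hR : 0 < R)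
    (hτ : 0 < d + τ * r) :
    shellNorm r τ g i σ R ≤ 2 ^ (-(d + τ * r) / r) * shellNorm r τ g i σ (2 * R) +
      (1 - 2 ^ (-(d + τ * r) / r)) ^ (1 - r) * 2 ^ (r - 1) * 2 * cubeOsc r τ g i σ R := by
  -- Doubling the scale multiplies the norm by 2^{d + τ r} up to oscillation. With θ^r equal to the
  -- inverse of that factor, the convexity constant θ^{1-r} leaves exactly θ < 1.
  set θ : ℝ≥0∞ := 2 ^ (-(d + τ * r) / r) with hθ
  have hr0 : 0 < r := by linarith
  have hθ1 : θ < 1 := ENNReal.rpow_lt_one_of_one_lt_of_neg (by norm_num)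
    (div_neg_of_neg_of_pos (by linarith) hr0)
  have hθ0 : θ ≠ 0 := by simp [hθ]
  have h := lintegral_enorm_rpow_le_of_sub (volume.restrict (axisShell i σ R)) hg
    (hg.comp (measurable_const_smul (2:ℝ))) (⨍ z in axisCube i σ R, g z) hθ0 hθ1 hr
  have h2 := mul_le_mul_right (h.trans (add_le_add_right (mul_le_mul_right
    (setLIntegral_axisShell_sub_add_le hσ hg hR _) _) _)) (ENNReal.ofReal R ^ (τ * r))
  refine h2.trans (le_of_eq ?_)
  rw [shellNorm_two_mul hg hR, cubeOsc]
  have hθ2 : θ ^ (1 - r) = θ * 2 ^ (d + τ * r) := by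
    rw [hθ, ← ENNReal.rpow_mul, ← ENNReal.rpow_add _ _ (by norm_num) (by norm_num)]
    congr 1
    field_simp
    ring
  rw [hθ2]
  simp only [Function.comp_apply]
  ring

theorem shellNorm_two_mul_le (hσ : σ = 1 ∨ σ = -1) (hr : 1 ≤ r) (hg : Measurable g) (hR : 0 < R)
    (hτ : d + τ * r < 0) :
    shellNorm r τ g i σ (2 * R) ≤ 2 ^ ((d + τ * r) / r) * shellNorm r τ g i σ R +
      2 ^ (d + τ * r) * ((1 - 2 ^ ((d + τ * r) / r)) ^ (1 - r) * 2 ^ (r - 1) * 2) *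
        cubeOsc r τ g i σ R := by
  set θ : ℝ≥0∞ := 2 ^ ((d + τ * r) / r) with hθ
  have hr0 : 0 < r := by linarith
  have hθ1 : θ < 1 := ENNReal.rpow_lt_one_of_one_lt_of_neg (by norm_num)
    (div_neg_of_neg_of_pos hτ hr0)
  have hθ0 : θ ≠ 0 := by simp [hθ]
  have h := lintegral_enorm_rpow_le_of_sub (volume.restrict (axisShell i σ R))
    (hg.comp (measurable_const_smul (2:ℝ))) hg (⨍ z in axisCube i σ R, g z) hθ0 hθ1 hr
  rw [add_comm (∫⁻ _ in _, _)] at h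
  have h2 := mul_le_mul_right (h.trans (add_le_add_right (mul_le_mul_right
    (setLIntegral_axisShell_sub_add_le hσ hg hR _) _) _)) (ENNReal.ofReal R ^ (τ * r))
  rw [shellNorm_two_mul hg hR]
  refine (mul_le_mul_right h2 _).trans (le_of_eq ?_)
  rw [shellNorm, cubeOsc]
  have hθ2 : 2 ^ (d + τ * r) * θ ^ (1 - r) = θ := by
    rw [hθ, ← ENNReal.rpow_mul, ← ENNReal.rpow_add _ _ (by norm_num) (by norm_num)]
    congr 1
    field_simp
    ring
  simp only [mul_add]
  congr 1
  · conv_rhs => rw [← hθ2]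
    ring
  · ring

end

/-- For positive d + τr small scales are controlled by larger ones, and the chain starts outside the
support. For negative d + τr the chain goes outwards from the neighborhood of the origin where g
vanishes. -/
theorem exists_tsum_shellNorm_le {r τ : ℝ} (hr : 1 ≤ r) :
    ∃ K : ℝ≥0∞, K ≠ ⊤ ∧ ∀ (g : EuclideanSpace ℝ (Fin d) → 𝕜), Measurable g →
      ((0 < d + τ * r ∧ ∃ ρ : ℝ, ∀ᵐ x, ρ < ‖x‖ → g x = 0) ∨
        (d + τ * r < 0 ∧ ∃ ρ : ℝ, 0 < ρ ∧ ∀ᵐ x, ‖x‖ < ρ → g x = 0)) →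
      ∀ (i : Fin d) (σ : ℝ), (σ = 1 ∨ σ = -1) →
        ∑' k : ℤ, shellNorm r τ g i σ (2 ^ k) ≤ K * ∑' k : ℤ, cubeOsc r τ g i σ (2 ^ k) := by
  have hr0 : 0 < r := by linarith
  have hfin : ∀ θ : ℝ≥0∞, θ < 1 → (1 - θ) ^ (1 - r) * 2 ^ (r - 1) * 2 ≠ ⊤ ∧ (1 - θ)⁻¹ ≠ ⊤ := by
    intro θ hθ
    have h0 : 1 - θ ≠ 0 := (tsub_pos_of_lt hθ).ne'
    refine ⟨ENNReal.mul_ne_top (ENNReal.mul_ne_top (ENNReal.rpow_ne_top_of_ne_zero h0 (by finiteness))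
      (ENNReal.rpow_ne_top_of_ne_zero (by norm_num) (by norm_num))) (by norm_num), by simpa using h0⟩
  have h2z : ∀ k : ℤ, (2:ℝ) ^ (k + 1) = 2 * 2 ^ k := fun k => by
    rw [zpow_add₀ (by norm_num)]; ring
  rcases lt_or_ge 0 (d + τ * r) with hpos | hneg
  · set θ : ℝ≥0∞ := 2 ^ (-(d + τ * r) / r)
    have hθ1 : θ < 1 := ENNReal.rpow_lt_one_of_one_lt_of_neg (by norm_num)
      (div_neg_of_neg_of_pos (by linarith) hr0)
    refine ⟨(1 - θ)⁻¹ * ((1 - θ) ^ (1 - r) * 2 ^ (r - 1) * 2),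
      ENNReal.mul_ne_top (hfin θ hθ1).2 (hfin θ hθ1).1, fun g hg h i σ hσ => ?_⟩
    obtain ⟨ρ, hρ⟩ := (h.resolve_right fun h => by linarith [h.1]).2
    rw [mul_assoc, ← ENNReal.tsum_mul_left]
    refine ENNReal.tsum_int_le_of_le_mul_succ hθ1 (fun k => ?_) ?_
    · rw [h2z]
      exact shellNorm_le_two_mul hσ hr hg (by positivity) hpos
    · obtain ⟨n, hn⟩ := pow_unbounded_of_one_lt ρ (one_lt_two : (1:ℝ) < 2)
      refine ⟨n, fun k hk => mul_eq_zero_of_right _ ?_⟩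
      refine (setLIntegral_congr_fun_ae (g := fun _ => 0) (measurableSet_axisShell _ _ _) ?_).trans
        lintegral_zero
      filter_upwards [hρ] with x hx hxS
      have h1 : (2:ℝ) ^ n ≤ 2 ^ k := by
        rw [← zpow_natCast]; exact zpow_le_zpow_right₀ one_le_two hk
      have h2 : |x i| ≤ ‖x‖ := PiLp.norm_apply_le x i
      have h3 : σ * x i ≤ |x i| := by
        rcases hσ with rfl | rfl
        · rw [one_mul]; exact le_abs_self _
        · rw [neg_one_mul]; exact neg_le_abs _
      rw [hx (by linarith [hxS.1])]
      simp [hr0]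
  · set θ : ℝ≥0∞ := 2 ^ ((d + τ * r) / r) with hθ
    rcases hneg.lt_or_eq with hneg | hzero
    swap
    -- In the borderline case neither alternative of the support hypothesis can hold, and any
    -- constant works.
    · exact ⟨0, by simp, fun g _ h => by rcases h with h | h <;> linarith [h.1]⟩
    have hθ1 : θ < 1 := ENNReal.rpow_lt_one_of_one_lt_of_neg (by norm_num)
      (div_neg_of_neg_of_pos hneg hr0)
    refine ⟨(1 - θ)⁻¹ * (2 ^ (d + τ * r) * ((1 - θ) ^ (1 - r) * 2 ^ (r - 1) * 2)),
      ENNReal.mul_ne_top (hfin θ hθ1).2 (ENNReal.mul_ne_top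
        (ENNReal.rpow_ne_top_of_ne_zero (by norm_num) (by norm_num)) (hfin θ hθ1).1),
      fun g hg h i σ hσ => ?_⟩
    obtain ⟨ρ, hρ0, hρ⟩ := (h.resolve_left fun h => by linarith [h.1]).2
    rw [mul_assoc, ← ENNReal.tsum_mul_left]
    refine ENNReal.tsum_int_le_of_succ_le_mul hθ1 (fun k => ?_) ?_
    · rw [h2z]
      exact shellNorm_two_mul_le hσ hr hg (by positivity) hneg
    · obtain ⟨n, hn⟩ := pow_unbounded_of_one_lt (10 * d / ρ) (one_lt_two : (1:ℝ) < 2)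
      refine ⟨-n, fun k hk => mul_eq_zero_of_right _ ?_⟩
      refine (setLIntegral_congr_fun_ae (g := fun _ => 0) (measurableSet_axisShell _ _ _) ?_).trans
        lintegral_zero
      filter_upwards [hρ] with x hx hxS
      have h1 : (2:ℝ) ^ k ≤ (2 ^ n)⁻¹ := by
        rw [← zpow_natCast, ← zpow_neg]; exact zpow_le_zpow_right₀ one_le_two hk
      have h2 := norm_le_of_mem_axisCube hσ (by positivity)
        (axisShell_subset hσ (by positivity) hxS)
      have h3 : 10 * (d:ℝ) * 2 ^ k < ρ := by
        rw [div_lt_iff₀ hρ0] at hn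
        calc 10 * (d:ℝ) * 2 ^ k ≤ 10 * d * (2 ^ n)⁻¹ := by gcongr
          _ < ρ := by rw [← div_eq_mul_inv, div_lt_iff₀ (by positivity)]; linarith
      rw [hx (by linarith)]
      simp [hr0]

end Telescoping

/-! ### Summation over scales -/

section ScaleSum

/-- The two bounds cross where ρ^k is about 1/S. On either side of the crossing one of them is
geometric, so S only shifts the position of the peak and drops out of the sum. -/
theorem ENNReal.tsum_int_le_of_two_sided {f : ℤ → ℝ≥0∞} {ρ S C : ℝ≥0∞} (hρ : 1 < ρ) (hρt : ρ ≠ ⊤)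
    (hS : S ≠ 0) (hSt : S ≠ ⊤) (h1 : ∀ k, f k ≤ C * (ρ ^ k * S))
    (h2 : ∀ k, f k ≤ C * (ρ ^ k * S)⁻¹) :
    ∑' k, f k ≤ C * (ρ * (1 - ρ⁻¹)⁻¹ + (1 - ρ⁻¹)⁻¹) := by
  have hρ0 : ρ ≠ 0 := (zero_lt_one.trans hρ).ne'
  obtain ⟨n, hn, hn'⟩ := ENNReal.exists_mem_Ico_zpow (x := S⁻¹) (by simpa using hSt)
    (by simpa using hS) hρ hρt
  have hz0 : ∀ k : ℤ, ρ ^ k ≠ 0 := fun k => by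
    rw [← ENNReal.rpow_intCast]
    exact (ENNReal.rpow_pos (pos_iff_ne_zero.2 hρ0) hρt).ne'
  have hzt : ∀ k : ℤ, ρ ^ k ≠ ⊤ := fun k => by
    rw [← ENNReal.rpow_intCast]; exact ENNReal.rpow_ne_top_of_ne_zero hρ0 hρt
  have hneg : ∀ j : ℕ, ρ ^ (-(j:ℤ)) = ρ⁻¹ ^ j := fun j => by
    rw [ENNReal.zpow_neg, zpow_natCast, ENNReal.inv_pow]
  have hA : ρ ^ n * S ≤ 1 := by
    calc ρ ^ n * S ≤ S⁻¹ * S := by gcongr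
      _ ≤ 1 := ENNReal.inv_mul_le_one S
  have hB : (ρ ^ n * S)⁻¹ ≤ ρ := by
    rw [ENNReal.mul_inv (Or.inl (hz0 n)) (Or.inl (hzt n))]
    calc (ρ ^ n)⁻¹ * S⁻¹ ≤ (ρ ^ n)⁻¹ * ρ ^ (n + 1) := by gcongr
      _ = ρ := by
        rw [ENNReal.zpow_add hρ0 hρt, ← mul_assoc, ENNReal.inv_mul_cancel (hz0 n) (hzt n), one_mul,
          zpow_one]
  refine (ENNReal.tsum_int_le f n).trans ?_
  rw [mul_add]
  refine add_le_add ?_ ?_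
  · rw [← ENNReal.tsum_geometric, ← ENNReal.tsum_mul_left, ← ENNReal.tsum_mul_left]
    refine ENNReal.tsum_le_tsum fun j => (h2 _).trans (mul_le_mul_right ?_ _)
    rw [ENNReal.zpow_add hρ0 hρt, mul_assoc, mul_comm _ S, ← mul_assoc,
      ENNReal.mul_inv (Or.inr (hzt _)) (Or.inr (hz0 _)), ← ENNReal.zpow_neg, hneg]
    gcongr
  · rw [← ENNReal.tsum_geometric, ← ENNReal.tsum_mul_left]
    refine ENNReal.tsum_le_tsum fun j => (h1 _).trans (mul_le_mul_right ?_ _)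
    rw [sub_eq_add_neg, ENNReal.zpow_add hρ0 hρt, hneg, mul_right_comm]
    calc _ ≤ 1 * ρ⁻¹ ^ j := by gcongr
      _ = _ := one_mul _

/-- The perturbation moves along the line on which β₁p + 2β₂q is constant. The new γ is defined by
the scaling relation, and all requirements are strict at t = 0, hence stable for small t. The sign
of δ is adapted to that of X. -/
theorem exists_perturbed_exponents {d s p q α β₁ β₂ γ γ' X : ℝ} (hd : 0 < d)
    (hβ₁ : 0 < β₁) (hβ₂ : 0 < β₂) (hγ' : 0 < γ')
    (hγ : (d - s * p) * β₁ + (d + α) * β₂ = d / γ) (hγγ' : γ' < γ) (hβγ : 1 < β₁ * γ + β₂ * γ)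
    (hX : X ≠ 0) :
    ∃ δ : ℝ, 0 < δ * X ∧ ∀ t : ℝ, t = δ ∨ t = -δ → 0 < β₁ + t / p ∧ 0 < β₂ - t / (2 * q) ∧
      ∃ γt : ℝ, γ' ≤ γt ∧ (d - s * p) * (β₁ + t / p) + (d + α) * (β₂ - t / (2 * q)) = d / γt ∧
        1 ≤ (β₁ + t / p) * γt + (β₂ - t / (2 * q)) * γt := by
  have hγ0 : 0 < γ := hγ'.trans hγγ'
  set D : ℝ → ℝ := fun t => (d - s * p) * (β₁ + t / p) + (d + α) * (β₂ - t / (2 * q)) with hD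
  have hD0 : D 0 = d / γ := by simp [hD, hγ]
  have hDc : Continuous D := by fun_prop
  have ev1 : ∀ᶠ t in 𝓝 (0:ℝ), 0 < β₁ + t / p :=
    (by fun_prop : Continuous fun t => β₁ + t / p).continuousAt.eventually (lt_mem_nhds (by simpa))
  have ev2 : ∀ᶠ t in 𝓝 (0:ℝ), 0 < β₂ - t / (2 * q) :=
    (by fun_prop : Continuous fun t => β₂ - t / (2 * q)).continuousAt.eventually
      (lt_mem_nhds (by simpa))
  have ev3 : ∀ᶠ t in 𝓝 (0:ℝ), 0 < D t :=
    hDc.continuousAt.eventually (lt_mem_nhds (by rw [hD0]; positivity))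
  have ev4 : ∀ᶠ t in 𝓝 (0:ℝ), D t < d / γ' :=
    hDc.continuousAt.eventually (gt_mem_nhds (by rw [hD0]; gcongr))
  have ev5 : ∀ᶠ t in 𝓝 (0:ℝ), 0 < d * (β₁ + t / p + (β₂ - t / (2 * q))) - D t := by
    refine (by fun_prop : Continuous fun t => d * (β₁ + t / p + (β₂ - t / (2 * q))) - D t).continuousAt.eventually
      (lt_mem_nhds ?_)
    simp only [hD0, zero_div, add_zero, sub_zero]
    rw [sub_pos, div_lt_iff₀ hγ0]
    nlinarith
  obtain ⟨ε, hε, h⟩ := Metric.eventually_nhds_iff.1 (ev1.and (ev2.and (ev3.and (ev4.and ev5))))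
  have main : ∀ t : ℝ, |t| < ε → 0 < β₁ + t / p ∧ 0 < β₂ - t / (2 * q) ∧
      ∃ γt : ℝ, γ' ≤ γt ∧ (d - s * p) * (β₁ + t / p) + (d + α) * (β₂ - t / (2 * q)) = d / γt ∧
        1 ≤ (β₁ + t / p) * γt + (β₂ - t / (2 * q)) * γt := by
    intro t ht
    obtain ⟨h1, h2, h3, h4, h5⟩ := h (y := t) (by rwa [Real.dist_eq, sub_zero])
    refine ⟨h1, h2, d / D t, ?_, ?_, ?_⟩
    · rw [le_div_iff₀ h3, mul_comm, ← le_div_iff₀ hγ']; exact h4.le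
    · change D t = _
      field_simp
    · rw [← add_mul, mul_div_assoc', le_div_iff₀ h3]
      linarith
  refine ⟨if 0 < X then ε / 2 else -(ε / 2), ?_, fun t ht => main t ?_⟩
  · split_ifs with h0
    · positivity
    · have : X < 0 := lt_of_le_of_ne (not_lt.1 h0) hX
      nlinarith
  · have h2 : |ε / 2| = ε / 2 := abs_of_pos (by positivity)
    rcases ht with rfl | rfl <;> split_ifs <;> simp only [abs_neg, neg_neg, h2] <;> linarith

variable {d : ℕ}

/-- Either the exponents at γ' already allow discrete Hölder over the scales, or the estimate at one
scale is applied with two perturbed pairs of exponents, whose scale factors 2^{±kδX} give geometric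
summability. -/
theorem exists_tsum_cubeOsc_le (hd : 1 ≤ d) (𝕜 : Type*) [RCLike 𝕜]
    {s p q α β₁ β₂ γ γ' α₁ α₂ τ' : ℝ}
    (hp : 1 ≤ p) (hq : 1 ≤ q) (hα₀ : 0 < α) (hαd : α < d)
    (hβ₁ : 0 < β₁) (hβ₂ : 0 < β₂) (hγ'0 : 0 < γ') (hγγ' : γ' ≤ γ)
    (hγ : (d - s * p) * β₁ + (d + α) * β₂ = d / γ) (hβ : β₁ * p + 2 * β₂ * q = 1)
    (hscale : 1 / γ' + τ' / d = 1 / γ + (β₁ * p * α₁ + β₂ * q * α₂) / d)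
    (hcond : 1 ≤ β₁ * γ' + β₂ * γ' ∨
      (1 / p * (s * p - d - α₁ * p) + 1 / (2 * q) * (α + d + α₂ * q) ≠ 0 ∧
        1 < β₁ * γ + β₂ * γ))
    {A B : ℝ≥0∞} (hA : A ≠ ⊤) (hB : B ≠ ⊤) :
    ∃ C : ℝ≥0∞, C ≠ ⊤ ∧ ∀ (g : EuclideanSpace ℝ (Fin d) → 𝕜)
      (m n : Measure (EuclideanSpace ℝ (Fin d) × EuclideanSpace ℝ (Fin d))), Measurable g →
      HasWeightedPoincare A s p α₁ g m → HasWeightedCoulomb B α q α₂ g n →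
      ∀ (i : Fin d) (σ : ℝ), (σ = 1 ∨ σ = -1) →
      (∀ R : ℝ, 0 < R → IntegrableOn g (axisCube i σ R)) →
      ∑' k : ℤ, cubeOsc γ' τ' g i σ (2 ^ k) ≤
        C * (m Set.univ ^ β₁ * n Set.univ ^ β₂) ^ γ' := by
  have hd0 : (0:ℝ) < d := by exact_mod_cast hd
  have hγ0 : 0 < γ := hγ'0.trans_le hγγ'
  have hp0 : 0 < p := by linarith
  have hq0 : 0 < q := by linarith
  have he : d / γ' + τ' - d / γ - (β₁ * p * α₁ + β₂ * q * α₂) = 0 := by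
    have : (d:ℝ) * (1 / γ' + τ' / d) = d * (1 / γ + (β₁ * p * α₁ + β₂ * q * α₂) / d) := by
      rw [hscale]
    rw [mul_add, mul_add, mul_div_cancel₀ _ hd0.ne', mul_div_cancel₀ _ hd0.ne', mul_one_div,
      mul_one_div] at this
    linarith
  by_cases hca : 1 ≤ β₁ * γ' + β₂ * γ'
  · have hβγ : 1 ≤ β₁ * γ + β₂ * γ := hca.trans (by gcongr)
    obtain ⟨C, hC, h⟩ := exists_axisCube_estimate hd 𝕜 (e := 0) (τ' := τ') (α₁ := α₁) (α₂ := α₂)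
      hp hq hα₀ hαd hβ₁ hβ₂ hγ'0 hγγ' hγ hβ hβγ hA hB he.symm
    refine ⟨C * (5 ^ (β₁ * γ') * 5 ^ (β₂ * γ')), by
      refine ENNReal.mul_ne_top hC (ENNReal.mul_ne_top ?_ ?_) <;>
        exact ENNReal.rpow_ne_top_of_nonneg (by positivity) (by norm_num), ?_⟩
    intro g m n hg hm hn i σ hσ hint
    calc ∑' k : ℤ, cubeOsc γ' τ' g i σ (2 ^ k)
        ≤ ∑' k : ℤ, C * (m (axisCube i σ (2 ^ k) ×ˢ axisCube i σ (2 ^ k)) ^ (β₁ * γ') *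
            n (axisCube i σ (2 ^ k) ×ˢ axisCube i σ (2 ^ k)) ^ (β₂ * γ')) := by
          refine ENNReal.tsum_le_tsum fun k => ?_
          refine (h g m n hg hm hn i σ (2 ^ k) hσ (by positivity) (hint _ (by positivity))).trans
            (le_of_eq ?_)
          rw [ENNReal.rpow_zero, one_mul, ENNReal.mul_rpow_of_nonneg _ _ hγ'0.le,
            ← ENNReal.rpow_mul, ← ENNReal.rpow_mul]
      _ ≤ C * ((5 * m Set.univ) ^ (β₁ * γ') * (5 * n Set.univ) ^ (β₂ * γ')) := by
          rw [ENNReal.tsum_mul_left]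
          gcongr
          refine (ENNReal.tsum_rpow_mul_rpow_le _ _ (by positivity) (by positivity) hca).trans ?_
          gcongr
          · exact tsum_axisCube_le hσ m
          · exact tsum_axisCube_le hσ n
      _ = _ := by
          rw [ENNReal.mul_rpow_of_nonneg _ _ hγ'0.le, ← ENNReal.rpow_mul, ← ENNReal.rpow_mul,
            ENNReal.mul_rpow_of_nonneg _ _ (by positivity),
            ENNReal.mul_rpow_of_nonneg _ _ (by positivity)]
          ring
  obtain ⟨hX, hβγ⟩ := hcond.resolve_left hca
  -- Strictness leaves room for the perturbed γ to remain above γ'.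
  have hlt : γ' < γ := lt_of_le_of_ne hγγ' fun h => hca (by rw [h]; exact hβγ.le)
  set X := 1 / p * (s * p - d - α₁ * p) + 1 / (2 * q) * (α + d + α₂ * q) with hXdef
  obtain ⟨δ, hδX, hδ⟩ := exists_perturbed_exponents (p := p) (q := q) hd0 hβ₁ hβ₂ hγ'0 hγ
    hlt hβγ hX
  have key : ∀ t : ℝ, t = δ ∨ t = -δ → ∃ C : ℝ≥0∞, C ≠ ⊤ ∧ ∀ (g : EuclideanSpace ℝ (Fin d) → 𝕜)
      (m n : Measure (EuclideanSpace ℝ (Fin d) × EuclideanSpace ℝ (Fin d))), Measurable g →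
      HasWeightedPoincare A s p α₁ g m → HasWeightedCoulomb B α q α₂ g n →
      ∀ (i : Fin d) (σ : ℝ), (σ = 1 ∨ σ = -1) →
      (∀ R : ℝ, 0 < R → IntegrableOn g (axisCube i σ R)) →
      ∀ k : ℤ, cubeOsc γ' τ' g i σ (2 ^ k) ≤ C * (((2:ℝ≥0∞) ^ k) ^ (t * X) *
        (m Set.univ ^ (β₁ + t / p) * n Set.univ ^ (β₂ - t / (2 * q)))) ^ γ' := by
    intro t ht
    obtain ⟨h1, h2, γt, h3, h4, h5⟩ := hδ t ht
    obtain ⟨C, hC, h⟩ := exists_axisCube_estimate hd 𝕜 (e := t * X) (τ' := τ') (α₁ := α₁)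
      (α₂ := α₂) hp hq hα₀ hαd h1 h2 hγ'0 h3 h4 (by rw [← hβ]; field_simp; ring) h5 hA hB
      (by
        rw [← h4]
        have h6 : d / γ' + τ' = d / γ + (β₁ * p * α₁ + β₂ * q * α₂) := by linarith
        rw [h6, ← hγ, hXdef]
        field_simp
        ring)
    refine ⟨C, hC, fun g m n hg hm hn i σ hσ hint k => ?_⟩
    refine (h g m n hg hm hn i σ (2 ^ k) hσ (by positivity) (hint _ (by positivity))).trans ?_
    rw [ENNReal.ofReal_two_zpow]
    gcongr <;> exact Set.subset_univ _
  obtain ⟨C₁, hC₁, h₁⟩ := key δ (Or.inl rfl)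
  obtain ⟨C₂, hC₂, h₂⟩ := key (-δ) (Or.inr rfl)
  have hδ₁ := hδ δ (Or.inl rfl)
  have hδ₂ := hδ (-δ) (Or.inr rfl)
  set ρ : ℝ≥0∞ := 2 ^ (δ * X * γ') with hρdef
  have hρ : 1 < ρ := ENNReal.one_lt_rpow (by norm_num) (by positivity)
  have hρt : ρ ≠ ⊤ := ENNReal.rpow_ne_top_of_ne_zero (by norm_num) (by norm_num)
  have hGt : ρ * (1 - ρ⁻¹)⁻¹ + (1 - ρ⁻¹)⁻¹ ≠ ⊤ := by
    have h1 : 1 - ρ⁻¹ ≠ 0 := (tsub_pos_of_lt (ENNReal.inv_lt_one.2 hρ)).ne'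
    have h2 : (1 - ρ⁻¹)⁻¹ ≠ ⊤ := by simpa using h1
    exact ENNReal.add_ne_top.2 ⟨ENNReal.mul_ne_top hρt h2, h2⟩
  refine ⟨(C₁ + C₂ + 1) * (ρ * (1 - ρ⁻¹)⁻¹ + (1 - ρ⁻¹)⁻¹),
    ENNReal.mul_ne_top (by finiteness) hGt, fun g m n hg hm hn i σ hσ hint => ?_⟩
  have b₁ := h₁ g m n hg hm hn i σ hσ hint
  have b₂ := h₂ g m n hg hm hn i σ hσ hint
  set M := m Set.univ
  set N := n Set.univ
  -- Degenerate energies are removed because below they are raised to negative powers. A vanishing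
  -- one kills every oscillation since the perturbed exponents are positive.
  by_cases hM0 : M = 0
  · have : ∀ k : ℤ, cubeOsc γ' τ' g i σ (2 ^ k) = 0 := fun k => by
      have := b₁ k
      rw [hM0, ENNReal.zero_rpow_of_pos hδ₁.1, zero_mul, mul_zero,
        ENNReal.zero_rpow_of_pos hγ'0, mul_zero] at this
      exact le_zero_iff.1 this
    simp [this]
  by_cases hN0 : N = 0
  · have : ∀ k : ℤ, cubeOsc γ' τ' g i σ (2 ^ k) = 0 := fun k => by
      have := b₁ k
      rw [hN0, ENNReal.zero_rpow_of_pos hδ₁.2.1, mul_zero, mul_zero,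
        ENNReal.zero_rpow_of_pos hγ'0, mul_zero] at this
      exact le_zero_iff.1 this
    simp [this]
  have hG0 : (C₁ + C₂ + 1) * (ρ * (1 - ρ⁻¹)⁻¹ + (1 - ρ⁻¹)⁻¹) ≠ 0 := by
    have h2 : (1 - ρ⁻¹)⁻¹ ≠ 0 := by simp
    simp [h2]
  have hpos : ∀ x : ℝ≥0∞, x ≠ 0 → ∀ t : ℝ, 0 < t → x ^ t ≠ 0 := fun x hx t ht => by
    simp [hx, ht.not_gt]
  by_cases hMt : M = ⊤
  · rw [hMt, ENNReal.top_rpow_of_pos hβ₁, ENNReal.top_mul (hpos _ hN0 _ hβ₂),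
      ENNReal.top_rpow_of_pos hγ'0, ENNReal.mul_top hG0]
    exact le_top
  by_cases hNt : N = ⊤
  · rw [hNt, ENNReal.top_rpow_of_pos hβ₂, ENNReal.mul_top (hpos _ hM0 _ hβ₁),
      ENNReal.top_rpow_of_pos hγ'0, ENNReal.mul_top hG0]
    exact le_top
  have hMr : ∀ t : ℝ, M ^ t ≠ 0 ∧ M ^ t ≠ ⊤ := fun t =>
    ⟨by simp [hM0, hMt], ENNReal.rpow_ne_top_of_ne_zero hM0 hMt⟩
  have hNr : ∀ t : ℝ, N ^ t ≠ 0 ∧ N ^ t ≠ ⊤ := fun t =>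
    ⟨by simp [hN0, hNt], ENNReal.rpow_ne_top_of_ne_zero hN0 hNt⟩
  -- The surplus of the perturbed product over the unperturbed one for t = δ; for t = -δ it is the
  -- inverse.
  set S : ℝ≥0∞ := M ^ (δ / p * γ') * N ^ (-(δ / (2 * q)) * γ') with hS
  have hS0 : S ≠ 0 := mul_ne_zero (hMr _).1 (hNr _).1
  have hSt : S ≠ ⊤ := ENNReal.mul_ne_top (hMr _).2 (hNr _).2
  have hrew : ∀ (t : ℝ) (k : ℤ), (((2:ℝ≥0∞) ^ k) ^ (t * X) *
      (M ^ (β₁ + t / p) * N ^ (β₂ - t / (2 * q)))) ^ γ' = (M ^ β₁ * N ^ β₂) ^ γ' *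
      (2 ^ (k * (t * X * γ')) * (M ^ (t / p * γ') * N ^ (-(t / (2 * q)) * γ'))) := by
    intro t k
    rw [← ENNReal.rpow_intCast, ENNReal.rpow_add _ _ hM0 hMt, sub_eq_add_neg,
      ENNReal.rpow_add _ _ hN0 hNt]
    simp only [ENNReal.mul_rpow_of_nonneg _ _ hγ'0.le, ← ENNReal.rpow_mul]
    rw [show (k:ℝ) * (t * X) * γ' = k * (t * X * γ') by ring]
    ring
  have hρk : ∀ k : ℤ, ρ ^ k = 2 ^ (k * (δ * X * γ')) := fun k => by
    rw [← ENNReal.rpow_intCast, hρdef, ← ENNReal.rpow_mul, mul_comm]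
  calc ∑' k : ℤ, cubeOsc γ' τ' g i σ (2 ^ k)
      ≤ ((C₁ + C₂ + 1) * (M ^ β₁ * N ^ β₂) ^ γ') * (ρ * (1 - ρ⁻¹)⁻¹ + (1 - ρ⁻¹)⁻¹) := by
        refine ENNReal.tsum_int_le_of_two_sided hρ hρt hS0 hSt (fun k => ?_) fun k => ?_
        · refine (b₁ k).trans ?_
          rw [hrew, hρk, mul_assoc (C₁ + C₂ + 1)]
          gcongr
          rw [add_assoc]; exact le_self_add
        · refine (b₂ k).trans ?_
          rw [hrew, hρk, mul_assoc (C₁ + C₂ + 1)]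
          have hinv : 2 ^ (k * (-δ * X * γ')) * (M ^ (-δ / p * γ') * N ^ (-(-δ / (2 * q)) * γ')) =
              (2 ^ (k * (δ * X * γ')) * S)⁻¹ := by
            have h2 : (2:ℝ≥0∞) ^ (k * (δ * X * γ')) ≠ 0 := by simp
            have h2t : (2:ℝ≥0∞) ^ (k * (δ * X * γ')) ≠ ⊤ :=
              ENNReal.rpow_ne_top_of_ne_zero (by norm_num) (by norm_num)
            rw [ENNReal.mul_inv (Or.inl h2) (Or.inl h2t), hS,
              ENNReal.mul_inv (Or.inl (hMr _).1) (Or.inl (hMr _).2), ← ENNReal.rpow_neg,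
              ← ENNReal.rpow_neg, ← ENNReal.rpow_neg]
            congr 2
            · ring
            · congr 1; ring
            · congr 1; ring
          rw [hinv]
          gcongr
          rw [add_comm C₁, add_assoc]; exact le_self_add
    _ = _ := by ring

end ScaleSum

/-! ### Weighted energies, null sets and the global estimate -/

section WeightedEnergy

variable {d : ℕ} {𝕜 : Type*} [RCLike 𝕜]

theorem ae_ne_of_one_le (hd : 1 ≤ d) (a : EuclideanSpace ℝ (Fin d)) : ∀ᵐ x, x ≠ a := by
  have : Nonempty (Fin d) := ⟨⟨0, hd⟩⟩
  exact Measure.ae_ne volume a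

/-- At a zero base with negative exponent the real power is 0 and the extended one is ∞; this is the
only discrepancy, and it occurs on null sets in the energies. -/
theorem ofReal_norm_rpow {F : Type*} [NormedAddCommGroup F] {x : F} {t : ℝ} (h : x ≠ 0 ∨ 0 ≤ t) :
    ENNReal.ofReal (‖x‖ ^ t) = ‖x‖ₑ ^ t := by
  rw [← ofReal_norm]
  by_cases hx : x = 0
  · exact (ENNReal.ofReal_rpow_of_nonneg (norm_nonneg _) (h.resolve_left (not_not.2 hx))).symm
  · exact (ENNReal.ofReal_rpow_of_pos (norm_pos_iff.2 hx)).symm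

theorem ofReal_norm_rpow_mul {F : Type*} [NormedAddCommGroup F] {p : ℝ} (hp : 0 ≤ p) (v : F)
    {x : EuclideanSpace ℝ (Fin d)} (hx : x ≠ 0) (t : ℝ) :
    ENNReal.ofReal (‖v‖ ^ p * ‖x‖ ^ t) = ‖v‖ₑ ^ p * ‖x‖ₑ ^ t := by
  rw [ENNReal.ofReal_mul (by positivity), ofReal_norm_rpow (Or.inr hp), ofReal_norm_rpow (Or.inl hx)]

theorem lintegral_ofReal_norm_rpow_mul (hd : 1 ≤ d) {F : Type*} [NormedAddCommGroup F] {p : ℝ}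
    (hp : 0 ≤ p) (t : ℝ) (g : EuclideanSpace ℝ (Fin d) → F) :
    ∫⁻ x, ENNReal.ofReal (‖g x‖ ^ p * ‖x‖ ^ t) = ∫⁻ x, ‖g x‖ₑ ^ p * ‖x‖ₑ ^ t := by
  refine lintegral_congr_ae ?_
  filter_upwards [ae_ne_of_one_le hd 0] with x hx
  exact ofReal_norm_rpow_mul hp _ hx t

theorem ofReal_mul_div_norm_sub {x y : EuclideanSpace ℝ (Fin d)} (hx : x ≠ 0) (hy : y ≠ 0)
    (hxy : y ≠ x) {c : ℝ} (hc : 0 ≤ c) (t₁ t₂ e : ℝ) :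
    ENNReal.ofReal (c * ‖x‖ ^ t₁ * ‖y‖ ^ t₂ / ‖x - y‖ ^ e) =
      ENNReal.ofReal c * ‖x - y‖ₑ ^ (-e) * ‖x‖ₑ ^ t₁ * ‖y‖ₑ ^ t₂ := by
  have h : c * ‖x‖ ^ t₁ * ‖y‖ ^ t₂ / ‖x - y‖ ^ e = c * ‖x - y‖ ^ (-e) * ‖x‖ ^ t₁ * ‖y‖ ^ t₂ := by
    rw [Real.rpow_neg (norm_nonneg _)]; ring
  rw [h, ENNReal.ofReal_mul (by positivity), ENNReal.ofReal_mul (by positivity),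
    ENNReal.ofReal_mul (by positivity), ofReal_norm_rpow (Or.inl (sub_ne_zero.2 hxy.symm)),
    ofReal_norm_rpow (Or.inl hx), ofReal_norm_rpow (Or.inl hy)]

theorem weightedCoulombEnergy_eq (hd : 1 ≤ d) {α q : ℝ} (hq : 0 ≤ q) (t₁ t₂ : ℝ)
    (g : EuclideanSpace ℝ (Fin d) → 𝕜) :
    weightedCoulombEnergy α q t₁ t₂ g = ∫⁻ x, ∫⁻ y, ‖g x‖ₑ ^ q * ‖g y‖ₑ ^ q *
      ‖x - y‖ₑ ^ (-(d - α)) * ‖x‖ₑ ^ (t₁ * q) * ‖y‖ₑ ^ (t₂ * q) := by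
  refine lintegral_congr_ae ?_
  filter_upwards [ae_ne_of_one_le hd 0] with x hx
  refine lintegral_congr_ae ?_
  filter_upwards [ae_ne_of_one_le hd 0, ae_ne_of_one_le hd x] with y hy hxy
  rw [ofReal_mul_div_norm_sub hx hy hxy (by positivity), ENNReal.ofReal_mul (by positivity),
    ofReal_norm_rpow (Or.inr hq), ofReal_norm_rpow (Or.inr hq)]

theorem lintegral_fractional_eq (hd : 1 ≤ d) {p : ℝ} (hp : 0 ≤ p) (e t₁ t₂ : ℝ)
    (g : EuclideanSpace ℝ (Fin d) → 𝕜) :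
    ∫⁻ x, ∫⁻ y, ENNReal.ofReal (‖g x - g y‖ ^ p * ‖x‖ ^ t₁ * ‖y‖ ^ t₂ / ‖x - y‖ ^ e) =
      ∫⁻ x, ∫⁻ y, ‖g x - g y‖ₑ ^ p * ‖x - y‖ₑ ^ (-e) * ‖x‖ₑ ^ t₁ * ‖y‖ₑ ^ t₂ := by
  refine lintegral_congr_ae ?_
  filter_upwards [ae_ne_of_one_le hd 0] with x hx
  refine lintegral_congr_ae ?_
  filter_upwards [ae_ne_of_one_le hd 0, ae_ne_of_one_le hd x] with y hy hxy
  rw [ofReal_mul_div_norm_sub hx hy hxy (by positivity), ofReal_norm_rpow (Or.inr hp)]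

theorem withDensity_prod_univ {X : Type*} [MeasurableSpace X] (μ : Measure X)
    [SFinite μ] {F : X × X → ℝ≥0∞} (hF : Measurable F) :
    (μ.prod μ).withDensity F Set.univ = ∫⁻ x, ∫⁻ y, F (x, y) ∂μ ∂μ := by
  rw [← Set.univ_prod_univ, withDensity_prod_self μ hF MeasurableSet.univ]
  simp

theorem map_diag_univ {X : Type*} [MeasurableSpace X] (μ : Measure X) (w : X → ℝ≥0∞) :
    (μ.withDensity w).map (fun x => (x, x)) Set.univ = ∫⁻ x, w x ∂μ := by
  rw [← Set.univ_prod_univ, map_diag_prod_self _ MeasurableSet.univ,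
    withDensity_apply _ MeasurableSet.univ, Measure.restrict_univ]

/-- The fundamental lemma of the calculus of variations, applied to each coordinate. It turns the
infimum defining the first order energy into the integral for any given weak gradient. -/
theorem HasWeakGradientOn.ae_eq {Ω : Set (EuclideanSpace ℝ (Fin d))}
    {g : EuclideanSpace ℝ (Fin d) → 𝕜} {G G' : EuclideanSpace ℝ (Fin d) → EuclideanSpace 𝕜 (Fin d)}
    (hΩ : IsOpen Ω) (h : HasWeakGradientOn Ω g G) (h' : HasWeakGradientOn Ω g G') :
    ∀ᵐ x, x ∈ Ω → G x = G' x := by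
  have hcomp : ∀ {H : EuclideanSpace ℝ (Fin d) → EuclideanSpace 𝕜 (Fin d)} (i : Fin d),
      LocallyIntegrableOn H Ω volume → LocallyIntegrableOn (fun x => H x i) Ω volume := by
    intro H i hH x hx
    obtain ⟨s, hs, hi⟩ := hH x hx
    refine ⟨s, hs, Integrable.mono hi ?_
      (Filter.Eventually.of_forall fun y => PiLp.norm_apply_le (H y) i)⟩
    exact (by fun_prop : Continuous fun v : EuclideanSpace 𝕜 (Fin d) => v i).comp_aestronglyMeasurable
      hi.aestronglyMeasurable
  have key : ∀ i : Fin d, ∀ᵐ x, x ∈ Ω → G x i - G' x i = 0 := by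
    intro i
    refine hΩ.ae_eq_zero_of_integral_contDiff_smul_eq_zero
      ((hcomp i h.2.1).sub (hcomp i h'.2.1)) fun φ hφ hφc hφs => ?_
    have e1 := h.2.2 φ hφ hφc hφs i
    have e2 := h'.2.2 φ hφ hφc hφs i
    rw [e1, neg_inj] at e2
    have hint : ∀ {H : EuclideanSpace ℝ (Fin d) → EuclideanSpace 𝕜 (Fin d)},
        LocallyIntegrableOn H Ω volume → Integrable (fun x => φ x • H x i) := fun {H} hH => by
      have hF := (integrable_indicator_of_locallyIntegrableOn (hcomp i hH) hφc hφs).locallyIntegrable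
        |>.integrable_smul_left_of_hasCompactSupport hφ.continuous hφc
      refine hF.congr (Filter.Eventually.of_forall fun x => ?_)
      by_cases hx : x ∈ tsupport φ
      · simp only [Set.indicator_of_mem hx]
      · simp only [image_eq_zero_of_notMem_tsupport hx, zero_smul]
    simp only [smul_sub]
    rw [integral_sub (hint h.2.1) (hint h'.2.1), e2, sub_self]
  filter_upwards [ae_all_iff.2 key] with x hx hxΩ
  ext i
  exact sub_eq_zero.1 (hx i hxΩ)

theorem HasWeakGradientOn.congr_ae {Ω : Set (EuclideanSpace ℝ (Fin d))}
    {g g' : EuclideanSpace ℝ (Fin d) → 𝕜}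
    {G : EuclideanSpace ℝ (Fin d) → EuclideanSpace 𝕜 (Fin d)} (h : HasWeakGradientOn Ω g G)
    (hg : g =ᵐ[volume] g') : HasWeakGradientOn Ω g' G := by
  refine ⟨fun x hx => ?_, h.2.1, fun φ hφ hφc hφs i => ?_⟩
  · obtain ⟨s, hs, hi⟩ := h.1 x hx
    exact ⟨s, hs, Integrable.congr hi (ae_restrict_of_ae hg)⟩
  · rw [← h.2.2 φ hφ hφc hφs i]
    refine integral_congr_ae ?_
    filter_upwards [hg] with x hx
    rw [hx]

theorem weightedSobolevEnergy_congr_ae (s p t₁ t₂ : ℝ) {g g' : EuclideanSpace ℝ (Fin d) → 𝕜}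
    (hg : g =ᵐ[volume] g') :
    weightedSobolevEnergy s p t₁ t₂ g = weightedSobolevEnergy s p t₁ t₂ g' := by
  unfold weightedSobolevEnergy
  split_ifs
  · refine lintegral_congr_ae ?_
    filter_upwards [hg] with x hx
    rw [hx]
  · refine iInf_congr fun G => iInf_congr_Prop ⟨fun h => h.congr_ae hg, fun h => h.congr_ae hg.symm⟩
      fun _ => rfl
  · refine lintegral_congr_ae ?_
    filter_upwards [hg] with x hx
    refine lintegral_congr_ae ?_
    filter_upwards [hg] with y hy
    rw [hx, hy]

theorem weightedCoulombEnergy_congr_ae (α q t₁ t₂ : ℝ) {g g' : EuclideanSpace ℝ (Fin d) → 𝕜}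
    (hg : g =ᵐ[volume] g') :
    weightedCoulombEnergy α q t₁ t₂ g = weightedCoulombEnergy α q t₁ t₂ g' := by
  refine lintegral_congr_ae ?_
  filter_upwards [hg] with x hx
  refine lintegral_congr_ae ?_
  filter_upwards [hg] with y hy
  rw [hx, hy]

theorem weightedLebesgueNorm_congr_ae (r τ : ℝ) {g g' : EuclideanSpace ℝ (Fin d) → 𝕜}
    (hg : g =ᵐ[volume] g') : weightedLebesgueNorm r τ g = weightedLebesgueNorm r τ g' := by
  unfold weightedLebesgueNorm
  congr 1
  refine lintegral_congr_ae ?_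
  filter_upwards [hg] with x hx
  rw [hx]

theorem weightedSobolevEnergy_one_eq (p t₁ t₂ : ℝ) {g : EuclideanSpace ℝ (Fin d) → 𝕜}
    (hd : 1 ≤ d) {G : EuclideanSpace ℝ (Fin d) → EuclideanSpace 𝕜 (Fin d)}
    (hG : HasWeakGradientOn {0}ᶜ g G) :
    weightedSobolevEnergy 1 p t₁ t₂ g =
      ∫⁻ x, ENNReal.ofReal (‖G x‖ ^ p * ‖x‖ ^ ((t₁ + t₂) * p)) := by
  rw [weightedSobolevEnergy, if_neg one_ne_zero, if_pos rfl]
  refine le_antisymm (iInf₂_le G hG) (le_iInf₂ fun G' hG' => le_of_eq (lintegral_congr_ae ?_))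
  filter_upwards [hG.ae_eq isOpen_compl_singleton hG', ae_ne_of_one_le hd 0] with x hx hx0
  rw [hx hx0]

/-- A finite weighted Sobolev energy is the total mass of a measure on the square that controls
the oscillation of `g` in the axis cubes. -/
theorem exists_hasWeightedPoincare (hd : 1 ≤ d) (𝕜 : Type*) [RCLike 𝕜] {s p t t₁ t₂ : ℝ}
    (hs₀ : 0 ≤ s) (hp : 1 ≤ p) (ht : t = t₁ + t₂) :
    ∃ A : ℝ≥0∞, A ≠ ⊤ ∧ ∀ g : EuclideanSpace ℝ (Fin d) → 𝕜, Measurable g →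
      weightedSobolevEnergy s p t₁ t₂ g ≠ ⊤ →
      ∃ m : Measure (EuclideanSpace ℝ (Fin d) × EuclideanSpace ℝ (Fin d)),
        HasWeightedPoincare A s p t g m ∧ m Set.univ = weightedSobolevEnergy s p t₁ t₂ g := by
  have hp0 : 0 ≤ p := by linarith
  by_cases h0 : s = 0
  · subst h0
    refine ⟨_, ?_, fun g hg _ => ⟨_, hasWeightedPoincare_zero hd (t := t) hp hg, ?_⟩⟩
    · exact ENNReal.mul_ne_top (ENNReal.mul_ne_top (by norm_num) (ENNReal.mul_ne_top (by norm_num)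
        (ENNReal.rpow_ne_top_of_nonneg hp0 (by norm_num)))) (weightConst_ne_top _ _)
    · rw [map_diag_univ, weightedSobolevEnergy, if_pos rfl, lintegral_ofReal_norm_rpow_mul hd hp0, ht]
  by_cases h1 : s = 1
  · subst h1
    obtain ⟨A, hA, h⟩ := exists_hasWeightedPoincare_one hd 𝕜 t hp
    refine ⟨A, hA, fun g hg hE => ?_⟩
    -- Finiteness of the energy supplies a gradient, since the infimum over the empty family is ∞.
    obtain ⟨G, hG⟩ : ∃ G, HasWeakGradientOn {0}ᶜ g G := by
      by_contra! hno
      rw [weightedSobolevEnergy, if_neg one_ne_zero, if_pos rfl] at hE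
      exact hE (by simp [hno])
    refine ⟨_, h g G hG hg, ?_⟩
    rw [map_diag_univ, weightedSobolevEnergy_one_eq _ _ _ hd hG,
      lintegral_ofReal_norm_rpow_mul hd hp0, ht]
  · have hs : 0 < s := lt_of_le_of_ne hs₀ (Ne.symm h0)
    refine ⟨_, ?_, fun g hg _ => ⟨_, hasWeightedPoincare_fractional hd hs hp ht hg, ?_⟩⟩
    · refine ENNReal.mul_ne_top (ENNReal.add_ne_top.2 ⟨by norm_num,
        ENNReal.rpow_ne_top_of_nonneg (by positivity) (by simp)⟩) (ENNReal.mul_ne_top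
        (weightConst_ne_top _ _) (weightConst_ne_top _ _))
    · rw [withDensity_prod_univ _ (by fun_prop), weightedSobolevEnergy, if_neg h0, if_neg h1,
        lintegral_fractional_eq hd hp0]

/-- Kernel and weights are positive almost everywhere. This settles the convention 0 · ∞ = 0: when
the Coulomb factor vanishes, the left-hand side vanishes too, whatever the Sobolev energy. -/
theorem ae_eq_zero_of_weightedCoulombEnergy_eq_zero (hd : 1 ≤ d) {α q : ℝ}
    (hq : 0 < q) (t₁ t₂ : ℝ) {g : EuclideanSpace ℝ (Fin d) → 𝕜} (hg : Measurable g)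
    (h : weightedCoulombEnergy α q t₁ t₂ g = 0) : g =ᵐ[volume] 0 := by
  have hpos : ∀ {x : EuclideanSpace ℝ (Fin d)} (t : ℝ), x ≠ 0 → ‖x‖ₑ ^ t ≠ 0 := fun {x} t hx =>
    (ENNReal.rpow_pos (enorm_pos.2 hx) enorm_ne_top).ne'
  rw [weightedCoulombEnergy_eq hd hq.le, lintegral_eq_zero_iff
    (Measurable.lintegral_prod_right' (f := fun z : EuclideanSpace ℝ (Fin d) ×
      EuclideanSpace ℝ (Fin d) => ‖g z.1‖ₑ ^ q * ‖g z.2‖ₑ ^ q * ‖z.1 - z.2‖ₑ ^ (-(d - α)) *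
        ‖z.1‖ₑ ^ (t₁ * q) * ‖z.2‖ₑ ^ (t₂ * q)) (by fun_prop))] at h
  by_contra hne
  refine hne ?_
  filter_upwards [h, ae_ne_of_one_le hd 0] with x hx hx0
  by_contra hgx
  refine hne ?_
  rw [Pi.zero_apply, lintegral_eq_zero_iff (by fun_prop)] at hx
  filter_upwards [hx, ae_ne_of_one_le hd 0, ae_ne_of_one_le hd x] with y hy hy0 hyx
  simp only [Pi.zero_apply, mul_eq_zero, hpos _ hx0, hpos _ hy0, hpos _ (sub_ne_zero.2 hyx.symm),
    or_false, ENNReal.rpow_eq_zero_iff_of_pos hq, enorm_eq_zero] at hy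
  exact hy.resolve_left hgx

theorem exists_weightedLebesgueNorm_le (hd : 1 ≤ d) (𝕜 : Type*) [RCLike 𝕜]
    {s p q α β₁ β₂ γ γ' α₁ α₂ τ' : ℝ}
    (hp : 1 ≤ p) (hq : 1 ≤ q) (hα₀ : 0 < α) (hαd : α < d)
    (hβ₁ : 0 < β₁) (hβ₂ : 0 < β₂) (hγ'₁ : 1 ≤ γ') (hγγ' : γ' ≤ γ)
    (hγ : (d - s * p) * β₁ + (d + α) * β₂ = d / γ) (hβ : β₁ * p + 2 * β₂ * q = 1)
    (hscale : 1 / γ' + τ' / d = 1 / γ + (β₁ * p * α₁ + β₂ * q * α₂) / d)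
    (hcond : 1 ≤ β₁ * γ' + β₂ * γ' ∨
      (1 / p * (s * p - d - α₁ * p) + 1 / (2 * q) * (α + d + α₂ * q) ≠ 0 ∧
        1 < β₁ * γ + β₂ * γ))
    {A B : ℝ≥0∞} (hA : A ≠ ⊤) (hB : B ≠ ⊤) :
    ∃ C : ℝ≥0∞, C ≠ ⊤ ∧ ∀ (g : EuclideanSpace ℝ (Fin d) → 𝕜)
      (m n : Measure (EuclideanSpace ℝ (Fin d) × EuclideanSpace ℝ (Fin d))), Measurable g →
      LocallyIntegrable g volume →
      HasWeightedPoincare A s p α₁ g m → HasWeightedCoulomb B α q α₂ g n →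
      ((0 < d + τ' * γ' ∧ ∃ ρ : ℝ, ∀ᵐ x, ρ < ‖x‖ → g x = 0) ∨
        (d + τ' * γ' < 0 ∧ ∃ ρ : ℝ, 0 < ρ ∧ ∀ᵐ x, ‖x‖ < ρ → g x = 0)) →
      weightedLebesgueNorm γ' τ' g ≤ C * (m Set.univ ^ β₁ * n Set.univ ^ β₂) := by
  have hγ'0 : 0 < γ' := by linarith
  obtain ⟨C, hC, h⟩ := exists_tsum_cubeOsc_le hd 𝕜 hp hq hα₀ hαd hβ₁ hβ₂ hγ'0 hγγ' hγ hβ hscale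
    hcond hA hB
  obtain ⟨K, hK, h'⟩ := exists_tsum_shellNorm_le (d := d) (𝕜 := 𝕜) (τ := τ') hγ'₁
  set W := weightConst d (τ' * γ')
  refine ⟨(W * (d * (2 * (K * C)))) ^ (1 / γ'), ENNReal.rpow_ne_top_of_nonneg (by positivity)
    (ENNReal.mul_ne_top (weightConst_ne_top _ _) (by finiteness)),
    fun g m n hg hloc hm hn hvan => ?_⟩
  have hint : ∀ (i : Fin d) (σ : ℝ), (σ = 1 ∨ σ = -1) → ∀ R : ℝ, 0 < R →
      IntegrableOn g (axisCube i σ R) := fun i σ hσ R hR =>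
    (hloc.integrableOn_isCompact (isCompact_closedBall 0 (10 * d * R))).mono_set fun x hx =>
      mem_closedBall_zero_iff.2 (norm_le_of_mem_axisCube hσ hR hx)
  rw [weightedLebesgueNorm, lintegral_ofReal_norm_rpow_mul hd hγ'0.le]
  set P := m Set.univ ^ β₁ * n Set.univ ^ β₂
  have hshell : ∀ (i : Fin d) (b : Bool) (k : ℤ),
      ∫⁻ x in axisShell i (boolSign b) (2 ^ k), ‖g x‖ₑ ^ γ' * ‖x‖ₑ ^ (τ' * γ') ≤
        W * shellNorm γ' τ' g i (boolSign b) (2 ^ k) := fun i b k => by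
    have hR : (0:ℝ) < 2 ^ k := by positivity
    have hR0 : ENNReal.ofReal (2 ^ k) ≠ 0 := by simpa using hR
    rw [shellNorm, ← mul_assoc, ← lintegral_const_mul _ (by fun_prop)]
    refine setLIntegral_mono' (measurableSet_axisShell _ _ _) fun x hx => ?_
    rw [mul_comm]
    gcongr
    exact (weight_comparison hd (boolSign_eq b) hR _
      (axisShell_subset (boolSign_eq b) hR hx)).1
  have hmain : ∫⁻ x, ‖g x‖ₑ ^ γ' * ‖x‖ₑ ^ (τ' * γ') ≤ W * (d * (2 * (K * C))) * P ^ γ' := by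
    -- The shells of all scales around the 2d half-axes cover everything but the origin. Their
    -- overlaps are harmless, as only subadditivity is used.
    calc ∫⁻ x, ‖g x‖ₑ ^ γ' * ‖x‖ₑ ^ (τ' * γ')
        = ∫⁻ x in ⋃ z : Fin d × Bool × ℤ, axisShell z.1 (boolSign z.2.1) (2 ^ z.2.2),
            ‖g x‖ₑ ^ γ' * ‖x‖ₑ ^ (τ' * γ') := by
          rw [← setLIntegral_univ]
          refine setLIntegral_congr ?_
          filter_upwards [ae_ne_of_one_le hd 0] with x hx
          obtain ⟨i, b, k, hk⟩ := exists_mem_axisShell hx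
          exact propext ⟨fun _ => Set.mem_iUnion.2 ⟨(i, b, k), hk⟩, fun _ => trivial⟩
      _ ≤ ∑' z : Fin d × Bool × ℤ, ∫⁻ x in axisShell z.1 (boolSign z.2.1) (2 ^ z.2.2),
            ‖g x‖ₑ ^ γ' * ‖x‖ₑ ^ (τ' * γ') := lintegral_iUnion_le _ _
      _ ≤ ∑' z : Fin d × Bool × ℤ, W * shellNorm γ' τ' g z.1 (boolSign z.2.1) (2 ^ z.2.2) :=
          ENNReal.tsum_le_tsum fun z => hshell _ _ _
      _ = W * ∑ i : Fin d, ∑ b : Bool, ∑' k : ℤ, shellNorm γ' τ' g i (boolSign b) (2 ^ k) := by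
          rw [ENNReal.tsum_mul_left, ENNReal.tsum_prod', tsum_fintype]
          congr 1
          refine Finset.sum_congr rfl fun i _ => ?_
          rw [ENNReal.tsum_prod', tsum_fintype]
      _ ≤ W * ∑ _i : Fin d, ∑ _b : Bool, K * (C * P ^ γ') := by
          gcongr with i _ b _
          refine (h' g hg hvan i _ (boolSign_eq b)).trans ?_
          gcongr
          exact h g m n hg hm hn i _ (boolSign_eq b) (hint i _ (boolSign_eq b))
      _ = _ := by
          simp only [Finset.sum_const, Finset.card_univ, Fintype.card_bool, Fintype.card_fin,
            nsmul_eq_mul, Nat.cast_ofNat]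
          ring
  calc _ ≤ (W * (d * (2 * (K * C))) * P ^ γ') ^ (1 / γ') :=
        ENNReal.rpow_le_rpow hmain (by positivity)
    _ = _ := by
        rw [ENNReal.mul_rpow_of_nonneg _ _ (by positivity), ← ENNReal.rpow_mul P,
          mul_one_div_cancel hγ'0.ne', ENNReal.rpow_one]

end WeightedEnergy

/-! ### The theorem -/

theorem theorem2 {𝕜 : Type*} [RCLike 𝕜] (d : ℕ) (hd : 1 ≤ d)
    (s p q α β₁ β₂ γ γ' σ τ' α₁ α₂ α₁₁ α₁₂ α₂₁ α₂₂ : ℝ)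
    (hs₀ : 0 ≤ s) (hs₁ : s ≤ 1) (hγ'₁ : 1 ≤ γ') (hp : 1 ≤ p) (hq : 1 ≤ q)
    (hα₀ : 0 < α) (hαd : α < d) (hβ₁ : 0 < β₁) (hβ₂ : 0 < β₂)
    (hα₁ : α₁ = α₁₁ + α₁₂) (hα₂ : α₂ = α₂₁ + α₂₂)
    (hσ : σ = β₁ * p * α₁ + β₂ * q * α₂)
    (hγ : (d - s * p) * β₁ + (d + α) * β₂ = d / γ)
    (hβ : β₁ * p + 2 * β₂ * q = 1)
    (hscale : 1 / γ' + τ' / d = 1 / γ + σ / d)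
    (hγγ' : γ' ≤ γ) (hγ₁ : 1 < γ)
    (hcond : 1 ≤ β₁ * γ' + β₂ * γ' ∨
      (1 / p * (s * p - d - α₁ * p) + 1 / (2 * q) * (α + d + α₂ * q) ≠ 0 ∧
        1 < β₁ * γ + β₂ * γ)) :
    ∃ C : ℝ≥0, 0 < C ∧ ∀ g : EuclideanSpace ℝ (Fin d) → 𝕜,
      ((0 < 1 / γ' + τ' / d ∧ Integrable g volume ∧
          ∃ K : Set (EuclideanSpace ℝ (Fin d)), IsCompact K ∧ ∀ᵐ x, x ∉ K → g x = 0) ∨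
        (1 / γ' + τ' / d < 0 ∧ LocallyIntegrable g volume ∧
          ∃ U ∈ 𝓝 (0 : EuclideanSpace ℝ (Fin d)), ∀ᵐ x, x ∈ U → g x = 0)) →
      weightedLebesgueNorm γ' τ' g ≤
        C * weightedSobolevSeminorm s p α₁₁ α₁₂ g ^ (p * β₁) *
          weightedCoulombEnergy α q α₂₁ α₂₂ g ^ β₂ := by
  have hd0 : (0:ℝ) < d := by exact_mod_cast hd
  have hγ'0 : 0 < γ' := by linarith
  have hp0 : 0 < p := by linarith
  have hq0 : 0 < q := by linarith
  obtain ⟨A, hA, hSob⟩ := exists_hasWeightedPoincare hd 𝕜 hs₀ hp hα₁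
  obtain ⟨C, hC, h⟩ := exists_weightedLebesgueNorm_le hd 𝕜 hp hq hα₀ hαd hβ₁ hβ₂ hγ'₁ hγγ' hγ hβ
    (hσ ▸ hscale) hcond hA
    (B := weightConst d (α₂₁ * q) * weightConst d (α₂₂ * q))
    (ENNReal.mul_ne_top (weightConst_ne_top _ _) (weightConst_ne_top _ _))
  have hsign : 1 / γ' + τ' / d = (d + τ' * γ') / (γ' * d) := by field_simp
  refine ⟨C.toNNReal + 1, by positivity, fun g hg => ?_⟩
  have hloc : LocallyIntegrable g volume := by
    rcases hg with ⟨-, hi, -⟩ | ⟨-, hi, -⟩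
    · exact hi.locallyIntegrable
    · exact hi
  have hmeas := hloc.aestronglyMeasurable
  -- All quantities and the support conditions depend only on the class of g modulo null sets, so a
  -- Borel representative may be used.
  obtain ⟨g', hg', hae⟩ : ∃ g', Measurable g' ∧ g =ᵐ[volume] g' :=
    ⟨hmeas.mk g, hmeas.stronglyMeasurable_mk.measurable, hmeas.ae_eq_mk⟩
  have hvan : (0 < d + τ' * γ' ∧ ∃ ρ : ℝ, ∀ᵐ x, ρ < ‖x‖ → g' x = 0) ∨
      (d + τ' * γ' < 0 ∧ ∃ ρ : ℝ, 0 < ρ ∧ ∀ᵐ x, ‖x‖ < ρ → g' x = 0) := by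
    rw [hsign] at hg
    rcases hg with ⟨hpos, -, K, hK, hzero⟩ | ⟨hneg, -, U, hU, hzero⟩
    · obtain ⟨ρ, hρ⟩ := hK.isBounded.subset_closedBall 0
      refine Or.inl ⟨(div_pos_iff_of_pos_right (by positivity)).1 hpos, ρ, ?_⟩
      filter_upwards [hzero, hae] with x hx hxe hlt
      rw [← hxe]
      exact hx fun hxK => absurd (mem_closedBall_zero_iff.1 (hρ hxK)) (not_le.2 hlt)
    · obtain ⟨ρ, hρ0, hρ⟩ := Metric.mem_nhds_iff.1 hU
      refine Or.inr ⟨by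
        rwa [div_lt_iff₀ (by positivity), zero_mul] at hneg, ρ, hρ0, ?_⟩
      filter_upwards [hzero, hae] with x hx hxe hlt
      rw [← hxe]
      exact hx (hρ (mem_ball_zero_iff.2 hlt))
  have hloc' : LocallyIntegrable g' volume := hloc.congr hae
  rw [weightedSobolevSeminorm, weightedLebesgueNorm_congr_ae γ' τ' hae,
    weightedSobolevEnergy_congr_ae s p α₁₁ α₁₂ hae, weightedCoulombEnergy_congr_ae α q α₂₁ α₂₂ hae,
    ← ENNReal.rpow_mul, ← mul_assoc, one_div_mul_cancel hp0.ne', one_mul, mul_assoc]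
  by_cases hN : weightedCoulombEnergy α q α₂₁ α₂₂ g' = 0
  · have hzero := ae_eq_zero_of_weightedCoulombEnergy_eq_zero hd hq0 α₂₁ α₂₂ hg' hN
    rw [weightedLebesgueNorm_congr_ae γ' τ' hzero]
    simp [weightedLebesgueNorm, Real.zero_rpow hγ'0.ne', hγ'0]
  have hC1 : C ≤ ((C.toNNReal + 1 : ℝ≥0) : ℝ≥0∞) := by
    rw [ENNReal.coe_add, ENNReal.coe_toNNReal hC]
    exact le_self_add
  -- With a nonzero Coulomb energy an infinite Sobolev energy makes the right-hand side infinite;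
  -- the constant was enlarged by 1 so that it is nonzero.
  by_cases hE : weightedSobolevEnergy s p α₁₁ α₁₂ g' = ⊤
  · have hN' : weightedCoulombEnergy α q α₂₁ α₂₂ g' ^ β₂ ≠ 0 := by
      simp [hN, hβ₂.not_gt]
    rw [hE, ENNReal.top_rpow_of_pos hβ₁, ENNReal.top_mul hN', ENNReal.mul_top (by simp)]
    exact le_top
  obtain ⟨m, hm, hmE⟩ := hSob g' hg' hE
  have hmain := h g' m _ hg' hloc' hm (hasWeightedCoulomb_withDensity hd hα₂ hg') hvan
  rw [withDensity_prod_univ _ (by fun_prop), ← weightedCoulombEnergy_eq hd hq0.le, hmE] at hmain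
  exact hmain.trans (mul_le_mul_left hC1 _)
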